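/- Let $0\le k\le n$, let $\mathfrak g=sl(n+1)$ over $\mathbb C$ with Chevalley generators $e_i=E_{i,i+1}$, $f_i=E_{i+1,i}$, $h_i=E_{i,i}-E_{i+1,i+1}$ and simple roots $\alpha_1,\dots,\alpha_n$. Let $V_\lambda$ be the Verma module with highest weight $\lambda$, $(\lambda,\alpha_i)=\lambda_i\in\mathbb C$, and highest weight vector $v_\lambda$, and let $V_\omega=\mathbb C^{n+1}$ be the linear representation with highest weight vector $v_0$. Put $$\Phi_k(\lambda,\kappa)(t)=\prod_{j=1}^k t_j^{-\lambda_j/\kappa}\,(1-t_1)^{-1/\kappa}\prod_{j=2}^k(t_j-t_{j-1})^{-1/\kappa},\qquad s_i=\lambda_i+\dots+\lambda_k+k-i ,$$ and assume that $s_i\ne0$ and $s_i+1\neq 0$ for $i=1,\dots,k$. 1. For every $\kappa\in\mathbb C\setminus\{0\}$, the function $\Phi_k(\lambda,\kappa)$ has exactly one critical point with all $t_j\ne0$, $t_1\neq1$ and $t_j\ne t_{j-1}$ for $j\ge2$, namely $t^k=(t^k_1,\dots,t^k_k)$ with $t^k_j=\prod_{i=1}^j\frac{s_i}{s_i+1}$.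 2. Each of $V=V_\lambda$ (with $v=v_\lambda$) and $V=V_\omega$ (with $v=v_0$) has exactly one Shapovalov form, that is, a symmetric bilinear form $B$ with $B(e_ix,y)=B(x,f_iy)$ for all $i$ and all $x,y\in V$, and $B(v,v)=1$. 3. For words $I=(i_1,\dots,i_p)$ and $J=(j_1,\dots,j_q)$ let $f^I=f_{i_1}\cdots f_{i_p}$ and $$\omega_{I,J}(t)=\frac1{(t_{i_1}-t_{i_2})\cdots(t_{i_{p-1}}-t_{i_p})\,t_{i_p}}\cdot\frac1{(t_{j_1}-t_{j_2})\cdots(t_{j_{q-1}}-t_{j_q})(t_{j_q}-1)},$$ where an empty word contributes the factor $1$. The vector-valued rational function $\sum_{I,J}\omega_{I,J}(t)\,f^Iv_\lambda\otimes f^Jv_0$, where the sum is over all pairs of words that together contain each of $1,\dots,k$ exactly once, has a well-defined value $X$ at $t^k$ (its limit over points where all $\omega_{I,J}$ are defined; it is the sum itself if the coordinates of $t^k$ are pairwise distinct). The vector $X$ is the Bethe vector of weight $\lambda+\omega-\sum_{i=1}^k\alpha_i$; for $k=n$ it is $X^n(\lambda)$. 4. If $B$ is the tensor product of the Shapovalov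 forms of $V_\lambda$ and $V_\omega$, then $$B(X,X)=\det\left(\frac{\partial^2}{\partial t_i\,\partial t_j}\ln\Phi_k(\lambda,\kappa=1)(t^k)\right)_{i,j=1}^k .$$ -/

import Mathlib

open scoped TensorProduct Topology

noncomputable section

namespace BetheNorm

attribute [local instance 100] LieRing.ofAssociativeRing

/-! ### The Lie algebra `sl(n+1)` and its Chevalley generators -/

/-- The complex Lie algebra `sl(n+1)` of traceless matrices. -/
abbrev SL (n : ℕ) : LieSubalgebra ℂ (Matrix (Fin (n + 1)) (Fin (n + 1)) ℂ) :=
  LieAlgebra.SpecialLinear.sl (Fin (n + 1)) ℂ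

/-- The generator `e_i`, the matrix unit with its entry in row `i` and column `i + 1`. -/
def chevE {n : ℕ} (i : Fin n) : SL n :=
  LieAlgebra.SpecialLinear.single i.castSucc i.succ i.castSucc_lt_succ.ne 1

/-- The generator `f_i`, the matrix unit with its entry in row `i + 1` and column `i`. -/
def chevF {n : ℕ} (i : Fin n) : SL n :=
  LieAlgebra.SpecialLinear.single i.succ i.castSucc i.castSucc_lt_succ.ne' 1

/-- The generator `h_i = [e_i, f_i]`. -/
def chevH {n : ℕ} (i : Fin n) : SL n :=
  LieAlgebra.SpecialLinear.singleSubSingle i.castSucc i.succ 1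

/-! ### The Verma module and the linear representation -/

/-- The universal enveloping algebra of `sl(n+1)`. -/
abbrev Env (n : ℕ) : Type := UniversalEnvelopingAlgebra ℂ (SL n)

/-- The left ideal of the enveloping algebra generated by all `e_i` and all `h_i - λ_i`. -/
def vermaIdeal {n : ℕ} (lam : Fin n → ℂ) : Ideal (Env n) :=
  Ideal.span
    (Set.range (fun i => UniversalEnvelopingAlgebra.ι ℂ (chevE i)) ∪
      Set.range (fun i => UniversalEnvelopingAlgebra.ι ℂ (chevH i) -
        algebraMap ℂ (Env n) (lam i)))

/-- The Verma module whose highest weight `λ` has the values `λ_i = (λ, α_i)`. -/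
abbrev Verma {n : ℕ} (lam : Fin n → ℂ) : Type := Env n ⧸ vermaIdeal lam

/-- The highest weight vector of the Verma module. -/
def vermaVec {n : ℕ} (lam : Fin n → ℂ) : Verma lam := Submodule.Quotient.mk 1

/-- The action of `sl(n+1)` on the Verma module, by left multiplication. -/
def vermaRep {n : ℕ} (lam : Fin n → ℂ) : SL n →ₗ⁅ℂ⁆ Module.End ℂ (Verma lam) :=
  (Algebra.lsmul ℂ ℂ (Verma lam)).toLieHom.comp (UniversalEnvelopingAlgebra.ι ℂ)

/-- The linear representation of `sl(n+1)` on column vectors. -/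
def linRep (n : ℕ) : SL n →ₗ⁅ℂ⁆ Module.End ℂ (Fin (n + 1) → ℂ) :=
  (Matrix.toLinAlgEquiv' : Matrix (Fin (n + 1)) (Fin (n + 1)) ℂ ≃ₐ[ℂ] _).toAlgHom.toLieHom.comp
    (SL n).incl

/-- The highest weight vector of the linear representation. -/
def linVec (n : ℕ) : Fin (n + 1) → ℂ := Pi.single 0 1

/-! ### Shapovalov forms -/

/-- `B` is a Shapovalov form on the module `V` with highest weight vector `v`: it is symmetric,
`B(e_i x, y) = B(x, f_i y)` for all `i`, `x`, `y`, and `B(v, v) = 1`. -/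
structure IsShapovalovForm {n : ℕ} {V : Type*} [AddCommGroup V] [Module ℂ V]
    (ρ : SL n →ₗ⁅ℂ⁆ Module.End ℂ V) (v : V) (B : LinearMap.BilinForm ℂ V) : Prop where
  symm : ∀ x y, B x y = B y x
  contravariant : ∀ (i : Fin n) (x y : V), B (ρ (chevE i) x) y = B x (ρ (chevF i) y)
  normalized : B v v = 1

/-! ### The phase function -/

/-- The factor `1 - t_1` for the first index and `t_j - t_{j-1}` for the later ones. -/
def gap {k : ℕ} (t : Fin k → ℂ) (j : Fin k) : ℂ :=
  if h : (j : ℕ) = 0 then 1 - t j else t j - t ⟨(j : ℕ) - 1, by omega⟩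

/-- The branch near `z = a`, for `a ≠ 0`, of the complex logarithm whose value at `a` is the
principal one. -/
def localLog (a z : ℂ) : ℂ := Complex.log a + Complex.log (z / a)

/-- The branch near the point `p` of `ln Φ`, where
`Φ(t) = ∏_j t_j ^ (-μ_j / κ) * (1 - t_1) ^ (-1 / κ) * ∏_{j ≥ 2} (t_j - t_{j-1}) ^ (-1 / κ)`.
Two branches differ by a constant. -/
def logPhase {k : ℕ} (μ : Fin k → ℂ) (κ : ℂ) (p t : Fin k → ℂ) : ℂ :=
  ∑ j, (-(μ j) / κ * localLog (p j) (t j) + -1 / κ * localLog (gap p j) (gap t j))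

/-- The branch near the point `p` of the phase function `Φ`. -/
def phase {k : ℕ} (μ : Fin k → ℂ) (κ : ℂ) (p t : Fin k → ℂ) : ℂ :=
  Complex.exp (logPhase μ κ p t)

/-- `t` is a critical point of the phase function: a point off the hyperplanes on which a factor
of `Φ` vanishes, with `dΦ = 0`. -/
def IsCriticalPoint {k : ℕ} (μ : Fin k → ℂ) (κ : ℂ) (t : Fin k → ℂ) : Prop :=
  (∀ j, t j ≠ 0 ∧ gap t j ≠ 0) ∧ fderiv ℂ (phase μ κ t) t = 0

/-- The matrix of second partial derivatives of `F` at `t`. -/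
def hessian {k : ℕ} (F : (Fin k → ℂ) → ℂ) (t : Fin k → ℂ) : Matrix (Fin k) (Fin k) ℂ :=
  Matrix.of fun i j =>
    fderiv ℂ (fun s => fderiv ℂ F s (Pi.single j 1)) t (Pi.single i 1)

/-- With indices counted from `1`, the number `μ_i + ⋯ + μ_k + k - i`. -/
def shiftedTail {k : ℕ} (μ : Fin k → ℂ) (i : Fin k) : ℂ :=
  ∑ j ∈ Finset.Ici i, μ j + ((k : ℂ) - 1 - (i : ℕ))

/-- With indices counted from `1`, the point with the coordinates
`t_j = ∏_{i ≤ j} (μ_i + ⋯ + μ_k + k - i) / (μ_i + ⋯ + μ_k + k - i + 1)`. -/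
def critPoint {k : ℕ} (μ : Fin k → ℂ) (j : Fin k) : ℂ :=
  ∏ i ∈ Finset.Iic j, shiftedTail μ i / (shiftedTail μ i + 1)

/-! ### The Bethe vector -/

/-- For `w = (i_1, …, i_m)`, the value
`1 / ((t_{i_1} - t_{i_2}) ⋯ (t_{i_{m-1}} - t_{i_m}) (t_{i_m} - z))`. -/
def chainFn {k : ℕ} (t : Fin k → ℂ) (z : ℂ) : List (Fin k) → ℂ
  | [] => 1
  | [i] => (t i - z)⁻¹
  | i :: j :: w => (t i - t j)⁻¹ * chainFn t z (j :: w)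

/-- The rational function `ω_{I,J}`, with `z_1 = 0` and `z_2 = 1`. -/
def omegaFn {k : ℕ} (I J : List (Fin k)) (t : Fin k → ℂ) : ℂ :=
  chainFn t 0 I * chainFn t 1 J

/-- For `w = (i_1, …, i_m)` with letters among the first `k ≤ n` indices, `f_{i_1} ⋯ f_{i_m} v`. -/
def fWord {n k : ℕ} (hk : k ≤ n) {V : Type*} [AddCommGroup V] [Module ℂ V]
    (ρ : SL n →ₗ⁅ℂ⁆ Module.End ℂ V) (w : List (Fin k)) (v : V) : V :=
  w.foldr (fun i x => ρ (chevF (Fin.castLE hk i)) x) v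

/-- The sum `∑ ω_{I,J}(t) f^I v_λ ⊗ f^J v_0` over all pairs `(I, J)` of words that together contain
each of the first `k` indices exactly once. Such a pair is an ordering of the `k` indices, cut in
two after its first `p` letters. -/
def betheSum {n k : ℕ} (hk : k ≤ n) (lam : Fin n → ℂ) (t : Fin k → ℂ) :
    Verma lam ⊗[ℂ] (Fin (n + 1) → ℂ) :=
  ∑ σ : Equiv.Perm (Fin k), ∑ p ∈ Finset.range (k + 1),
    omegaFn ((List.ofFn σ).take p) ((List.ofFn σ).drop p) t •
      (fWord hk (vermaRep lam) ((List.ofFn σ).take p) (vermaVec lam) ⊗ₜ[ℂ]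
        fWord hk (linRep n) ((List.ofFn σ).drop p) (linVec n))

/-- The points at which every denominator of every `ω_{I,J}` is nonzero. -/
def regularPoints (k : ℕ) : Set (Fin k → ℂ) :=
  {s | Function.Injective s ∧ ∀ j, s j ≠ 0 ∧ s j ≠ 1}

/-- `X` is the value at `t` of the vector-valued rational function
`∑ ω_{I,J} f^I v_λ ⊗ f^J v_0`. Single terms of the sum may have a pole at `t` that
cancels in the sum, so the value is taken as the limit over regular points, tested on linear
functionals. At a regular point `t` it is the sum itself. -/
def IsBetheVector {n k : ℕ} (hk : k ≤ n) (lam : Fin n → ℂ) (t : Fin k → ℂ)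
    (X : Verma lam ⊗[ℂ] (Fin (n + 1) → ℂ)) : Prop :=
  ∀ ℓ : Module.Dual ℂ (Verma lam ⊗[ℂ] (Fin (n + 1) → ℂ)),
    Filter.Tendsto (fun s => ℓ (betheSum hk lam s)) (𝓝[regularPoints k] t) (𝓝 (ℓ X))

end BetheNorm

end

noncomputable section

namespace BetheNorm

attribute [local instance 100] LieRing.ofAssociativeRing

/-! ### Relations between the Chevalley generators -/

/-! Indices start from 0. Write s_r for `shiftedTail`, and d_r for `diffSeq`: d_0 = t_0 - 1, d_r =
t_r - t_{r-1}.

Critical points. The equations dΦ = 0 do not depend on κ. Multiplied by t_r, the r-th one reads u_r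
= u_{r+1} with u_r = s_r + t_r / d_r and u_k = 0. Hence s_r d_r + t_r = 0 for all r, a first-order
recursion solved only by the product formula (`criticalSeq_iff`, `eq_critPoint_iff`).

Shapovalov forms. On column vectors the form is the dot product. On the Verma module it is B(x v, y
v) = φ(xᵀ y), where φ is a highest weight functional on the enveloping algebra. No basis of that
algebra is needed to get φ: wedge vectors give the fundamental weights, the comultiplication adds
weights, and polynomial dependence on m extends the multiples m ω from m in ℕ to complex m.
Uniqueness holds because both modules are generated from v by the f_i.

Bethe vector. In the linear representation f^J v_0 is zero unless J = (m, ..., 1), which gives v_m.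
For fixed m, the sum over orderings of the remaining letters collapses: a letter commuting with all
others but its neighbour can be summed over all its positions, with the effect of replacing the
neighbour's operator by `mergeStep`. Iteration gives `betheReg`, whose poles lie only on t_j = 0 and
d_j = 0. These avoid the critical point, so the limit exists there.

Norm. Let S_m be the Verma component attached to v_m. The critical point equations give e_r S_m = 0
for m < r < k and e_m S_m = -S_{m+1} / d_m (`e_blockSeq_of_lt`, `e_blockSeq_self`). Contravariance
then evaluates B(S_m, S_m), and since Σ d_m telescopes, B(X, X) = ∏ d_j⁻² / t_{k-1}
(`sum_apply_blockSeq`).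

Hessian. It factors as RᵀDR with R unipotent bidiagonal and D diagonal with entries s_l (s_l + 1) /
t_l². As 1 / d_l = -s_l / t_l and t_{k-1} = ∏ s_l / (s_l + 1), its determinant is the same number
(`det_hessian_critPoint`). -/

/-- The Cartan matrix of type `A`. -/
def cartan (i j : ℕ) : ℂ := if i = j then 2 else if i + 1 = j ∨ j + 1 = i then -1 else 0

lemma coe_chevE {n : ℕ} (i : Fin n) :
    (chevE i : Matrix (Fin (n + 1)) (Fin (n + 1)) ℂ) = Matrix.single i.castSucc i.succ 1 := rfl

lemma coe_chevF {n : ℕ} (i : Fin n) :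
    (chevF i : Matrix (Fin (n + 1)) (Fin (n + 1)) ℂ) = Matrix.single i.succ i.castSucc 1 := rfl

lemma coe_chevH {n : ℕ} (i : Fin n) :
    (chevH i : Matrix (Fin (n + 1)) (Fin (n + 1)) ℂ) =
      Matrix.single i.castSucc i.castSucc 1 - Matrix.single i.succ i.succ 1 := rfl

lemma single_mul_single_ite {ι : Type*} [Fintype ι] [DecidableEq ι] (a b c d : ι) :
    (Matrix.single a b (1 : ℂ)) * Matrix.single c d 1 =
      if b = c then Matrix.single a d 1 else 0 := by
  split_ifs with h
  · subst h; simp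
  · simp [h]

lemma lie_chevE_chevF {n : ℕ} (i j : Fin n) :
    ⁅chevE i, chevF j⁆ = if i = j then chevH i else 0 := by
  apply Subtype.ext
  rw [LieAlgebra.SpecialLinear.sl_bracket, coe_chevE, coe_chevF, single_mul_single_ite,
    single_mul_single_ite]
  by_cases h : i = j
  · subst h; simp [coe_chevH]
  · simp [h, Ne.symm h, Fin.succ_inj]

lemma lie_chevH_chevF {n : ℕ} (i j : Fin n) :
    ⁅chevH i, chevF j⁆ = -cartan i j • chevF j := by
  apply Subtype.ext
  rw [LieAlgebra.SpecialLinear.sl_bracket, coe_chevH, SetLike.val_smul, coe_chevF]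
  simp only [sub_mul, mul_sub, single_mul_single_ite]
  -- Each of the four products is a scalar times `chevF j`, so the relation reduces to a comparison
  -- of scalars.
  have h1 : (if i.castSucc = j.succ then Matrix.single i.castSucc j.castSucc (1 : ℂ) else 0) =
      (if (j : ℕ) + 1 = i then (1 : ℂ) else 0) • Matrix.single j.succ j.castSucc 1 := by
    by_cases h : i.castSucc = j.succ
    · rw [if_pos h, h, if_pos (by simpa [Fin.ext_iff] using h.symm), one_smul]
    · rw [if_neg h, if_neg (by simpa [Fin.ext_iff, eq_comm] using h), zero_smul]
  have h2 : (if j.castSucc = i.succ then Matrix.single j.succ i.succ (1 : ℂ) else 0) =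
      (if (i : ℕ) + 1 = j then (1 : ℂ) else 0) • Matrix.single j.succ j.castSucc 1 := by
    by_cases h : j.castSucc = i.succ
    · rw [if_pos h, h, if_pos (by simpa [Fin.ext_iff] using h.symm), one_smul]
    · rw [if_neg h, if_neg (by simpa [Fin.ext_iff, eq_comm] using h), zero_smul]
  have h3 : (if i.succ = j.succ then Matrix.single i.succ j.castSucc (1 : ℂ) else 0) =
      (if i = j then (1 : ℂ) else 0) • Matrix.single j.succ j.castSucc 1 := by
    by_cases h : i = j <;> simp [h, Fin.succ_inj]
  have h4 : (if j.castSucc = i.castSucc then Matrix.single j.succ i.castSucc (1 : ℂ) else 0) =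
      (if i = j then (1 : ℂ) else 0) • Matrix.single j.succ j.castSucc 1 := by
    by_cases h : i = j
    · subst h; simp
    · rw [if_neg h, if_neg (by simpa [Fin.ext_iff, eq_comm] using h), zero_smul]
  rw [h1, h2, h3, h4, ← sub_smul, ← sub_smul, ← sub_smul]
  congr 1
  simp only [cartan, Fin.ext_iff]
  split_ifs <;> first | omega | norm_num

lemma lie_chevF_chevF {n : ℕ} (i j : Fin n) (h : (i : ℕ) + 1 ≠ j) (h' : (j : ℕ) + 1 ≠ i) :
    ⁅chevF i, chevF j⁆ = 0 := by
  apply Subtype.ext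
  rw [LieAlgebra.SpecialLinear.sl_bracket, coe_chevF, coe_chevF, single_mul_single_ite,
    single_mul_single_ite, if_neg, if_neg]
  · simp
  · simpa [Fin.ext_iff] using h.symm
  · simpa [Fin.ext_iff] using h'.symm

/-- Transposition of traceless matrices. -/
def slTranspose {n : ℕ} : SL n →ₗ[ℂ] SL n :=
  ((Matrix.transposeLinearEquiv (Fin (n + 1)) (Fin (n + 1)) ℂ ℂ).toLinearMap.comp
    (SL n).toSubmodule.subtype).codRestrict (SL n).toSubmodule (by
      rintro ⟨A, hA⟩
      have h : Matrix.trace A = 0 := hA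
      change Matrix.trace A.transpose = 0
      rw [Matrix.trace_transpose, h])

lemma coe_slTranspose {n : ℕ} (A : SL n) :
    (slTranspose A : Matrix (Fin (n + 1)) (Fin (n + 1)) ℂ) = (A : Matrix _ _ ℂ).transpose := rfl

lemma slTranspose_lie {n : ℕ} (A B : SL n) :
    slTranspose ⁅A, B⁆ = ⁅slTranspose B, slTranspose A⁆ := by
  apply Subtype.ext
  simp only [LieAlgebra.SpecialLinear.sl_bracket, coe_slTranspose, Matrix.transpose_sub,
    Matrix.transpose_mul]

@[simp] lemma slTranspose_chevE {n : ℕ} (i : Fin n) : slTranspose (chevE i) = chevF i :=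
  Subtype.ext (by simp [coe_slTranspose, coe_chevE, coe_chevF])

@[simp] lemma slTranspose_chevF {n : ℕ} (i : Fin n) : slTranspose (chevF i) = chevE i :=
  Subtype.ext (by simp [coe_slTranspose, coe_chevE, coe_chevF])

@[simp] lemma slTranspose_chevH {n : ℕ} (i : Fin n) : slTranspose (chevH i) = chevH i :=
  Subtype.ext (by simp [coe_slTranspose, coe_chevH])

lemma slTranspose_slTranspose {n : ℕ} (A : SL n) : slTranspose (slTranspose A) = A :=
  Subtype.ext (by simp [coe_slTranspose])

/-- Transposition is an antiautomorphism that fixes `chevH` and swaps the other generators, so the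
relation is the transpose of the one for `chevF`. -/
lemma lie_chevH_chevE {n : ℕ} (i j : Fin n) :
    ⁅chevH i, chevE j⁆ = cartan i j • chevE j := by
  have h := congrArg slTranspose (lie_chevH_chevF i j)
  rw [slTranspose_lie, map_smul, slTranspose_chevF, slTranspose_chevH] at h
  rw [← lie_skew, h, neg_smul, neg_neg]

/-! ### Generation by the Chevalley generators -/

/-- A Lie subalgebra of `sl(n+1)` that contains all `e_i` and `f_i` is the whole algebra. -/
lemma lieSubalgebra_eq_top {n : ℕ} (S : LieSubalgebra ℂ (SL n)) (he : ∀ i, chevE i ∈ S)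
    (hf : ∀ i, chevF i ∈ S) : S = ⊤ := by
  -- Induction on the distance to the superdiagonal, by E_{i,j} = [E_{i,j-1}, E_{j-1,j}].
  have up : ∀ (d : ℕ) (i j : Fin (n + 1)) (hij : (i : ℕ) + d + 1 = j) (hne : i ≠ j),
      LieAlgebra.SpecialLinear.single i j hne (1 : ℂ) ∈ S := by
    intro d
    induction d with
    | zero =>
      intro i j hij hne
      have := he ⟨i, by omega⟩
      convert this using 1
      apply Subtype.ext
      rw [coe_chevE, LieAlgebra.SpecialLinear.val_single]
      congr 1
      exact Fin.ext (by simp; omega)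
    | succ d ih =>
      intro i j hij hne
      have h1 := ih i ⟨j - 1, by omega⟩ (by simp; omega) (by simp [Fin.ext_iff]; omega)
      have h2 := he ⟨j - 1, by omega⟩
      convert S.lie_mem h1 h2 using 1
      apply Subtype.ext
      rw [LieAlgebra.SpecialLinear.sl_bracket, coe_chevE, LieAlgebra.SpecialLinear.val_single,
        LieAlgebra.SpecialLinear.val_single, single_mul_single_ite, single_mul_single_ite,
        if_pos, if_neg]
      · rw [sub_zero]
        congr 1
        exact Fin.ext (by simp; omega)
      · simp [Fin.ext_iff]; omega
      · simp
  have down : ∀ (d : ℕ) (i j : Fin (n + 1)) (hij : (j : ℕ) + d + 1 = i) (hne : i ≠ j),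
      LieAlgebra.SpecialLinear.single i j hne (1 : ℂ) ∈ S := by
    intro d
    induction d with
    | zero =>
      intro i j hij hne
      have := hf ⟨j, by omega⟩
      convert this using 1
      apply Subtype.ext
      rw [coe_chevF, LieAlgebra.SpecialLinear.val_single]
      congr 1
      exact Fin.ext (by simp; omega)
    | succ d ih =>
      intro i j hij hne
      have h1 := ih ⟨i - 1, by omega⟩ j (by simp; omega) (by simp [Fin.ext_iff]; omega)
      have h2 := hf ⟨i - 1, by omega⟩
      convert S.lie_mem h2 h1 using 1
      apply Subtype.ext
      rw [LieAlgebra.SpecialLinear.sl_bracket, coe_chevF, LieAlgebra.SpecialLinear.val_single,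
        LieAlgebra.SpecialLinear.val_single, single_mul_single_ite, single_mul_single_ite,
        if_pos, if_neg]
      · rw [sub_zero]
        congr 1
        exact Fin.ext (by simp; omega)
      · simp [Fin.ext_iff]; omega
      · simp
  have off : ∀ (i j : Fin (n + 1)) (hne : i ≠ j) (c : ℂ),
      LieAlgebra.SpecialLinear.single i j hne c ∈ S := by
    intro i j hne c
    have h1 : LieAlgebra.SpecialLinear.single i j hne (1 : ℂ) ∈ S := by
      rcases lt_or_gt_of_ne hne with h | h
      · exact up (j - i - 1) i j (by have : (i : ℕ) < j := h; omega) hne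
      · exact down (i - j - 1) i j (by have : (j : ℕ) < i := h; omega) hne
    have := S.smul_mem c h1
    rwa [← map_smul, smul_eq_mul, mul_one] at this
  -- For i ≠ 0 this is c (E_{ii} - E_{00}) = [c E_{i0}, E_{0i}].
  have diag : ∀ (i : Fin (n + 1)) (c : ℂ),
      LieAlgebra.SpecialLinear.singleSubSingle i 0 c ∈ S := by
    intro i c
    by_cases hi : i = 0
    · subst hi
      convert S.zero_mem
      apply Subtype.ext
      simp [LieAlgebra.SpecialLinear.val_singleSubSingle]
    · convert S.lie_mem (off i 0 hi c) (off 0 i (Ne.symm hi) 1) using 1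
      apply Subtype.ext
      rw [LieAlgebra.SpecialLinear.sl_bracket]
      simp
  rw [eq_top_iff]
  rintro A -
  -- Replacing each diagonal unit E_{ii} by E_{ii} - E_{00} changes the sum by tr(A) E_{00}, which
  -- is zero.
  have hA : A = ∑ i, (∑ j, if h : i ≠ j then
      LieAlgebra.SpecialLinear.single i j h ((A : Matrix _ _ ℂ) i j) else
      LieAlgebra.SpecialLinear.singleSubSingle i 0 ((A : Matrix _ _ ℂ) i i)) := by
    apply Subtype.ext
    ext a b
    have htr : ∑ i, (A : Matrix (Fin (n + 1)) (Fin (n + 1)) ℂ) i i = 0 := A.2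
    have : ∀ i j, ((if h : i ≠ j then
      LieAlgebra.SpecialLinear.single i j h ((A : Matrix _ _ ℂ) i j) else
      LieAlgebra.SpecialLinear.singleSubSingle i 0 ((A : Matrix _ _ ℂ) i i) : SL n) :
        Matrix (Fin (n + 1)) (Fin (n + 1)) ℂ) =
      Matrix.single i j ((A : Matrix _ _ ℂ) i j) -
        if i = j then Matrix.single 0 0 ((A : Matrix _ _ ℂ) i i) else 0 := by
      intro i j
      by_cases h : i = j
      · subst h
        simp
      · simp [h]
    rw [AddSubmonoidClass.coe_finsetSum]
    simp only [AddSubmonoidClass.coe_finsetSum, this, Finset.sum_sub_distrib, Finset.sum_ite_eq,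
      Finset.mem_univ, if_true]
    rw [← Matrix.matrix_eq_sum_single]
    simp only [Matrix.sub_apply, Matrix.sum_apply, Matrix.single_apply]
    by_cases h : 0 = a ∧ 0 = b <;> simp [h, htr]
  rw [hA]
  refine sum_mem fun i _ => sum_mem fun j _ => ?_
  split_ifs with h
  · exact off i j h _
  · exact diag i _

/-- The images of the Chevalley generators in the enveloping algebra. -/
def envE {n : ℕ} (i : Fin n) : Env n := UniversalEnvelopingAlgebra.ι ℂ (chevE i)
/-- The images of the Chevalley generators in the enveloping algebra. -/
def envF {n : ℕ} (i : Fin n) : Env n := UniversalEnvelopingAlgebra.ι ℂ (chevF i)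
/-- The images of the Chevalley generators in the enveloping algebra. -/
def envH {n : ℕ} (i : Fin n) : Env n := UniversalEnvelopingAlgebra.ι ℂ (chevH i)

/-- By the universal property, ι corestricted to `S` extends to an algebra map into `S`; followed by
the inclusion it must be the identity. -/
lemma env_subalgebra_eq_top_of_ι {n : ℕ} (S : Subalgebra ℂ (Env n))
    (h : ∀ A, UniversalEnvelopingAlgebra.ι ℂ A ∈ S) : S = ⊤ := by
  let g : SL n →ₗ⁅ℂ⁆ S :=
    { (UniversalEnvelopingAlgebra.ι ℂ (L := SL n)).toLinearMap.codRestrict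
        (Subalgebra.toSubmodule S) h with
      map_lie' := fun {x y} => Subtype.ext (by
        change UniversalEnvelopingAlgebra.ι ℂ ⁅x, y⁆ = _
        rw [LieHom.map_lie]; rfl) }
  have : S.val.comp (UniversalEnvelopingAlgebra.lift ℂ g) = AlgHom.id ℂ _ := by
    apply UniversalEnvelopingAlgebra.hom_ext
    ext A
    change ((UniversalEnvelopingAlgebra.lift ℂ g (UniversalEnvelopingAlgebra.ι ℂ A) : S) : Env n) = _
    rw [UniversalEnvelopingAlgebra.lift_ι_apply]
    rfl
  rw [eq_top_iff]
  rintro x -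
  have := DFunLike.congr_fun this x
  rw [AlgHom.id_apply] at this
  rw [← this]
  exact Subtype.prop _

lemma env_adjoin_eq_top {n : ℕ} (S : Subalgebra ℂ (Env n)) (he : ∀ i, envE i ∈ S)
    (hf : ∀ i, envF i ∈ S) : S = ⊤ := by
  apply env_subalgebra_eq_top_of_ι
  let T : LieSubalgebra ℂ (SL n) :=
    { (Subalgebra.toSubmodule S).comap (UniversalEnvelopingAlgebra.ι ℂ (L := SL n)).toLinearMap with
      lie_mem' := fun {x y} hx hy => by
        change UniversalEnvelopingAlgebra.ι ℂ ⁅x, y⁆ ∈ S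
        rw [LieHom.map_lie, LieRing.of_associative_ring_bracket]
        exact S.sub_mem (S.mul_mem hx hy) (S.mul_mem hy hx) }
  have hT : T = ⊤ := lieSubalgebra_eq_top T he hf
  intro A
  have : A ∈ T := by rw [hT]; trivial
  exact this

/-! ### Highest weight functionals on the enveloping algebra -/

lemma envE_mul_envF {n : ℕ} (i j : Fin n) :
    (envE i : Env n) * envF j = envF j * envE i + if i = j then envH i else 0 := by
  have h := congrArg (UniversalEnvelopingAlgebra.ι ℂ) (lie_chevE_chevF i j)
  rw [LieHom.map_lie, LieRing.of_associative_ring_bracket, sub_eq_iff_eq_add'] at h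
  refine h.trans ?_
  split_ifs
  · rfl
  · rw [map_zero]; rfl

lemma envE_mul_envH {n : ℕ} (i j : Fin n) :
    (envE i : Env n) * envH j = envH j * envE i + (-cartan j i) • envE i := by
  have h := congrArg (UniversalEnvelopingAlgebra.ι ℂ) (lie_chevH_chevE j i)
  rw [LieHom.map_lie, LieRing.of_associative_ring_bracket, map_smul, sub_eq_iff_eq_add] at h
  change envH j * envE i = _ • envE i + envE i * envH j at h
  rw [h, neg_smul]
  abel

/-- A linear functional on the enveloping algebra which is the matrix coefficient
`x ↦ ⟨v, x v⟩` of a highest weight vector `v` of weight `lam`. -/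
structure IsHighestWeightFunctional {n : ℕ} (lam : Fin n → ℂ) (φ : Env n →ₗ[ℂ] ℂ) : Prop where
  map_one : φ 1 = 1
  f_mul : ∀ i x, φ (envF i * x) = 0
  mul_e : ∀ i x, φ (x * envE i) = 0
  h_mul : ∀ i x, φ (envH i * x) = lam i * φ x
  mul_h : ∀ i x, φ (x * envH i) = lam i * φ x

/-- The counit, that is, the matrix coefficient of the trivial representation. -/
lemma exists_highestWeightFunctional_zero (n : ℕ) :
    ∃ φ, IsHighestWeightFunctional (0 : Fin n → ℂ) φ := by
  let ε : Env n →ₐ[ℂ] ℂ := UniversalEnvelopingAlgebra.lift ℂ (0 : SL n →ₗ⁅ℂ⁆ ℂ)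
  have h : ∀ A, ε (UniversalEnvelopingAlgebra.ι ℂ A) = 0 := fun A =>
    UniversalEnvelopingAlgebra.lift_ι_apply ℂ _ A
  refine ⟨ε.toLinearMap, ?_, ?_, ?_, ?_, ?_⟩ <;> intros <;>
    simp [envE, envF, envH, h, -UniversalEnvelopingAlgebra.ι_apply]

/-- The comultiplication of the enveloping algebra. -/
def envComul (n : ℕ) : Env n →ₐ[ℂ] Env n ⊗[ℂ] Env n :=
  UniversalEnvelopingAlgebra.lift ℂ
    { toFun := fun A => UniversalEnvelopingAlgebra.ι ℂ A ⊗ₜ 1 + 1 ⊗ₜ UniversalEnvelopingAlgebra.ι ℂ A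
      map_add' := fun A B => by
        rw [map_add, TensorProduct.add_tmul, TensorProduct.tmul_add]; abel
      map_smul' := fun c A => by
        rw [map_smul, ← TensorProduct.smul_tmul', TensorProduct.tmul_smul, smul_add]; rfl
      map_lie' := fun {A B} => by
        simp only [LieHom.map_lie, LieRing.of_associative_ring_bracket, add_mul, mul_add,
          Algebra.TensorProduct.tmul_mul_tmul, one_mul, mul_one, TensorProduct.sub_tmul,
          TensorProduct.tmul_sub]
        abel }

lemma envComul_ι {n : ℕ} (A : SL n) :
    envComul n (UniversalEnvelopingAlgebra.ι ℂ A) =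
      UniversalEnvelopingAlgebra.ι ℂ A ⊗ₜ 1 + 1 ⊗ₜ UniversalEnvelopingAlgebra.ι ℂ A :=
  UniversalEnvelopingAlgebra.lift_ι_apply ℂ _ A

/-- A tensor product of highest weight vectors is one for the sum of the weights. Its matrix
coefficient is φ ⊗ ψ composed with the comultiplication, and each condition is checked on pure
tensors. -/
lemma IsHighestWeightFunctional.exists_add {n : ℕ} {lam mu : Fin n → ℂ} {φ ψ : Env n →ₗ[ℂ] ℂ}
    (hφ : IsHighestWeightFunctional lam φ) (hψ : IsHighestWeightFunctional mu ψ) :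
    ∃ χ, IsHighestWeightFunctional (lam + mu) χ := by
  let θ : Env n ⊗[ℂ] Env n →ₗ[ℂ] ℂ := LinearMap.mul' ℂ ℂ ∘ₗ TensorProduct.map φ ψ
  have hθ : ∀ x y, θ (x ⊗ₜ y) = φ x * ψ y := fun x y => by simp [θ]
  have hcomE : ∀ i, envComul n (envE i) = envE i ⊗ₜ 1 + 1 ⊗ₜ envE i := fun i => envComul_ι _
  have hcomF : ∀ i, envComul n (envF i) = envF i ⊗ₜ 1 + 1 ⊗ₜ envF i := fun i => envComul_ι _
  have hcomH : ∀ i, envComul n (envH i) = envH i ⊗ₜ 1 + 1 ⊗ₜ envH i := fun i => envComul_ι _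
  refine ⟨θ ∘ₗ (envComul n).toLinearMap, ?_, ?_, ?_, ?_, ?_⟩
  · simp [Algebra.TensorProduct.one_def, hθ, hφ.map_one, hψ.map_one]
  · intro i x
    have h : ∀ z : Env n ⊗[ℂ] Env n, θ ((envF i ⊗ₜ 1 + 1 ⊗ₜ envF i) * z) = 0 := by
      intro z
      induction z using TensorProduct.induction_on with
      | zero => simp
      | add a b ha hb => rw [mul_add, map_add, ha, hb, add_zero]
      | tmul a b =>
        simp only [add_mul, Algebra.TensorProduct.tmul_mul_tmul, one_mul, map_add, hθ,
          hφ.f_mul, hψ.f_mul]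
        ring
    have h := h (envComul n x)
    simpa only [LinearMap.comp_apply, AlgHom.toLinearMap_apply, map_mul, hcomF] using h
  · intro i x
    have h : ∀ z : Env n ⊗[ℂ] Env n, θ (z * (envE i ⊗ₜ 1 + 1 ⊗ₜ envE i)) = 0 := by
      intro z
      induction z using TensorProduct.induction_on with
      | zero => simp
      | add a b ha hb => rw [add_mul, map_add, ha, hb, add_zero]
      | tmul a b =>
        simp only [mul_add, Algebra.TensorProduct.tmul_mul_tmul, mul_one, map_add, hθ,
          hφ.mul_e, hψ.mul_e]
        ring
    have h := h (envComul n x)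
    simpa only [LinearMap.comp_apply, AlgHom.toLinearMap_apply, map_mul, hcomE] using h
  · intro i x
    have h : ∀ z : Env n ⊗[ℂ] Env n, θ ((envH i ⊗ₜ 1 + 1 ⊗ₜ envH i) * z) = (lam + mu) i * θ z := by
      intro z
      induction z using TensorProduct.induction_on with
      | zero => simp
      | add a b ha hb => rw [mul_add, map_add, ha, hb, map_add, mul_add]
      | tmul a b =>
        simp only [add_mul, Algebra.TensorProduct.tmul_mul_tmul, one_mul, map_add, hθ,
          hφ.h_mul, hψ.h_mul, Pi.add_apply]
        ring
    have h := h (envComul n x)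
    simpa only [LinearMap.comp_apply, AlgHom.toLinearMap_apply, map_mul, hcomH] using h
  · intro i x
    have h : ∀ z : Env n ⊗[ℂ] Env n, θ (z * (envH i ⊗ₜ 1 + 1 ⊗ₜ envH i)) = (lam + mu) i * θ z := by
      intro z
      induction z using TensorProduct.induction_on with
      | zero => simp
      | add a b ha hb => rw [add_mul, map_add, ha, hb, map_add, mul_add]
      | tmul a b =>
        simp only [mul_add, Algebra.TensorProduct.tmul_mul_tmul, mul_one, map_add, hθ,
          hφ.mul_h, hψ.mul_h, Pi.add_apply]
        ring
    have h := h (envComul n x)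
    simpa only [LinearMap.comp_apply, AlgHom.toLinearMap_apply, map_mul, hcomH] using h

/-- The generators `f_i` and `h_i`. -/
def lowerGens (n : ℕ) : Set (Env n) := Set.range envF ∪ Set.range envH

/-- The generators `e_i`, `f_i` and `h_i`. -/
def allGens (n : ℕ) : Set (Env n) := Set.range envE ∪ lowerGens n

lemma list_split_last {α : Type*} (S T : Set α) (l : List α) (h : ∀ x ∈ l, x ∈ S ∪ T) :
    (∀ x ∈ l, x ∈ T) ∨ ∃ l₁ e l₂, l = l₁ ++ e :: l₂ ∧ e ∈ S ∧ (∀ x ∈ l₂, x ∈ T) := by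
  induction l with
  | nil => left; simp
  | cons a l ih =>
    rcases ih (fun x hx => h x (List.mem_cons_of_mem _ hx)) with h1 | ⟨l₁, e, l₂, rfl, he, h2⟩
    · rcases h a List.mem_cons_self with ha | ha
      · exact Or.inr ⟨[], a, l, rfl, ha, h1⟩
      · left
        intro x hx
        rcases List.mem_cons.1 hx with rfl | hx
        exacts [ha, h1 x hx]
    · exact Or.inr ⟨a :: l₁, e, l₂, rfl, he, h2⟩

/-- A submodule of the enveloping algebra contains all words in the generators if it contains `1`,
all `x e_i`, and is stable under left multiplication by the `f_i` and the `h_i`. -/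
lemma submodule_eq_top_of_triangular {n : ℕ} (P : Submodule ℂ (Env n)) (h1 : 1 ∈ P)
    (hf : ∀ i, ∀ x ∈ P, envF i * x ∈ P) (he : ∀ i x, x * envE i ∈ P)
    (hh : ∀ i, ∀ x ∈ P, envH i * x ∈ P) : P = ⊤ := by
  have key : ∀ N : ℕ, ∀ l : List (Env n), l.length = N → (∀ x ∈ l, x ∈ allGens n) →
      l.prod ∈ P := by
    intro N
    induction N using Nat.strong_induction_on with
    | _ N IH =>
      -- The last e_i of the word is pushed to the right end. Each exchange with an f or an h costs
      -- only a shorter word, with a factor h_i or e_i, which the outer induction on length covers.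
      have move : ∀ (l₂ l₁ : List (Env n)) (i : Fin n), (l₁ ++ envE i :: l₂).length = N →
          (∀ x ∈ l₁, x ∈ allGens n) → (∀ x ∈ l₂, x ∈ lowerGens n) →
          (l₁ ++ envE i :: l₂).prod ∈ P := by
        intro l₂
        induction l₂ with
        | nil =>
          intro l₁ i _ _ _
          rw [List.prod_append, List.prod_singleton]
          exact he _ _
        | cons a l₂ ih =>
          intro l₁ i hN hl₁ hl₂
          have ha := hl₂ a List.mem_cons_self
          have hl₂' : ∀ x ∈ l₂, x ∈ lowerGens n := fun x hx => hl₂ x (List.mem_cons_of_mem _ hx)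
          have hIH : ∀ g ∈ allGens n, (l₁ ++ g :: l₂).prod ∈ P := by
            intro g hg
            refine IH _ ?_ _ rfl ?_
            · rw [← hN]; simp
            · intro x hx
              rcases List.mem_append.1 hx with hx | hx
              · exact hl₁ x hx
              · rcases List.mem_cons.1 hx with rfl | hx
                exacts [hg, Or.inr (hl₂' x hx)]
          have hswap : ((l₁ ++ [a]) ++ envE i :: l₂).prod ∈ P := by
            refine ih (l₁ ++ [a]) i (by rw [← hN]; simp) ?_ hl₂'
            intro x hx
            rcases List.mem_append.1 hx with hx | hx
            · exact hl₁ x hx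
            · rw [List.mem_singleton.1 hx]; exact Or.inr ha
          rcases ha with ⟨j, rfl⟩ | ⟨j, rfl⟩
          · have : (l₁ ++ envE i :: envF j :: l₂).prod = ((l₁ ++ [envF j]) ++ envE i :: l₂).prod +
                if i = j then (l₁ ++ envH i :: l₂).prod else 0 := by
              simp only [List.prod_append, List.prod_cons, List.prod_nil, mul_one]
              rw [← mul_assoc (envE i), envE_mul_envF]
              split_ifs <;> simp only [mul_add, add_mul, mul_assoc, add_zero]
            rw [this]
            refine P.add_mem hswap ?_
            split_ifs
            · exact hIH _ (Or.inr (Or.inr ⟨i, rfl⟩))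
            · exact P.zero_mem
          · have : (l₁ ++ envE i :: envH j :: l₂).prod = ((l₁ ++ [envH j]) ++ envE i :: l₂).prod +
                (-cartan j i) • (l₁ ++ envE i :: l₂).prod := by
              simp only [List.prod_append, List.prod_cons, List.prod_nil, mul_one]
              rw [← mul_assoc (envE i), envE_mul_envH]
              simp only [mul_add, add_mul, mul_assoc, smul_mul_assoc, mul_smul_comm]
            rw [this]
            exact P.add_mem hswap (P.smul_mem _ (hIH _ (Or.inl ⟨i, rfl⟩)))
      intro l hN hl
      -- A word without any e is peeled from the left by the stability hypotheses; any other word is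
      -- handled at its last e.
      rcases list_split_last _ _ l hl with hlow | ⟨l₁, _, l₂, rfl, ⟨i, rfl⟩, h₂⟩
      · cases l with
        | nil => exact h1
        | cons a l =>
          rw [List.prod_cons]
          have hlP : l.prod ∈ P := IH _ (by rw [← hN]; simp) l rfl fun x hx =>
            hl x (List.mem_cons_of_mem _ hx)
          rcases hlow a List.mem_cons_self with ⟨j, rfl⟩ | ⟨j, rfl⟩
          · exact hf _ _ hlP
          · exact hh _ _ hlP
      · exact move l₂ l₁ i hN (fun x hx => hl x (List.mem_append_left _ hx)) h₂
  have hgen : Algebra.adjoin ℂ (allGens n) = ⊤ :=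
    env_adjoin_eq_top _ (fun i => Algebra.subset_adjoin (Or.inl ⟨i, rfl⟩))
      (fun i => Algebra.subset_adjoin (Or.inr (Or.inl ⟨i, rfl⟩)))
  rw [eq_top_iff]
  rintro x -
  have hx : x ∈ Subalgebra.toSubmodule (Algebra.adjoin ℂ (allGens n)) := by rw [hgen]; trivial
  rw [Algebra.adjoin_eq_span] at hx
  refine Submodule.span_le.2 ?_ hx
  intro y hy
  obtain ⟨l, hl, rfl⟩ := Submonoid.exists_list_of_mem_closure hy
  exact key _ l rfl hl

lemma polynomial_eq_of_eval_nat {p q : Polynomial ℂ}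
    (h : ∀ m : ℕ, p.eval (m : ℂ) = q.eval (m : ℂ)) : p = q := by
  refine Polynomial.eq_of_infinite_eval_eq p q (Set.Infinite.mono ?_
    (Set.infinite_range_of_injective (Nat.cast_injective (R := ℂ))))
  rintro _ ⟨m, rfl⟩
  exact h m

/-- Highest weight functionals of the weights `m ω` with `m ∈ ℕ` depend polynomially on `m`, and
so extend to all multiples of `ω`. -/
lemma exists_highestWeightFunctional_smul {n : ℕ} (om : Fin n → ℂ)
    (H : ∀ m : ℕ, ∃ φ, IsHighestWeightFunctional ((m : ℂ) • om) φ) (c : ℂ) :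
    ∃ φ, IsHighestWeightFunctional (c • om) φ := by
  choose φ hφ using H
  -- The elements with polynomial values form a submodule satisfying the triangular criterion: a
  -- factor e on the right or f on the left gives the zero polynomial, and a factor h_i on the left
  -- multiplies the polynomial by ω_i X.
  have hP : ∀ x : Env n, ∃ p : Polynomial ℂ, ∀ m : ℕ, φ m x = p.eval (m : ℂ) := by
    let P : Submodule ℂ (Env n) :=
      { carrier := {x | ∃ p : Polynomial ℂ, ∀ m : ℕ, φ m x = p.eval (m : ℂ)}
        add_mem' := by
          rintro x y ⟨p, hp⟩ ⟨q, hq⟩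
          exact ⟨p + q, fun m => by rw [map_add, hp, hq, Polynomial.eval_add]⟩
        zero_mem' := ⟨0, fun m => by simp⟩
        smul_mem' := by
          rintro a x ⟨p, hp⟩
          exact ⟨a • p, fun m => by rw [map_smul, hp, Polynomial.eval_smul]⟩ }
    have : P = ⊤ := by
      apply submodule_eq_top_of_triangular
      · exact ⟨1, fun m => by rw [(hφ m).map_one, Polynomial.eval_one]⟩
      · exact fun i x _ => ⟨0, fun m => by rw [(hφ m).f_mul, Polynomial.eval_zero]⟩
      · exact fun i x => ⟨0, fun m => by rw [(hφ m).mul_e, Polynomial.eval_zero]⟩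
      · rintro i x ⟨p, hp⟩
        exact ⟨Polynomial.C (om i) * Polynomial.X * p, fun m => by
          rw [(hφ m).h_mul, hp]; simp only [Pi.smul_apply, smul_eq_mul, Polynomial.eval_mul, Polynomial.eval_C, Polynomial.eval_X]; ring⟩
    intro x
    have hx : x ∈ P := by rw [this]; trivial
    exact hx
  choose p hp using hP
  -- The polynomials are chosen separately for each element. Linearity and all other conditions hold
  -- at every natural m, hence as polynomial identities, hence at `c`.
  refine ⟨⟨⟨fun x => (p x).eval c, fun x y => ?_⟩, fun a x => ?_⟩, ?_, ?_, ?_, ?_, ?_⟩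
  · rw [← Polynomial.eval_add]
    congr 1
    exact polynomial_eq_of_eval_nat fun m => by rw [Polynomial.eval_add, ← hp, ← hp, ← hp, map_add]
  · rw [RingHom.id_apply, ← Polynomial.eval_smul]
    change (p (a • x)).eval c = (a • p x).eval c
    congr 1
    exact polynomial_eq_of_eval_nat fun m => by rw [Polynomial.eval_smul, ← hp x, ← hp, map_smul]
  · change (p 1).eval c = 1
    rw [← Polynomial.eval_one (x := c)]
    congr 1
    exact polynomial_eq_of_eval_nat fun m => by rw [Polynomial.eval_one, ← hp, (hφ m).map_one]
  · intro i x
    change (p _).eval c = 0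
    rw [← Polynomial.eval_zero (x := c)]
    congr 1
    exact polynomial_eq_of_eval_nat fun m => by rw [Polynomial.eval_zero, ← hp, (hφ m).f_mul]
  · intro i x
    change (p _).eval c = 0
    rw [← Polynomial.eval_zero (x := c)]
    congr 1
    exact polynomial_eq_of_eval_nat fun m => by rw [Polynomial.eval_zero, ← hp, (hφ m).mul_e]
  · intro i x
    change (p _).eval c = _ * (p x).eval c
    have : p (envH i * x) = Polynomial.C (om i) * Polynomial.X * p x :=
      polynomial_eq_of_eval_nat fun m => by rw [← hp, (hφ m).h_mul, hp]; simp only [Pi.smul_apply, smul_eq_mul, Polynomial.eval_mul, Polynomial.eval_C, Polynomial.eval_X]; ring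
    rw [this]; simp only [Pi.smul_apply, smul_eq_mul, Polynomial.eval_mul, Polynomial.eval_C, Polynomial.eval_X]; ring
  · intro i x
    change (p _).eval c = _ * (p x).eval c
    have : p (x * envH i) = Polynomial.C (om i) * Polynomial.X * p x :=
      polynomial_eq_of_eval_nat fun m => by rw [← hp, (hφ m).mul_h, hp]; simp only [Pi.smul_apply, smul_eq_mul, Polynomial.eval_mul, Polynomial.eval_C, Polynomial.eval_X]; ring
    rw [this]; simp only [Pi.smul_apply, smul_eq_mul, Polynomial.eval_mul, Polynomial.eval_C, Polynomial.eval_X]; ring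

/-- Every weight is a complex combination of fundamental ones. Natural multiples and sums come from
adding weights, complex multiples from polynomial extension. -/
lemma exists_highestWeightFunctional_of_fundamental {n : ℕ}
    (H : ∀ i : Fin n, ∃ φ, IsHighestWeightFunctional (Pi.single i (1 : ℂ)) φ) (lam : Fin n → ℂ) :
    ∃ φ, IsHighestWeightFunctional lam φ := by
  have hc : ∀ i (c : ℂ), ∃ φ, IsHighestWeightFunctional (c • Pi.single i (1 : ℂ) : Fin n → ℂ) φ := by
    intro i c
    apply exists_highestWeightFunctional_smul
    intro m
    induction m with
    | zero => simpa using exists_highestWeightFunctional_zero n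
    | succ m ih =>
      obtain ⟨φ, hφ⟩ := ih
      obtain ⟨ψ, hψ⟩ := H i
      have := hφ.exists_add hψ
      rwa [Nat.cast_succ, add_smul, one_smul]
  have hs : ∀ s : Finset (Fin n), ∃ φ,
      IsHighestWeightFunctional (∑ i ∈ s, lam i • Pi.single i (1 : ℂ) : Fin n → ℂ) φ := by
    intro s
    induction s using Finset.induction_on with
    | empty => simpa using exists_highestWeightFunctional_zero n
    | insert i s hi ih =>
      obtain ⟨φ, hφ⟩ := hc i (lam i)
      obtain ⟨ψ, hψ⟩ := ih
      rw [Finset.sum_insert hi]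
      exact hφ.exists_add hψ
  have hlam : lam = ∑ i, lam i • Pi.single i (1 : ℂ) := by
    ext j; simp [Finset.sum_apply, Pi.single_apply]
  rw [hlam]
  exact hs _

/-! ### Fundamental weights -/

/-- The action of a matrix on one slot of a tensor, given by its coordinates. -/
def slotAct {N r : ℕ} (a : Fin r) (A : Matrix (Fin N) (Fin N) ℂ) :
    Module.End ℂ ((Fin r → Fin N) → ℂ) where
  toFun Ψ := fun s => ∑ c, A (s a) c * Ψ (Function.update s a c)
  map_add' Ψ Ψ' := by ext s; simp [mul_add, Finset.sum_add_distrib]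
  map_smul' c Ψ := by
    ext s
    simp only [Pi.smul_apply, smul_eq_mul, RingHom.id_apply, Finset.mul_sum]
    exact Finset.sum_congr rfl fun _ _ => by ring

lemma slotAct_apply {N r : ℕ} (a : Fin r) (A : Matrix (Fin N) (Fin N) ℂ)
    (Ψ : (Fin r → Fin N) → ℂ) (s : Fin r → Fin N) :
    slotAct a A Ψ s = ∑ c, A (s a) c * Ψ (Function.update s a c) := rfl

lemma slotAct_mul {N r : ℕ} (a : Fin r) (A B : Matrix (Fin N) (Fin N) ℂ) :
    slotAct a A * slotAct a B = slotAct a (A * B) := by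
  refine LinearMap.ext fun Ψ => funext fun s => ?_
  rw [Module.End.mul_apply, slotAct_apply, slotAct_apply]
  simp only [slotAct_apply, Function.update_self, Function.update_idem, Matrix.mul_apply,
    Finset.mul_sum, Finset.sum_mul]
  rw [Finset.sum_comm]
  exact Finset.sum_congr rfl fun _ _ => Finset.sum_congr rfl fun _ _ => by ring

lemma slotAct_comm {N r : ℕ} {a b : Fin r} (hab : a ≠ b) (A B : Matrix (Fin N) (Fin N) ℂ) :
    slotAct a A * slotAct b B = slotAct b B * slotAct a A := by
  refine LinearMap.ext fun Ψ => funext fun s => ?_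
  rw [Module.End.mul_apply, Module.End.mul_apply, slotAct_apply, slotAct_apply]
  simp only [slotAct_apply, Function.update_of_ne hab, Function.update_of_ne hab.symm,
    Finset.mul_sum]
  rw [Finset.sum_comm]
  refine Finset.sum_congr rfl fun c _ => Finset.sum_congr rfl fun d _ => ?_
  rw [Function.update_comm hab]
  ring

/-- The action of `sl(n+1)` on tensors of degree `r`. -/
def tensorRep (n r : ℕ) : SL n →ₗ⁅ℂ⁆ Module.End ℂ ((Fin r → Fin (n + 1)) → ℂ) where
  toFun A := ∑ a, slotAct a (A : Matrix _ _ ℂ)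
  map_add' A B := by
    rw [← Finset.sum_add_distrib]
    refine Finset.sum_congr rfl fun a _ => ?_
    refine LinearMap.ext fun Ψ => funext fun s => ?_
    simp [slotAct_apply, add_mul, Finset.sum_add_distrib]
  map_smul' c A := by
    rw [Finset.smul_sum]
    refine Finset.sum_congr rfl fun a _ => ?_
    refine LinearMap.ext fun Ψ => funext fun s => ?_
    simp [slotAct_apply, mul_assoc, Finset.mul_sum]
  map_lie' {A B} := by
    rw [LieRing.of_associative_ring_bracket, Finset.sum_mul_sum, Finset.sum_mul_sum]
    rw [Finset.sum_comm (f := fun i j => slotAct i (B : Matrix (Fin (n + 1)) (Fin (n + 1)) ℂ) *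
      slotAct j (A : Matrix (Fin (n + 1)) (Fin (n + 1)) ℂ)), ← Finset.sum_sub_distrib]
    refine Finset.sum_congr rfl fun a _ => ?_
    rw [← Finset.sum_sub_distrib, Finset.sum_eq_single a]
    · rw [slotAct_mul, slotAct_mul, LieAlgebra.SpecialLinear.sl_bracket]
      refine LinearMap.ext fun Ψ => funext fun s => ?_
      simp [slotAct_apply, sub_mul, Finset.sum_sub_distrib]
    · intro b _ hb
      rw [slotAct_comm hb.symm, sub_self]
    · simp

lemma tensorRep_apply {n r : ℕ} (A : SL n) (Ψ : (Fin r → Fin (n + 1)) → ℂ)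
    (s : Fin r → Fin (n + 1)) :
    tensorRep n r A Ψ s =
      ∑ a, ∑ c, (A : Matrix _ _ ℂ) (s a) c * Ψ (Function.update s a c) := by
  change (∑ a, slotAct a (A : Matrix _ _ ℂ)) Ψ s = _
  rw [LinearMap.sum_apply, Finset.sum_apply]
  rfl

lemma sum_mul_slotAct {N r : ℕ} (a : Fin r) (A : Matrix (Fin N) (Fin N) ℂ)
    (Ψ Ψ' : (Fin r → Fin N) → ℂ) :
    ∑ s, Ψ' s * slotAct a A Ψ s = ∑ s, slotAct a A.transpose Ψ' s * Ψ s := by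
  simp only [slotAct_apply, Finset.mul_sum, Finset.sum_mul]
  rw [← Finset.sum_product', ← Finset.sum_product', Finset.univ_product_univ]
  -- Exchanging the a-th entry of `s` with the summation index interchanges the two double sums and
  -- transposes the matrix.
  have hinv : Function.Involutive (fun p : (Fin r → Fin N) × Fin N =>
      (Function.update p.1 a p.2, p.1 a)) := by
    rintro ⟨s, c⟩
    simp
  rw [← Equiv.sum_comp (hinv.toPerm _)]
  refine Finset.sum_congr rfl fun p _ => ?_
  simp [Matrix.transpose_apply]
  ring

lemma sum_mul_tensorRep {n r : ℕ} (A : SL n) (Ψ Ψ' : (Fin r → Fin (n + 1)) → ℂ) :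
    ∑ s, Ψ' s * tensorRep n r A Ψ s = ∑ s, tensorRep n r (slTranspose A) Ψ' s * Ψ s := by
  have h : ∀ (B : SL n) (Φ : (Fin r → Fin (n + 1)) → ℂ) s,
      tensorRep n r B Φ s = ∑ a, slotAct a (B : Matrix _ _ ℂ) Φ s := fun B Φ s =>
    tensorRep_apply B Φ s
  simp only [h, Finset.mul_sum, Finset.sum_mul]
  rw [Finset.sum_comm, Finset.sum_comm (s := Finset.univ (α := Fin r → Fin (n + 1)))]
  exact Finset.sum_congr rfl fun a _ => sum_mul_slotAct a _ _ _

/-- The matrix whose determinants are the coordinates of `v_0 ∧ ⋯ ∧ v_{r-1}`. -/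
def wedgeMatrix (R : Type*) [CommRing R] {N r : ℕ} (s : Fin r → Fin N) : Matrix (Fin r) (Fin r) R :=
  Matrix.of fun a b => if (s a : ℕ) = b then 1 else 0

/-- The antisymmetric tensor `v_0 ∧ ⋯ ∧ v_{r-1}`. -/
def wedgeVec (n r : ℕ) : (Fin r → Fin (n + 1)) → ℂ := fun s => (wedgeMatrix ℂ s).det

/-- By Cramer's rule the a-th summand is the diagonal entry of M A adj(M); cyclicity of the trace
and adj(M) M = det(M) give the rest. This is the derivative of det(M (1 + εA)) at ε = 0. -/
lemma sum_det_updateRow_mul {r : ℕ} (M A : Matrix (Fin r) (Fin r) ℂ) :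
    ∑ a, (M.updateRow a ((M * A) a)).det = A.trace * M.det := by
  have h : ∀ a, (M.updateRow a ((M * A) a)).det = (M * A * M.adjugate) a a := by
    intro a
    rw [← Matrix.cramer_transpose_apply, Matrix.cramer_eq_adjugate_mulVec,
      ← Matrix.adjugate_transpose, Matrix.mulVec_transpose, Matrix.mul_apply]
    rfl
  simp only [h]
  change Matrix.trace _ = _
  rw [Matrix.trace_mul_comm, ← mul_assoc, Matrix.adjugate_mul, Matrix.smul_mul, one_mul,
    Matrix.trace_smul, smul_eq_mul, mul_comm]

/-- An upper triangular matrix preserves the span of the first `r` basis vectors, so it acts on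
their top wedge by its trace on that span. Acting on one slot replaces one row of `wedgeMatrix`. -/
lemma tensorRep_wedgeVec {n r : ℕ} (hr : r ≤ n + 1) (A : SL n)
    (hA : ∀ a b, b < a → (A : Matrix (Fin (n + 1)) (Fin (n + 1)) ℂ) a b = 0) :
    tensorRep n r A (wedgeVec n r) =
      (∑ a : Fin r, (A : Matrix (Fin (n + 1)) (Fin (n + 1)) ℂ) (Fin.castLE hr a) (Fin.castLE hr a)) •
        wedgeVec n r := by
  funext s
  rw [tensorRep_apply, Pi.smul_apply, smul_eq_mul]
  have h := sum_det_updateRow_mul (wedgeMatrix ℂ s)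
    ((A : Matrix (Fin (n + 1)) (Fin (n + 1)) ℂ).submatrix (Fin.castLE hr) (Fin.castLE hr))
  change _ = Matrix.trace ((A : Matrix (Fin (n + 1)) (Fin (n + 1)) ℂ).submatrix
    (Fin.castLE hr) (Fin.castLE hr)) * (wedgeMatrix ℂ s).det
  rw [← h]
  refine Finset.sum_congr rfl fun a _ => ?_
  have hupd : ∀ c, wedgeVec n r (Function.update s a c) =
      ((wedgeMatrix ℂ s).updateRow a (fun b => if (c : ℕ) = b then 1 else 0)).det := by
    intro c
    unfold wedgeVec
    congr 1
    ext x y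
    by_cases hx : x = a
    · subst hx; simp [wedgeMatrix]
    · simp [wedgeMatrix, hx]
  simp only [hupd]
  rw [← Matrix.cramer_transpose_apply]
  simp only [← Matrix.cramer_transpose_apply]
  have hrow : (wedgeMatrix ℂ s * (A : Matrix (Fin (n + 1)) (Fin (n + 1)) ℂ).submatrix
      (Fin.castLE hr) (Fin.castLE hr)) a =
      ∑ c, (A : Matrix (Fin (n + 1)) (Fin (n + 1)) ℂ) (s a) c •
        (fun b : Fin r => if (c : ℕ) = b then (1 : ℂ) else 0) := by
    funext b
    rw [Matrix.mul_apply, Finset.sum_apply]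
    have hc : ∀ c : Fin (n + 1), ((c : ℕ) = b) ↔ c = Fin.castLE hr b := fun c => by
      rw [Fin.ext_iff]; rfl
    simp only [Pi.smul_apply, smul_eq_mul, mul_ite, mul_one, mul_zero, hc, Finset.sum_ite_eq',
      Finset.mem_univ, if_true, wedgeMatrix, Matrix.of_apply, ite_mul, one_mul, zero_mul,
      Matrix.submatrix_apply]
    by_cases hs : (s a : ℕ) < r
    · rw [Finset.sum_eq_single ⟨s a, hs⟩]
      · simp only [if_true]; rfl
      · intro x _ hx
        rw [if_neg]
        intro h; exact hx (Fin.ext h.symm)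
      · simp
    -- If s_a ≥ r, this row of `wedgeMatrix` is zero, while on the other side the entry lies below
    -- the diagonal of `A`.
    · rw [Finset.sum_eq_zero]
      · rw [hA]
        change (b : ℕ) < s a
        omega
      · intro x _
        rw [if_neg]; omega
  rw [hrow, map_sum, Finset.sum_apply]
  simp

/-- The coordinates are integers, so the sum of squares is positive as soon as one of them is
nonzero; the tuple (0, ..., r-1) has coordinate 1. This permits normalization of the matrix
coefficient, although the form is bilinear rather than Hermitian. -/
lemma sum_wedgeVec_sq_ne_zero {n r : ℕ} (hr : r ≤ n + 1) :
    ∑ s, wedgeVec n r s * wedgeVec n r s ≠ 0 := by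
  have h : ∀ s, wedgeVec n r s = (((wedgeMatrix ℤ s).det : ℤ) : ℂ) := by
    intro s
    rw [Int.cast_det]
    unfold wedgeVec
    congr 1
    ext a b
    simp [wedgeMatrix]
  simp only [h]
  norm_cast
  refine (Finset.sum_pos' (fun s _ => mul_self_nonneg _) ⟨Fin.castLE hr, Finset.mem_univ _, ?_⟩).ne'
  have : wedgeMatrix ℤ (Fin.castLE hr) = 1 := by
    ext a b
    simp [wedgeMatrix, Matrix.one_apply, Fin.ext_iff]
  rw [this]
  simp

/-- With indices from 0, the vector v_0 ∧ ... ∧ v_i has r = i + 1 factors. It is killed by all e_j,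
and h_j acts by 1 if j = i and by 0 otherwise. -/
lemma exists_highestWeightFunctional_fundamental {n : ℕ} (i : Fin n) :
    ∃ φ, IsHighestWeightFunctional (Pi.single i (1 : ℂ)) φ := by
  have hr : (i : ℕ) + 1 ≤ n + 1 := by omega
  set r := (i : ℕ) + 1 with hrdef
  set v := wedgeVec n r with hv
  have hE : ∀ j, tensorRep n r (chevE j) v = 0 := by
    intro j
    rw [hv, tensorRep_wedgeVec hr, Finset.sum_eq_zero, zero_smul]
    · intro a _
      rw [coe_chevE, Matrix.single_apply, if_neg]
      rintro ⟨h1, h2⟩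
      exact absurd (h1.trans h2.symm) j.castSucc_lt_succ.ne
    · intro a b hab
      rw [coe_chevE, Matrix.single_apply, if_neg]
      rintro ⟨rfl, rfl⟩
      exact absurd hab (not_lt.2 j.castSucc_lt_succ.le)
  have hH : ∀ j, tensorRep n r (chevH j) v = (Pi.single i (1 : ℂ) : Fin n → ℂ) j • v := by
    intro j
    rw [hv, tensorRep_wedgeVec hr]
    · congr 1
      have h1 : ∀ a : Fin r, (chevH j : Matrix (Fin (n + 1)) (Fin (n + 1)) ℂ)
          (Fin.castLE hr a) (Fin.castLE hr a) =
          (if (a : ℕ) = j then 1 else 0) - (if (a : ℕ) = j + 1 then 1 else 0) := by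
        intro a
        simp [coe_chevH, Matrix.single_apply, Fin.ext_iff, eq_comm]
      simp only [h1, Finset.sum_sub_distrib]
      rw [Fin.sum_univ_eq_sum_range (fun a => if a = (j : ℕ) then (1 : ℂ) else 0),
        Fin.sum_univ_eq_sum_range (fun a => if a = (j : ℕ) + 1 then (1 : ℂ) else 0)]
      simp only [Finset.sum_ite_eq', Finset.mem_range, Pi.single_apply, Fin.ext_iff]
      split_ifs <;> first | omega | simp
    · intro a b hab
      simp only [coe_chevH, Matrix.sub_apply, Matrix.single_apply]
      rw [if_neg, if_neg, sub_zero]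
      · rintro ⟨rfl, rfl⟩; exact lt_irrefl _ hab
      · rintro ⟨rfl, rfl⟩; exact lt_irrefl _ hab
  let π : Env n →ₐ[ℂ] Module.End ℂ ((Fin r → Fin (n + 1)) → ℂ) :=
    UniversalEnvelopingAlgebra.lift ℂ (tensorRep n r)
  have hπ : ∀ A, π (UniversalEnvelopingAlgebra.ι ℂ A) = tensorRep n r A := fun A =>
    UniversalEnvelopingAlgebra.lift_ι_apply ℂ _ A
  let pair : ((Fin r → Fin (n + 1)) → ℂ) →ₗ[ℂ] ℂ :=
    ∑ s, v s • LinearMap.proj (R := ℂ) (φ := fun _ : Fin r → Fin (n + 1) => ℂ) s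
  have hpair : ∀ Ψ, pair Ψ = ∑ s, v s * Ψ s := by
    intro Ψ
    simp [pair]
  have hadj : ∀ A Ψ, pair (tensorRep n r A Ψ) = ∑ s, tensorRep n r (slTranspose A) v s * Ψ s := by
    intro A Ψ
    rw [hpair, sum_mul_tensorRep]
  have h0 := sum_wedgeVec_sq_ne_zero hr
  rw [← hv, ← hpair] at h0
  -- The functional is x ↦ ⟨v, x v⟩ / ⟨v, v⟩. A generator on the left of x moves to the other
  -- argument by transposition.
  refine ⟨(pair v)⁻¹ • (pair ∘ₗ (LinearMap.applyₗ v) ∘ₗ π.toLinearMap), ?_, ?_, ?_, ?_, ?_⟩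
  · simp [h0]
  · intro j x
    simp only [LinearMap.smul_apply, LinearMap.comp_apply, AlgHom.toLinearMap_apply, map_mul, envF,
      hπ, LinearMap.applyₗ_apply_apply, Module.End.mul_apply, hadj, slTranspose_chevF, hE]
    simp
  · intro j x
    simp only [LinearMap.smul_apply, LinearMap.comp_apply, AlgHom.toLinearMap_apply, map_mul, envE,
      hπ, LinearMap.applyₗ_apply_apply, Module.End.mul_apply, hE]
    simp
  · intro j x
    simp only [LinearMap.smul_apply, LinearMap.comp_apply, AlgHom.toLinearMap_apply, map_mul, envH,
      hπ, LinearMap.applyₗ_apply_apply, Module.End.mul_apply, hadj, slTranspose_chevH, hH, hpair]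
    simp only [Pi.smul_apply, smul_eq_mul, mul_assoc, ← Finset.mul_sum]
    ring
  · intro j x
    simp only [LinearMap.smul_apply, LinearMap.comp_apply, AlgHom.toLinearMap_apply, map_mul, envH,
      hπ, LinearMap.applyₗ_apply_apply, Module.End.mul_apply, hH, map_smul]
    simp only [smul_eq_mul]
    ring

lemma exists_highestWeightFunctional {n : ℕ} (lam : Fin n → ℂ) :
    ∃ φ, IsHighestWeightFunctional lam φ :=
  exists_highestWeightFunctional_of_fundamental exists_highestWeightFunctional_fundamental lam

/-! ### The transposition of the enveloping algebra -/

/-- The antiautomorphism of the enveloping algebra that extends the transposition of matrices, as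
a homomorphism to the opposite algebra. -/
def envTransposeHom (n : ℕ) : Env n →ₐ[ℂ] (Env n)ᵐᵒᵖ :=
  UniversalEnvelopingAlgebra.lift ℂ
    { toFun := fun A => MulOpposite.op (UniversalEnvelopingAlgebra.ι ℂ (slTranspose A))
      map_add' := fun A B => by rw [map_add, map_add, MulOpposite.op_add]
      map_smul' := fun c A => by rw [map_smul, map_smul, MulOpposite.op_smul]; rfl
      map_lie' := fun {A B} => by
        rw [slTranspose_lie, LieHom.map_lie, LieRing.of_associative_ring_bracket,
          LieRing.of_associative_ring_bracket, MulOpposite.op_sub, MulOpposite.op_mul,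
          MulOpposite.op_mul] }

/-- The antiautomorphism of the enveloping algebra that extends the transposition of matrices. -/
def envTranspose (n : ℕ) : Env n →ₗ[ℂ] Env n :=
  (MulOpposite.opLinearEquiv ℂ).symm.toLinearMap ∘ₗ (envTransposeHom n).toLinearMap

lemma envTranspose_ι {n : ℕ} (A : SL n) :
    envTranspose n (UniversalEnvelopingAlgebra.ι ℂ A) =
      UniversalEnvelopingAlgebra.ι ℂ (slTranspose A) :=
  congrArg MulOpposite.unop (UniversalEnvelopingAlgebra.lift_ι_apply ℂ _ A)

lemma envTranspose_one (n : ℕ) : envTranspose n 1 = 1 :=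
  congrArg MulOpposite.unop (map_one (envTransposeHom n))

lemma envTranspose_mul {n : ℕ} (x y : Env n) :
    envTranspose n (x * y) = envTranspose n y * envTranspose n x :=
  congrArg MulOpposite.unop (map_mul (envTransposeHom n) x y)

lemma envTranspose_algebraMap {n : ℕ} (c : ℂ) :
    envTranspose n (algebraMap ℂ _ c) = algebraMap ℂ _ c := by
  rw [Algebra.algebraMap_eq_smul_one, map_smul, envTranspose_one]

lemma envTranspose_E {n : ℕ} (i : Fin n) : envTranspose n (envE i) = envF i := by
  rw [envE, envTranspose_ι, slTranspose_chevE]; rfl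

lemma envTranspose_F {n : ℕ} (i : Fin n) : envTranspose n (envF i) = envE i := by
  rw [envF, envTranspose_ι, slTranspose_chevF]; rfl

lemma envTranspose_H {n : ℕ} (i : Fin n) : envTranspose n (envH i) = envH i := by
  rw [envH, envTranspose_ι, slTranspose_chevH]

lemma envTranspose_envTranspose {n : ℕ} (x : Env n) : envTranspose n (envTranspose n x) = x := by
  let S : Subalgebra ℂ (Env n) :=
    { carrier := {x | envTranspose n (envTranspose n x) = x}
      mul_mem' := fun {x y} hx hy => by
        change envTranspose n (envTranspose n x) = x at hx
        change envTranspose n (envTranspose n y) = y at hy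
        change envTranspose n (envTranspose n (x * y)) = x * y
        rw [envTranspose_mul, envTranspose_mul, hx, hy]
      add_mem' := fun {x y} hx hy => by
        change envTranspose n (envTranspose n x) = x at hx
        change envTranspose n (envTranspose n y) = y at hy
        change envTranspose n (envTranspose n (x + y)) = x + y
        rw [map_add, map_add, hx, hy]
      algebraMap_mem' := fun c => by
        change envTranspose n (envTranspose n _) = _
        rw [envTranspose_algebraMap, envTranspose_algebraMap] }
  have hS : S = ⊤ := env_subalgebra_eq_top_of_ι S fun A => by
    change envTranspose n (envTranspose n _) = _
    rw [envTranspose_ι, envTranspose_ι, slTranspose_slTranspose]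
  have : x ∈ S := by rw [hS]; trivial
  exact this

/-! ### The Shapovalov form of the Verma module -/

/-- Transposition exchanges the left and right conditions on φ, so the average of φ and its
transpose still satisfies them. -/
lemma exists_symmetric_highestWeightFunctional {n : ℕ} (lam : Fin n → ℂ) :
    ∃ φ, IsHighestWeightFunctional lam φ ∧ ∀ x, φ (envTranspose n x) = φ x := by
  obtain ⟨φ, hφ⟩ := exists_highestWeightFunctional lam
  have hval : ∀ x, ((2 : ℂ)⁻¹ • (φ + φ ∘ₗ envTranspose n)) x =
      (2 : ℂ)⁻¹ * (φ x + φ (envTranspose n x)) := fun x => rfl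
  refine ⟨(2 : ℂ)⁻¹ • (φ + φ ∘ₗ envTranspose n), ⟨?_, ?_, ?_, ?_, ?_⟩, ?_⟩
  · rw [hval, envTranspose_one, hφ.map_one]; norm_num
  · intro i x
    rw [hval, envTranspose_mul, envTranspose_F, hφ.f_mul, hφ.mul_e]; ring
  · intro i x
    rw [hval, envTranspose_mul, envTranspose_E, hφ.f_mul, hφ.mul_e]; ring
  · intro i x
    rw [hval, hval, envTranspose_mul, envTranspose_H, hφ.h_mul, hφ.mul_h]; ring
  · intro i x
    rw [hval, hval, envTranspose_mul, envTranspose_H, hφ.h_mul, hφ.mul_h]; ring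
  · intro x
    rw [hval, hval, envTranspose_envTranspose, add_comm]

lemma IsHighestWeightFunctional.mul_mem_vermaIdeal {n : ℕ} {lam : Fin n → ℂ} {φ : Env n →ₗ[ℂ] ℂ}
    (hφ : IsHighestWeightFunctional lam φ) {x : Env n} (hx : x ∈ vermaIdeal lam) (y : Env n) :
    φ (y * x) = 0 := by
  induction hx using Submodule.span_induction generalizing y with
  | mem x hx =>
    rcases hx with ⟨i, rfl⟩ | ⟨i, rfl⟩
    · exact hφ.mul_e i y
    · have := hφ.mul_h i y
      simp only [mul_sub, map_sub, Algebra.algebraMap_eq_smul_one, mul_smul_comm, mul_one, map_smul]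
      change φ (y * envH i) - _ = 0
      rw [this, smul_eq_mul, sub_self]
  | zero => simp
  | add x z _ _ hx hz => rw [mul_add, map_add, hx, hz, add_zero]
  | smul a x _ hx => rw [smul_eq_mul, ← mul_assoc, hx]

lemma vermaRep_mk {n : ℕ} (lam : Fin n → ℂ) (A : SL n) (x : Env n) :
    vermaRep lam A (Submodule.Quotient.mk x) =
      Submodule.Quotient.mk (UniversalEnvelopingAlgebra.ι ℂ A * x) := rfl

/-- The form is B(x v, y v) = φ(xᵀ y). Contravariance is (e_i x)ᵀ y = xᵀ f_i y, and symmetry is the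
invariance of φ under transposition. -/
lemma exists_isShapovalovForm_verma {n : ℕ} (lam : Fin n → ℂ) :
    ∃ B, IsShapovalovForm (vermaRep lam) (vermaVec lam) B := by
  obtain ⟨φ, hφ, hsymm⟩ := exists_symmetric_highestWeightFunctional lam
  have hswap : ∀ a b, φ (envTranspose n a * b) = φ (envTranspose n b * a) := by
    intro a b
    rw [← hsymm, envTranspose_mul, envTranspose_envTranspose]
  -- Independence of the representative is proved on the right, since φ kills the left ideal even
  -- after left multiplication. Symmetry carries it to the left argument.
  have hr : ∀ a b b' : Env n, (Submodule.Quotient.mk b : Verma lam) = Submodule.Quotient.mk b' →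
      φ (envTranspose n a * b) = φ (envTranspose n a * b') := by
    intro a b b' h
    rw [Submodule.Quotient.eq] at h
    rw [← sub_eq_zero, ← map_sub, ← mul_sub]
    exact hφ.mul_mem_vermaIdeal h _
  have hwd : ∀ a a' b b' : Env n,
      (Submodule.Quotient.mk a : Verma lam) = Submodule.Quotient.mk a' →
      (Submodule.Quotient.mk b : Verma lam) = Submodule.Quotient.mk b' →
      φ (envTranspose n a * b) = φ (envTranspose n a' * b') := by
    intro a a' b b' ha hb
    rw [hr a b b' hb, hswap, hr b' a a' ha, hswap]
  have hsurj : ∀ x : Verma lam, ∃ a : Env n, Submodule.Quotient.mk a = x :=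
    Submodule.Quotient.mk_surjective _
  choose rep hrep using hsurj
  let B : LinearMap.BilinForm ℂ (Verma lam) :=
    LinearMap.mk₂ ℂ (fun x y => φ (envTranspose n (rep x) * rep y))
      (fun x x' y => by
        rw [hwd (rep (x + x')) (rep x + rep x') (rep y) (rep y)
          (by rw [hrep, Submodule.Quotient.mk_add, hrep, hrep]) rfl, map_add, add_mul, map_add])
      (fun c x y => by
        rw [hwd (rep (c • x)) (c • rep x) (rep y) (rep y)
          (by rw [hrep, Submodule.Quotient.mk_smul, hrep]) rfl, map_smul, smul_mul_assoc, map_smul])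
      (fun x y y' => by
        rw [hwd (rep x) (rep x) (rep (y + y')) (rep y + rep y') rfl
          (by rw [hrep, Submodule.Quotient.mk_add, hrep, hrep]), mul_add, map_add])
      (fun c x y => by
        rw [hwd (rep x) (rep x) (rep (c • y)) (c • rep y) rfl
          (by rw [hrep, Submodule.Quotient.mk_smul, hrep]), mul_smul_comm, map_smul])
  have hB : ∀ a b : Env n, B (Submodule.Quotient.mk a) (Submodule.Quotient.mk b) =
      φ (envTranspose n a * b) := fun a b => hwd _ _ _ _ (hrep _) (hrep _)
  refine ⟨B, ?_, ?_, ?_⟩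
  · intro x y
    rw [← hrep x, ← hrep y, hB, hB, hswap]
  · intro i x y
    rw [← hrep x, ← hrep y, vermaRep_mk, vermaRep_mk, hB, hB, envTranspose_mul]
    change φ (_ * envTranspose n (envE i) * _) = φ (_ * (envF i * _))
    rw [envTranspose_E, mul_assoc]
  · change B (Submodule.Quotient.mk 1) (Submodule.Quotient.mk 1) = 1
    rw [hB, envTranspose_one, mul_one, hφ.map_one]

/-! ### Uniqueness of Shapovalov forms -/

/-- A symmetric contravariant form on a module that is generated from a vector killed by the `e_i`
by the action of the `f_i` is determined by its value at this vector. -/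
lemma IsShapovalovForm.eq_of_cyclic {n : ℕ} {V : Type*} [AddCommGroup V] [Module ℂ V]
    {ρ : SL n →ₗ⁅ℂ⁆ Module.End ℂ V} {v : V} (he : ∀ i, ρ (chevE i) v = 0)
    (hcyc : ∀ P : Submodule ℂ V, v ∈ P → (∀ i, ∀ x ∈ P, ρ (chevF i) x ∈ P) → P = ⊤)
    {B B' : LinearMap.BilinForm ℂ V} (hB : IsShapovalovForm ρ v B)
    (hB' : IsShapovalovForm ρ v B') : B = B' := by
  -- When one argument is v, an f_i on the other becomes an e_i on v and gives zero, so the two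
  -- forms agree on v. The second step extends this to all first arguments.
  have h1 : LinearMap.ker (B v - B' v) = ⊤ := by
    apply hcyc
    · rw [LinearMap.mem_ker, LinearMap.sub_apply, hB.normalized, hB'.normalized, sub_self]
    · intro i x _
      rw [LinearMap.mem_ker, LinearMap.sub_apply, ← hB.contravariant, ← hB'.contravariant, he]
      simp
  have h2 : LinearMap.ker (B - B') = ⊤ := by
    apply hcyc
    · rw [LinearMap.mem_ker, LinearMap.sub_apply]
      exact LinearMap.ker_eq_top.1 h1
    · intro i x hx
      rw [LinearMap.mem_ker] at hx ⊢
      ext y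
      have hx := LinearMap.congr_fun hx (ρ (chevE i) y)
      rw [LinearMap.sub_apply, LinearMap.sub_apply] at hx ⊢
      rw [hB.symm, hB'.symm, ← hB.contravariant, ← hB'.contravariant, hB.symm, hB'.symm]
      exact hx
  exact sub_eq_zero.1 (LinearMap.ker_eq_top.1 h2)

lemma vermaRep_chevE {n : ℕ} (lam : Fin n → ℂ) (i : Fin n) :
    vermaRep lam (chevE i) (vermaVec lam) = 0 := by
  rw [vermaVec, vermaRep_mk, mul_one, Submodule.Quotient.mk_eq_zero]
  exact Ideal.subset_span (Or.inl ⟨i, rfl⟩)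

lemma vermaRep_chevH {n : ℕ} (lam : Fin n → ℂ) (i : Fin n) :
    vermaRep lam (chevH i) (vermaVec lam) = lam i • vermaVec lam := by
  rw [vermaVec, vermaRep_mk, mul_one, ← Submodule.Quotient.mk_smul, Submodule.Quotient.eq,
    ← Algebra.algebraMap_eq_smul_one]
  exact Ideal.subset_span (Or.inr ⟨i, rfl⟩)

lemma vermaRep_chevH_chevF {n : ℕ} (lam : Fin n → ℂ) (i j : Fin n) (x : Verma lam) :
    vermaRep lam (chevH i) (vermaRep lam (chevF j) x) =
      vermaRep lam (chevF j) (vermaRep lam (chevH i) x) - cartan i j • vermaRep lam (chevF j) x := by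
  have h := LinearMap.congr_fun (congrArg (vermaRep lam) (lie_chevH_chevF i j)) x
  rw [LieHom.map_lie, LieRing.of_associative_ring_bracket, map_smul, LinearMap.sub_apply,
    Module.End.mul_apply, Module.End.mul_apply, LinearMap.smul_apply, sub_eq_iff_eq_add] at h
  rw [h, neg_smul]
  abel

lemma verma_cyclic {n : ℕ} (lam : Fin n → ℂ) (P : Submodule ℂ (Verma lam)) (hv : vermaVec lam ∈ P)
    (hf : ∀ i, ∀ x ∈ P, vermaRep lam (chevF i) x ∈ P) : P = ⊤ := by
  -- The given `P` need not be stable under the h_i. The smallest submodule `Q` with the same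
  -- properties is, and the triangular criterion applies to it.
  let F : Set (Submodule ℂ (Verma lam)) :=
    {Q | vermaVec lam ∈ Q ∧ ∀ i, ∀ x ∈ Q, vermaRep lam (chevF i) x ∈ Q}
  let Q : Submodule ℂ (Verma lam) := sInf F
  have hQv : vermaVec lam ∈ Q := Submodule.mem_sInf.2 fun R hR => hR.1
  have hQf : ∀ i, ∀ x ∈ Q, vermaRep lam (chevF i) x ∈ Q := fun i x hx =>
    Submodule.mem_sInf.2 fun R hR => hR.2 i x (Submodule.mem_sInf.1 hx R hR)
  have hQh : ∀ i, ∀ x ∈ Q, vermaRep lam (chevH i) x ∈ Q := by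
    intro i x hx
    -- The vectors of `Q` that h_i sends into `Q` again contain v and are stable under the f_j, so
    -- by minimality they exhaust `Q`.
    have hR : Q ⊓ Q.comap (vermaRep lam (chevH i)) ∈ F := by
      refine ⟨⟨hQv, ?_⟩, fun j y hy => ⟨hQf j y hy.1, ?_⟩⟩
      · change vermaRep lam (chevH i) _ ∈ Q
        rw [vermaRep_chevH]
        exact Q.smul_mem _ hQv
      · change vermaRep lam (chevH i) _ ∈ Q
        rw [vermaRep_chevH_chevF]
        exact Q.sub_mem (hQf j _ hy.2) (Q.smul_mem _ (hQf j _ hy.1))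
    exact (Submodule.mem_sInf.1 hx _ hR).2
  let mk : Env n →ₗ[ℂ] Verma lam :=
    { toFun := Submodule.Quotient.mk
      map_add' := fun _ _ => rfl
      map_smul' := fun _ _ => rfl }
  have htop : Q.comap mk = ⊤ := by
    apply submodule_eq_top_of_triangular
    · exact hQv
    · exact fun i x hx => hQf i _ hx
    · intro i x
      have : mk (x * envE i) = 0 := (Submodule.Quotient.mk_eq_zero _).2
        ((vermaIdeal lam).mul_mem_left x (Ideal.subset_span (Or.inl ⟨i, rfl⟩)))
      rw [Submodule.mem_comap, this]
      exact Q.zero_mem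
    · exact fun i x hx => hQh i _ hx
  rw [eq_top_iff]
  rintro x -
  obtain ⟨a, rfl⟩ := Submodule.Quotient.mk_surjective _ x
  have ha : a ∈ Q.comap mk := by rw [htop]; trivial
  exact Submodule.mem_sInf.1 ha P ⟨hv, hf⟩

lemma existsUnique_isShapovalovForm_verma {n : ℕ} (lam : Fin n → ℂ) :
    ∃! B, IsShapovalovForm (vermaRep lam) (vermaVec lam) B :=
  existsUnique_of_exists_of_unique (exists_isShapovalovForm_verma lam) fun _ _ hB hB' =>
    hB.eq_of_cyclic (vermaRep_chevE lam) (verma_cyclic lam) hB'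

/-! ### The linear representation -/

lemma linRep_apply {n : ℕ} (A : SL n) (x : Fin (n + 1) → ℂ) :
    linRep n A x = (A : Matrix (Fin (n + 1)) (Fin (n + 1)) ℂ).mulVec x := rfl

lemma linRep_chevF {n : ℕ} (i : Fin n) (j : Fin (n + 1)) :
    linRep n (chevF i) (Pi.single j 1) = if j = i.castSucc then Pi.single i.succ 1 else 0 := by
  rw [linRep_apply, coe_chevF]
  split_ifs with h
  · subst h
    ext a
    simp [Matrix.single_apply, Pi.single_apply, eq_comm]
  · ext a
    simp only [Matrix.mulVec_single_one, Matrix.col_apply, Matrix.single_apply, Pi.zero_apply]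
    rw [if_neg]
    rintro ⟨-, h'⟩
    exact h h'.symm

lemma linRep_chevE_linVec {n : ℕ} (i : Fin n) : linRep n (chevE i) (linVec n) = 0 := by
  rw [linRep_apply, coe_chevE, linVec]
  ext a
  simp only [Matrix.mulVec_single_one, Matrix.col_apply, Matrix.single_apply, Pi.zero_apply]
  rw [if_neg]
  rintro ⟨-, h'⟩
  exact Fin.succ_ne_zero _ h'

lemma linRep_cyclic {n : ℕ} (P : Submodule ℂ (Fin (n + 1) → ℂ)) (hv : linVec n ∈ P)
    (hf : ∀ i, ∀ x ∈ P, linRep n (chevF i) x ∈ P) : P = ⊤ := by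
  have h : ∀ j : Fin (n + 1), (Pi.single j (1 : ℂ) : Fin (n + 1) → ℂ) ∈ P := by
    intro j
    induction j using Fin.induction with
    | zero => exact hv
    | succ i ih =>
      have := hf i _ ih
      rwa [linRep_chevF, if_pos rfl] at this
  rw [eq_top_iff]
  rintro x -
  have hx : x = ∑ j, x j • (Pi.single j (1 : ℂ) : Fin (n + 1) → ℂ) := by
    ext a; simp [Finset.sum_apply, Pi.single_apply]
  rw [hx]
  exact P.sum_mem fun j _ => P.smul_mem _ (h j)

/-- The standard symmetric form on column vectors. -/
def dotForm (n : ℕ) : LinearMap.BilinForm ℂ (Fin (n + 1) → ℂ) := dotProductBilin ℂ ℂ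

/-- The matrix of e_i is the transpose of that of f_i. -/
lemma isShapovalovForm_dotForm (n : ℕ) : IsShapovalovForm (linRep n) (linVec n) (dotForm n) where
  symm x y := by
    change dotProduct x y = dotProduct y x
    exact dotProduct_comm x y
  contravariant i x y := by
    change dotProduct (linRep n (chevE i) x) y = dotProduct x (linRep n (chevF i) y)
    rw [linRep_apply, linRep_apply, ← slTranspose_chevE, coe_slTranspose,
      Matrix.mulVec_transpose, dotProduct_comm x, ← Matrix.dotProduct_mulVec, dotProduct_comm]
  normalized := by
    change dotProduct (linVec n) (linVec n) = 1
    simp [linVec]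

lemma IsShapovalovForm.eq_dotForm {n : ℕ} {B : LinearMap.BilinForm ℂ (Fin (n + 1) → ℂ)}
    (hB : IsShapovalovForm (linRep n) (linVec n) B) : B = dotForm n :=
  hB.eq_of_cyclic linRep_chevE_linVec linRep_cyclic (isShapovalovForm_dotForm n)

lemma existsUnique_isShapovalovForm_linRep (n : ℕ) :
    ∃! B, IsShapovalovForm (linRep n) (linVec n) B :=
  ⟨dotForm n, isShapovalovForm_dotForm n, fun _ hB => hB.eq_dotForm⟩

/-! ### Sums over insertions of a letter into a word -/

section Insertions

variable {k : ℕ} {A : Type*} [Ring A]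

/-- Each letter commutes with all later letters but the next one. -/
def CommuteApart (g : Fin k → A) : List (Fin k) → Prop
  | [] => True
  | [_] => True
  | a :: b :: l => (∀ x ∈ l, Commute (g a) (g x)) ∧ CommuteApart g (b :: l)

lemma CommuteApart.congr {g g' : Fin k → A} : ∀ (l : List (Fin k)) (_ : ∀ x ∈ l, g x = g' x)
    (_ : CommuteApart g l), CommuteApart g' l
  | [], _, _ => trivial
  | [_], _, _ => trivial
  | a :: b :: l, h, hg => by
    refine ⟨fun x hx => ?_, CommuteApart.congr (b :: l)
      (fun x hx => h x (List.mem_cons_of_mem _ hx)) hg.2⟩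
    rw [← h a List.mem_cons_self,
      ← h x (List.mem_cons_of_mem _ (List.mem_cons_of_mem _ hx))]
    exact hg.1 x hx

lemma CommuteApart.update {g : Fin k → A} {b : Fin k} {l : List (Fin k)} (hb : b ∉ l)
    (h : CommuteApart g (b :: l)) {X : A} (hX : ∀ x ∈ l.tail, Commute X (g x)) :
    CommuteApart (Function.update g b X) (b :: l) := by
  cases l with
  | nil => trivial
  | cons c l =>
    refine ⟨fun x hx => ?_, CommuteApart.congr (c :: l) (fun x hx => ?_) h.2⟩
    · rw [Function.update_self, Function.update_of_ne]
      · exact hX x hx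
      · rintro rfl
        exact hb (List.mem_cons_of_mem _ hx)
    · rw [Function.update_of_ne]
      rintro rfl
      exact hb hx

lemma CommuteApart.tail_commute {g : Fin k → A} {b : Fin k} {l : List (Fin k)}
    (h : CommuteApart g (b :: l)) : ∀ x ∈ l.tail, Commute (g b) (g x) := by
  cases l with
  | nil => simp
  | cons c l => exact h.1

variable [Algebra ℂ A]

lemma chainFn_cons_cons (t : Fin k → ℂ) (z : ℂ) (i j : Fin k) (w : List (Fin k)) :
    chainFn t z (i :: j :: w) = (t i - t j)⁻¹ * chainFn t z (j :: w) := rfl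

lemma sum_map_flatMap {α β M : Type*} [AddCommMonoid M] (l : List α) (G : α → List β) (F : β → M) :
    ((l.flatMap G).map F).sum = (l.map fun x => ((G x).map F).sum).sum := by
  induction l with
  | nil => simp
  | cons a l ih => simp [List.flatMap_cons, ih]

lemma sum_permutations'Aux_cons {α M : Type*} [AddCommMonoid M] (a x : α) (l : List α)
    (F : List α → M) :
    ((List.permutations'Aux a (x :: l)).map F).sum =
      F (a :: x :: l) + ((List.permutations'Aux a l).map fun w => F (x :: w)).sum := by
  rw [List.permutations'Aux, List.map_cons, List.sum_cons, List.map_map]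
  rfl

/-- Partial fractions: the cost of inserting a between x and y is a difference, and these
differences telescope as the place of insertion moves along a word. -/
lemma inv_sub_add_inv_sub {x y a : ℂ} (hxa : x ≠ a) (hay : a ≠ y) (hxy : x ≠ y) :
    (x - a)⁻¹ * (a - y)⁻¹ = (x - y)⁻¹ * ((a - y)⁻¹ - (a - x)⁻¹) := by
  have h1 := sub_ne_zero.2 hxa
  have h2 := sub_ne_zero.2 hay
  have h3 := sub_ne_zero.2 hxy
  have h4 := sub_ne_zero.2 hxa.symm
  field_simp
  ring

/-- Insertion of a letter that commutes with all letters of the word, after a fixed letter. -/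
lemma sum_insert_of_commute {t : Fin k → ℂ} (ht : Function.Injective t) {z : ℂ}
    (hz : ∀ j, t j ≠ z) (g : Fin k → A) (a : Fin k) (l : List (Fin k)) :
    ∀ y : Fin k, (a :: y :: l).Nodup → (∀ x ∈ l, Commute (g a) (g x)) →
    ((List.permutations'Aux a l).map fun w => chainFn t z (y :: w) • (w.map g).prod).sum =
      (chainFn t z (y :: l) * ((t a - z)⁻¹ - (t a - t y)⁻¹)) • (g a * (l.map g).prod) := by
  induction l with
  | nil =>
    intro y hnd _
    have hay : t y ≠ t a := ht.ne (by rintro rfl; simp at hnd)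
    have h := inv_sub_add_inv_sub hay (hz a) (hz y)
    simp [List.permutations'Aux, chainFn, h]
  | cons x l ih =>
    intro y hnd hc
    have hay : t y ≠ t a := ht.ne (by rintro rfl; simp at hnd)
    have hax : t a ≠ t x := ht.ne (by rintro rfl; simp at hnd)
    have hyx : t y ≠ t x := ht.ne (by rintro rfl; simp at hnd)
    have hnd' : (a :: x :: l).Nodup := by
      simp only [List.nodup_cons, List.mem_cons] at hnd ⊢; tauto
    have hcx : Commute (g a) (g x) := hc x List.mem_cons_self
    rw [sum_permutations'Aux_cons]
    have h1 : ((List.permutations'Aux a l).map fun w =>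
        chainFn t z (y :: x :: w) • ((x :: w).map g).prod).sum =
        (t y - t x)⁻¹ • (g x * ((List.permutations'Aux a l).map fun w =>
          chainFn t z (x :: w) • (w.map g).prod).sum) := by
      rw [← List.sum_map_mul_left, List.smul_sum, List.map_map]
      congr 1
      refine List.map_congr_left fun w _ => ?_
      simp only [Function.comp_apply, chainFn_cons_cons, List.map_cons, List.prod_cons,
        mul_smul_comm, smul_smul]
    rw [h1, ih x hnd' fun u hu => hc u (List.mem_cons_of_mem _ hu)]
    simp only [chainFn_cons_cons, List.map_cons, List.prod_cons, mul_smul_comm, smul_smul]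
    rw [← mul_assoc (g x), ← hcx.eq, mul_assoc, ← add_smul]
    congr 1
    -- Insertion before x contributes (t_a - t_x)⁻¹ - (t_a - t_y)⁻¹; its first term cancels against
    -- the later insertions.
    rw [← mul_assoc, inv_sub_add_inv_sub hay hax hyx]
    ring

/-- The operator that replaces a letter `Y` when the letter `X` is inserted into a word. -/
def mergeStep (x y : ℂ) (X Y : A) : A :=
  (x - y)⁻¹ • (X * Y) + (x⁻¹ - (x - y)⁻¹) • (Y * X)

/-- Insertion of a letter that commutes with all letters of the word but one, after a fixed
letter. -/
lemma sum_insert_after {t : Fin k → ℂ} (ht : Function.Injective t) (hz : ∀ j, t j ≠ 0)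
    (g : Fin k → A) (a b : Fin k) (Q P : List (Fin k)) :
    ∀ y : Fin k, (a :: y :: (P ++ b :: Q)).Nodup → (∀ x ∈ P ++ Q, Commute (g a) (g x)) →
    ((List.permutations'Aux a (P ++ b :: Q)).map fun w =>
        chainFn t 0 (y :: w) • (w.map g).prod).sum =
      chainFn t 0 (y :: (P ++ b :: Q)) • ((P.map g).prod *
        (mergeStep (t a) (t b) (g a) (g b) - (t a - t y)⁻¹ • (g a * g b)) * (Q.map g).prod) := by
  induction P with
  | nil =>
    intro y hnd hc
    rw [List.nil_append] at hnd hc ⊢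
    have hay : t y ≠ t a := ht.ne (by rintro rfl; simp at hnd)
    have hab : t a ≠ t b := ht.ne (by rintro rfl; simp at hnd)
    have hyb : t y ≠ t b := ht.ne (by rintro rfl; simp at hnd)
    have hnd' : (a :: b :: Q).Nodup := by
      simp only [List.nodup_cons, List.mem_cons] at hnd ⊢; tauto
    rw [sum_permutations'Aux_cons]
    have h1 : ((List.permutations'Aux a Q).map fun w =>
        chainFn t 0 (y :: b :: w) • ((b :: w).map g).prod).sum =
        (t y - t b)⁻¹ • (g b * ((List.permutations'Aux a Q).map fun w =>
          chainFn t 0 (b :: w) • (w.map g).prod).sum) := by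
      rw [← List.sum_map_mul_left, List.smul_sum, List.map_map]
      congr 1
      refine List.map_congr_left fun w _ => ?_
      simp only [Function.comp_apply, chainFn_cons_cons, List.map_cons, List.prod_cons,
        mul_smul_comm, smul_smul]
    -- Insertion before b yields g_a g_b and all later insertions yield g_b g_a. The coefficients
    -- are those of `mergeStep`, up to the boundary term at y.
    rw [h1, sum_insert_of_commute ht hz g a Q b hnd' hc]
    simp only [chainFn_cons_cons, List.map_cons, List.prod_cons, List.map_nil, List.prod_nil,
      one_mul, mul_smul_comm, smul_smul, mergeStep, sub_mul, add_mul, smul_mul_assoc, smul_sub,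
      smul_add, mul_assoc, sub_zero]
    rw [← mul_assoc (t y - t a)⁻¹, inv_sub_add_inv_sub hay hab hyb]
    module
  | cons x P ih =>
    intro y hnd hc
    rw [List.cons_append] at hnd hc ⊢
    have hay : t y ≠ t a := ht.ne (by rintro rfl; simp at hnd)
    have hax : t a ≠ t x := ht.ne (by rintro rfl; simp at hnd)
    have hyx : t y ≠ t x := ht.ne (by rintro rfl; simp at hnd)
    have hnd' : (a :: x :: (P ++ b :: Q)).Nodup := by
      simp only [List.nodup_cons, List.mem_cons] at hnd ⊢; tauto
    have hcP : Commute (g a) ((x :: P).map g).prod := by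
      refine Commute.list_prod_right _ _ fun u hu => ?_
      obtain ⟨v, hv, rfl⟩ := List.mem_map.1 hu
      refine hc v ?_
      rw [← List.cons_append]
      exact List.mem_append_left _ hv
    rw [sum_permutations'Aux_cons]
    have h1 : ((List.permutations'Aux a (P ++ b :: Q)).map fun w =>
        chainFn t 0 (y :: x :: w) • ((x :: w).map g).prod).sum =
        (t y - t x)⁻¹ • (g x * ((List.permutations'Aux a (P ++ b :: Q)).map fun w =>
          chainFn t 0 (x :: w) • (w.map g).prod).sum) := by
      rw [← List.sum_map_mul_left, List.smul_sum, List.map_map]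
      congr 1
      refine List.map_congr_left fun w _ => ?_
      simp only [Function.comp_apply, chainFn_cons_cons, List.map_cons, List.prod_cons,
        mul_smul_comm, smul_smul]
    rw [h1, ih x hnd' fun u hu => hc u (List.mem_cons_of_mem _ hu)]
    have h2 : ((a :: x :: (P ++ b :: Q)).map g).prod =
        ((x :: P).map g).prod * (g a * g b) * (Q.map g).prod := by
      rw [List.map_cons, List.prod_cons, ← List.cons_append, List.map_append, List.prod_append,
        ← mul_assoc, hcP.eq, List.map_cons (a := b), List.prod_cons]
      simp only [mul_assoc]
    rw [h2]
    simp only [chainFn_cons_cons, List.map_cons, List.prod_cons, mul_smul_comm, smul_smul,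
      sub_mul, mul_sub, smul_mul_assoc, smul_sub, mul_assoc]
    rw [← mul_assoc (t y - t a)⁻¹, inv_sub_add_inv_sub hay hax hyx]
    module

/-- Insertion of a letter that commutes with all letters of the word but one. -/
lemma sum_insert {t : Fin k → ℂ} (ht : Function.Injective t) (hz : ∀ j, t j ≠ 0)
    (g : Fin k → A) (a b : Fin k) (P Q : List (Fin k)) (hnd : (a :: (P ++ b :: Q)).Nodup)
    (hc : ∀ x ∈ P ++ Q, Commute (g a) (g x)) :
    ((List.permutations'Aux a (P ++ b :: Q)).map fun w => chainFn t 0 w • (w.map g).prod).sum =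
      chainFn t 0 (P ++ b :: Q) • ((P.map g).prod * mergeStep (t a) (t b) (g a) (g b) *
        (Q.map g).prod) := by
  cases P with
  | nil =>
    rw [List.nil_append] at hnd hc ⊢
    rw [sum_permutations'Aux_cons]
    have h1 : ((List.permutations'Aux a Q).map fun w =>
        chainFn t 0 (b :: w) • ((b :: w).map g).prod).sum =
        (g b * ((List.permutations'Aux a Q).map fun w =>
          chainFn t 0 (b :: w) • (w.map g).prod).sum) := by
      rw [← List.sum_map_mul_left]
      congr 1
      refine List.map_congr_left fun w _ => ?_
      simp only [List.map_cons, List.prod_cons, mul_smul_comm]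
    rw [h1, sum_insert_of_commute ht hz g a Q b hnd hc]
    simp only [chainFn_cons_cons, List.map_cons, List.prod_cons, List.map_nil, List.prod_nil,
      one_mul, mul_smul_comm, smul_smul, mergeStep, add_mul, smul_mul_assoc,
      smul_add, mul_assoc, sub_zero]
    module
  | cons x P =>
    rw [List.cons_append] at hnd hc ⊢
    have hcP : Commute (g a) ((x :: P).map g).prod := by
      refine Commute.list_prod_right _ _ fun u hu => ?_
      obtain ⟨v, hv, rfl⟩ := List.mem_map.1 hu
      refine hc v ?_
      rw [← List.cons_append]
      exact List.mem_append_left _ hv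
    rw [sum_permutations'Aux_cons]
    have h1 : ((List.permutations'Aux a (P ++ b :: Q)).map fun w =>
        chainFn t 0 (x :: w) • ((x :: w).map g).prod).sum =
        (g x * ((List.permutations'Aux a (P ++ b :: Q)).map fun w =>
          chainFn t 0 (x :: w) • (w.map g).prod).sum) := by
      rw [← List.sum_map_mul_left]
      congr 1
      refine List.map_congr_left fun w _ => ?_
      simp only [List.map_cons, List.prod_cons, mul_smul_comm]
    rw [h1, sum_insert_after ht hz g a b Q P x hnd fun u hu => hc u (List.mem_cons_of_mem _ hu)]
    -- Insertion at the very front has coefficient (t_a - t_x)⁻¹ and cancels the boundary term left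
    -- by the insertions after x.
    have h2 : ((a :: x :: (P ++ b :: Q)).map g).prod =
        ((x :: P).map g).prod * (g a * g b) * (Q.map g).prod := by
      rw [List.map_cons, List.prod_cons, ← List.cons_append, List.map_append, List.prod_append,
        ← mul_assoc, hcP.eq, List.map_cons (a := b), List.prod_cons]
      simp only [mul_assoc]
    rw [h2]
    simp only [chainFn_cons_cons, List.map_cons, List.prod_cons, mul_smul_comm,
      sub_mul, mul_sub, smul_mul_assoc, smul_sub, mul_assoc, smul_smul]
    module

/-- The operator obtained by merging the letters of a word one after another, starting with `X` in
the place of the letter `a`. -/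
def mergeChain (t : Fin k → ℂ) (g : Fin k → A) : A → Fin k → List (Fin k) → A
  | X, a, [] => (t a)⁻¹ • X
  | X, a, b :: l => mergeChain t g (mergeStep (t a) (t b) X (g b)) b l

lemma mergeChain_congr (t : Fin k → ℂ) {g g' : Fin k → A} (l : List (Fin k))
    (h : ∀ x ∈ l, g x = g' x) : ∀ (X : A) (a : Fin k),
    mergeChain t g X a l = mergeChain t g' X a l := by
  induction l with
  | nil => exact fun _ _ => rfl
  | cons b l ih =>
    intro X a
    rw [mergeChain, mergeChain, h b List.mem_cons_self,
      ih fun x hx => h x (List.mem_cons_of_mem _ hx)]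

/-- The sum over all orderings of a word of its letters, weighted by the chain functions. -/
theorem sum_permutations_chainFn {t : Fin k → ℂ} (ht : Function.Injective t) (hz : ∀ j, t j ≠ 0)
    (l : List (Fin k)) : ∀ (a : Fin k) (g : Fin k → A), (a :: l).Nodup → CommuteApart g (a :: l) →
    (((a :: l).permutations').map fun w => chainFn t 0 w • (w.map g).prod).sum =
      mergeChain t g (g a) a l := by
  induction l with
  | nil =>
    intro a g _ _
    simp [List.permutations', List.permutations'Aux, chainFn, mergeChain]
  | cons b l ih =>
    intro a g hnd hc
    have hbl : (b :: l).Nodup := (List.nodup_cons.1 hnd).2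
    have hb : b ∉ l := (List.nodup_cons.1 hbl).1
    -- Summing over the positions of a replaces g_b by `X`. Since `X` is built from g_a and g_b, it
    -- commutes with every letter past the neighbour of b, so the shorter word b :: l satisfies the
    -- hypotheses again.
    set X := mergeStep (t a) (t b) (g a) (g b) with hX
    have hXc : ∀ x ∈ l.tail, Commute X (g x) := by
      intro x hx
      have h1 : Commute (g a) (g x) := hc.1 x (List.mem_of_mem_tail hx)
      have h2 : Commute (g b) (g x) := hc.2.tail_commute x hx
      exact ((h1.mul_left h2).smul_left _).add_left ((h2.mul_left h1).smul_left _)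
    have hmain := ih b (Function.update g b X) hbl (hc.2.update hb hXc)
    rw [mergeChain, ← hX, mergeChain_congr t l (g := g) (g' := Function.update g b X)
      (fun x hx => by rw [Function.update_of_ne]; rintro rfl; exact hb hx)]
    rw [Function.update_self] at hmain
    rw [← hmain, List.permutations', sum_map_flatMap]
    congr 1
    refine List.map_congr_left fun w hw => ?_
    have hperm : w.Perm (b :: l) := List.mem_permutations'.1 hw
    obtain ⟨P, Q, rfl⟩ := List.append_of_mem (hperm.mem_iff.2 List.mem_cons_self)
    have hPQ : (P ++ Q).Perm l := (List.perm_middle.symm.trans hperm).cons_inv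
    have hnotP : ∀ x ∈ P ++ Q, x ≠ b := by
      rintro x hx rfl
      exact hb (hPQ.mem_iff.1 hx)
    rw [sum_insert ht hz g a b P Q ((hperm.cons a).nodup_iff.2 hnd)
      fun x hx => hc.1 x (hPQ.mem_iff.1 hx)]
    have hmap : ∀ R : List (Fin k), (∀ x ∈ R, x ≠ b) →
        R.map (Function.update g b X) = R.map g := fun R hR =>
      List.map_congr_left fun x hx => Function.update_of_ne (hR x hx) _ _
    rw [List.map_append, List.map_cons, List.prod_append, List.prod_cons, Function.update_self,
      hmap P fun x hx => hnotP x (List.mem_append_left _ hx),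
      hmap Q fun x hx => hnotP x (List.mem_append_right _ hx), ← hX]
    simp only [mul_assoc]

end Insertions

/-! ### Sums over the ways to cut a word in two -/

section Cuts

variable {α M : Type*} [AddCommMonoid M]

/-- The sum of `H I J` over all ways to write a word as `I ++ J`. -/
def cutSum : (List α → List α → M) → List α → M
  | H, [] => H [] []
  | H, x :: w => H [] (x :: w) + cutSum (fun I J => H (x :: I) J) w

lemma cutSum_eq_sum_range (w : List α) : ∀ H : List α → List α → M,
    ∑ p ∈ Finset.range (w.length + 1), H (w.take p) (w.drop p) = cutSum H w := by
  induction w with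
  | nil => intro H; simp [cutSum]
  | cons x w ih =>
    intro H
    rw [List.length_cons, Finset.sum_range_succ', cutSum, add_comm, ← ih]
    rfl

lemma cutSum_add (w : List α) : ∀ H H' : List α → List α → M,
    cutSum (fun I J => H I J + H' I J) w = cutSum H w + cutSum H' w := by
  induction w with
  | nil => intro H H'; rfl
  | cons x w ih =>
    intro H H'
    simp only [cutSum]
    rw [ih]
    abel

lemma cutSum_congr (w : List α) : ∀ {H H' : List α → List α → M}
    (_ : ∀ I J, (∀ x ∈ J, x ∈ w) → H I J = H' I J), cutSum H w = cutSum H' w := by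
  induction w with
  | nil => intro H H' h; exact h _ _ (by simp)
  | cons x w ih =>
    intro H H' h
    simp only [cutSum]
    rw [h _ _ fun _ hy => hy, ih fun I J hJ => h _ _ fun y hy => List.mem_cons_of_mem _ (hJ y hy)]

lemma cutSum_eq_single (w : List α) : ∀ {H : List α → List α → M}
    (_ : ∀ I J, (∀ x ∈ J, x ∈ w) → J ≠ [] → H I J = 0), cutSum H w = H w [] := by
  induction w with
  | nil => intro H _; rfl
  | cons x w ih =>
    intro H h
    simp only [cutSum]
    rw [h _ _ (fun _ hy => hy) (by simp), zero_add,
      ih fun I J hJ => h _ _ fun y hy => List.mem_cons_of_mem _ (hJ y hy)]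

/-- Inserting and then cutting amounts to cutting and then inserting into one of the two pieces. The
two insertions at the cut itself, ending `I` or beginning `J`, correspond to different cuts of the
enlarged word. -/
lemma sum_insert_cutSum (a : α) (w : List α) : ∀ H : List α → List α → M,
    ((List.permutations'Aux a w).map (cutSum H)).sum =
      cutSum (fun I J => ((List.permutations'Aux a I).map fun I' => H I' J).sum +
        ((List.permutations'Aux a J).map fun J' => H I J').sum) w := by
  induction w with
  | nil => intro H; simp [List.permutations'Aux, cutSum, add_comm]
  | cons x w ih =>
    intro H
    rw [sum_permutations'Aux_cons]
    simp only [cutSum, sum_permutations'Aux_cons]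
    rw [List.sum_map_add, ih]
    simp only [List.permutations'Aux, List.map_cons, List.map_nil, List.sum_cons, List.sum_nil,
      add_zero, add_assoc, cutSum_add]
    abel

/-- Letters on the right end of the second word are only allowed in the order of the list. -/
def AllowsOnly : (List α → List α → M) → List α → Prop
  | _, [] => True
  | H, a :: l => (∀ I J x, x ≠ a → H I (J ++ [x]) = 0) ∧ AllowsOnly (fun I J => H I (J ++ [a])) l

/-- The part of the sum over all orderings and cuts in which the second word is the reverse of an
initial segment of the list. -/
def initialCutSum : (List α → List α → M) → List α → M
  | H, [] => H [] []
  | H, a :: l => ((a :: l).permutations'.map fun I => H I []).sum +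
      initialCutSum (fun I J => H I (J ++ [a])) l

/-- At any other place of insertion the last letter is still that of `J`, which is not a, so the
term vanishes. -/
lemma sum_insert_eq_last (a : α) (J : List α) : ∀ {f : List α → M}
    (_ : ∀ J x, x ≠ a → f (J ++ [x]) = 0) (_ : a ∉ J),
    ((List.permutations'Aux a J).map f).sum = f (J ++ [a]) := by
  induction J with
  | nil => intro f _ _; simp [List.permutations'Aux]
  | cons x J ih =>
    intro f hf ha
    have h0 : f (a :: x :: J) = 0 := by
      obtain ⟨L, b, hL⟩ := (List.eq_nil_or_concat (x :: J)).resolve_left (by simp)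
      rw [List.concat_eq_append] at hL
      rw [hL, ← List.cons_append]
      refine hf _ _ ?_
      rintro rfl
      exact ha (hL ▸ by simp)
    rw [sum_permutations'Aux_cons, h0, zero_add, ih (f := fun w => f (x :: w))]
    · rfl
    · intro J' y hy
      exact hf (x :: J') y hy
    · exact fun h => ha (List.mem_cons_of_mem _ h)

/-- Follow the first letter a of the list. If it falls into `I`, then `J` must be empty, since its
last letter would not be a; if it falls into `J`, it must come last. The second case recurses on the
remaining letters. -/
theorem sum_permutations_cutSum (l : List α) : ∀ {H : List α → List α → M} (_ : l.Nodup)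
    (_ : AllowsOnly H l), (l.permutations'.map (cutSum H)).sum = initialCutSum H l := by
  induction l with
  | nil => intro H _ _; simp [List.permutations', cutSum, initialCutSum]
  | cons a l ih =>
    intro H hnd hH
    have ha : a ∉ l := (List.nodup_cons.1 hnd).1
    rw [initialCutSum, List.permutations', sum_map_flatMap, sum_map_flatMap,
      ← ih (List.nodup_cons.1 hnd).2 hH.2, ← List.sum_map_add]
    congr 1
    refine List.map_congr_left fun w hw => ?_
    have hw' : w.Perm l := List.mem_permutations'.1 hw
    have haw : a ∉ w := fun h => ha (hw'.mem_iff.1 h)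
    rw [sum_insert_cutSum, cutSum_add]
    congr 1
    · rw [cutSum_eq_single]
      intro I J hJ hne
      obtain ⟨L, b, rfl⟩ := (List.eq_nil_or_concat J).resolve_left hne
      rw [List.concat_eq_append] at hJ ⊢
      rw [List.sum_eq_zero]
      intro y hy
      obtain ⟨I', -, rfl⟩ := List.mem_map.1 hy
      refine hH.1 _ _ _ ?_
      rintro rfl
      exact haw (hJ _ (by simp))
    · refine cutSum_congr w fun I J hJ => ?_
      exact sum_insert_eq_last a J (hH.1 I) fun h => haw (hJ a h)

end Cuts

lemma sum_perm_eq_sum_permutations' {k : ℕ} {M : Type*} [AddCommMonoid M]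
    (F : List (Fin k) → M) :
    ∑ σ : Equiv.Perm (Fin k), F (List.ofFn σ) = ((List.finRange k).permutations'.map F).sum := by
  have hnd : (List.finRange k).permutations'.Nodup :=
    (List.permutations_perm_permutations' _).nodup_iff.1
      (List.nodup_permutations _ (List.nodup_finRange k))
  have h2 : ((List.finRange k).permutations'.map F).sum =
      ∑ w ∈ (⟨↑(List.finRange k).permutations', hnd⟩ : Finset (List (Fin k))), F w := rfl
  rw [h2]
  refine Finset.sum_bij (fun σ _ => List.ofFn σ) ?_ ?_ ?_ ?_
  · intro σ _
    change List.ofFn σ ∈ (List.finRange k).permutations'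
    rw [List.mem_permutations', List.perm_ext_iff_of_nodup (List.nodup_ofFn.2 σ.injective)
      (List.nodup_finRange k)]
    intro a
    simp [List.mem_ofFn']
  · intro σ _ τ _ h
    exact Equiv.ext (congrFun (List.ofFn_injective h))
  · intro w hw
    have hw : w ∈ (List.finRange k).permutations' := hw
    rw [List.mem_permutations'] at hw
    have hlen : w.length = k := by rw [hw.length_eq, List.length_finRange]
    have hwn : w.Nodup := hw.nodup_iff.2 (List.nodup_finRange k)
    have hinj : Function.Injective (fun i : Fin k => w.get (i.cast hlen.symm)) :=
      (List.nodup_iff_injective_get.1 hwn).comp (Fin.cast_injective _)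
    refine ⟨Equiv.ofBijective _ (Finite.injective_iff_bijective.1 hinj), Finset.mem_univ _, ?_⟩
    refine List.ext_getElem (by simp [hlen]) fun i h1 h2 => ?_
    simp
  · intro σ _
    rfl

/-! ### The Bethe vector without apparent singularities -/

/-- Extension by zero of a finite sequence. -/
def natExt {k : ℕ} {M : Type*} [Zero M] (t : Fin k → M) (j : ℕ) : M :=
  if h : j < k then t ⟨j, h⟩ else 0

lemma natExt_of_lt {k : ℕ} {M : Type*} [Zero M] (t : Fin k → M) {j : ℕ} (h : j < k) :
    natExt t j = t ⟨j, h⟩ := dif_pos h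

/-- The differences `t_j - t_{j-1}`, where the term before the first one is `1`. -/
def diffSeq (t : ℕ → ℂ) : ℕ → ℂ
  | 0 => t 0 - 1
  | j + 1 => t (j + 1) - t j

/-- The operators obtained by merging the letters `a`, …, `a + d`. -/
def mergeSeq {A : Type*} [Ring A] [Algebra ℂ A] (t : ℕ → ℂ) (F : ℕ → A) (a : ℕ) : ℕ → A
  | 0 => F a
  | d + 1 => mergeStep (t (a + d)) (t (a + d + 1)) (mergeSeq t F a d) (F (a + d + 1))

lemma drop_finRange {k m : ℕ} (h : m < k) :
    (List.finRange k).drop m = ⟨m, h⟩ :: (List.finRange k).drop (m + 1) := by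
  rw [List.drop_eq_getElem_cons (by simpa using h)]
  simp

lemma le_of_mem_drop_finRange {k m : ℕ} {x : Fin k} (h : x ∈ (List.finRange k).drop m) :
    m ≤ x := by
  obtain ⟨i, hi, rfl⟩ := List.mem_iff_getElem.1 h
  simp

lemma mergeChain_mergeSeq {k : ℕ} {A : Type*} [Ring A] [Algebra ℂ A] (t : Fin k → ℂ)
    (g : Fin k → A) (a : ℕ) : ∀ (e d : ℕ) (h : a + d < k), a + d + e + 1 = k →
    mergeChain t g (mergeSeq (natExt t) (natExt g) a d) ⟨a + d, h⟩
        ((List.finRange k).drop (a + d + 1)) =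
      (natExt t (k - 1))⁻¹ • mergeSeq (natExt t) (natExt g) a (d + e) := by
  intro e
  induction e with
  | zero =>
    intro d h hk
    rw [List.drop_eq_nil_of_le (by simp; omega), mergeChain, add_zero,
      natExt_of_lt t (by omega : k - 1 < k)]
    congr 4
    omega
  | succ e ih =>
    intro d h hk
    have h' : a + d + 1 < k := by omega
    rw [drop_finRange h', mergeChain]
    have := ih (d + 1) h' (by omega)
    rw [mergeSeq, natExt_of_lt t h, natExt_of_lt t h', natExt_of_lt g h'] at this
    rw [show d + (e + 1) = d + 1 + e by omega]
    exact this

lemma commuteApart_drop_finRange {k : ℕ} {A : Type*} [Ring A] {g : Fin k → A}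
    (hg : ∀ i j : Fin k, (i : ℕ) + 2 ≤ j → Commute (g i) (g j)) :
    ∀ d m, m + d = k → CommuteApart g ((List.finRange k).drop m) := by
  intro d
  induction d with
  | zero =>
    intro m hm
    rw [List.drop_eq_nil_of_le (by simp; omega)]
    trivial
  | succ d ih =>
    intro m hm
    have h1 := ih (m + 1) (by omega)
    rw [drop_finRange (by omega : m < k)]
    by_cases h : m + 1 < k
    · rw [drop_finRange h] at h1 ⊢
      refine ⟨fun x hx => hg _ _ ?_, h1⟩
      have := le_of_mem_drop_finRange hx
      exact this
    · rw [List.drop_eq_nil_of_le (by simp; omega)]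
      trivial

section

variable {n k : ℕ} (hk : k ≤ n) (lam : Fin n → ℂ) (t : Fin k → ℂ)

/-- The operators of the `f_j` on the Verma module. -/
def vermaF (j : Fin k) : Module.End ℂ (Verma lam) := vermaRep lam (chevF (Fin.castLE hk j))

/-- The vector `v_m` of the linear representation. -/
def stdVec (n m : ℕ) : Fin (n + 1) → ℂ := if h : m < n + 1 then Pi.single ⟨m, h⟩ 1 else 0

/-- The component in the Verma module of the part of the Bethe vector which involves `v_m`. -/
def vermaBlock (m : ℕ) : Verma lam :=
  if m < k then (natExt t (k - 1))⁻¹ •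
    mergeSeq (natExt t) (natExt (vermaF hk lam)) m (k - 1 - m) (vermaVec lam)
  else vermaVec lam

/-- The Bethe vector, written without apparent singularities. -/
def betheReg : Verma lam ⊗[ℂ] (Fin (n + 1) → ℂ) :=
  ∑ m ∈ Finset.range (k + 1), (∏ j ∈ Finset.range m, (diffSeq (natExt t) j)⁻¹) •
    (vermaBlock hk lam t m ⊗ₜ[ℂ] stdVec n m)

lemma fWord_eq_prod {V : Type*} [AddCommGroup V] [Module ℂ V] (ρ : SL n →ₗ⁅ℂ⁆ Module.End ℂ V)
    (w : List (Fin k)) (v : V) :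
    fWord hk ρ w v = (w.map fun j => ρ (chevF (Fin.castLE hk j))).prod v := by
  induction w with
  | nil => rfl
  | cons a w ih =>
    rw [List.map_cons, List.prod_cons, Module.End.mul_apply, ← ih]
    rfl

lemma fWord_append_singleton {V : Type*} [AddCommGroup V] [Module ℂ V]
    (ρ : SL n →ₗ⁅ℂ⁆ Module.End ℂ V) (w : List (Fin k)) (a : Fin k) (v : V) :
    fWord hk ρ (w ++ [a]) v = fWord hk ρ w (ρ (chevF (Fin.castLE hk a)) v) := by
  simp [fWord]

lemma fWord_zero {V : Type*} [AddCommGroup V] [Module ℂ V]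
    (ρ : SL n →ₗ⁅ℂ⁆ Module.End ℂ V) (w : List (Fin k)) : fWord hk ρ w 0 = 0 := by
  rw [fWord_eq_prod, map_zero]

lemma linRep_chevF_stdVec (j : Fin k) (m : ℕ) :
    linRep n (chevF (Fin.castLE hk j)) (stdVec n m) = if (j : ℕ) = m then stdVec n (m + 1) else 0 := by
  unfold stdVec
  by_cases hm : m < n + 1
  · rw [dif_pos hm, linRep_chevF]
    by_cases h : (j : ℕ) = m
    · subst h
      rw [if_pos rfl, dif_pos (by omega),
        if_pos (show (⟨j, hm⟩ : Fin (n + 1)) = (Fin.castLE hk j).castSucc from rfl)]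
      rfl
    · rw [if_neg h, if_neg]
      intro h'
      exact h (Fin.ext_iff.1 h').symm
  · rw [dif_neg hm, map_zero, if_neg (by omega)]

/-- The word `(m, m - 1, …, 1)`, with letters counted from `1`. -/
def initRev (k m : ℕ) : List (Fin k) := ((List.finRange k).take m).reverse

lemma initRev_succ {m : ℕ} (h : m < k) : initRev k (m + 1) = ⟨m, h⟩ :: initRev k m := by
  rw [initRev, initRev, List.take_succ_eq_append_getElem (by simpa using h), List.reverse_append]
  simp

lemma chainFn_initRev : ∀ {m : ℕ} (_ : m ≤ k),
    chainFn t 1 (initRev k m) = ∏ j ∈ Finset.range m, (diffSeq (natExt t) j)⁻¹ := by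
  intro m
  induction m with
  | zero => intro _; simp [initRev, chainFn]
  | succ m ih =>
    intro hm
    rw [Finset.prod_range_succ, ← ih (by omega), initRev_succ (by omega)]
    cases m with
    | zero => simp [initRev, chainFn, diffSeq, natExt_of_lt t (by omega : 0 < k)]
    | succ m =>
      rw [initRev_succ (by omega), chainFn_cons_cons, diffSeq, natExt_of_lt t (by omega : m + 1 < k),
        natExt_of_lt t (by omega : m < k), mul_comm]

/-- The term of the Bethe sum of a pair of words, where the second word is continued by
`(m, m - 1, …, 1)`. -/
def cutTerm (m : ℕ) (I J : List (Fin k)) : Verma lam ⊗[ℂ] (Fin (n + 1) → ℂ) :=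
  omegaFn I (J ++ initRev k m) t •
    (fWord hk (vermaRep lam) I (vermaVec lam) ⊗ₜ[ℂ] fWord hk (linRep n) J (stdVec n m))

lemma betheSum_eq_cutSum :
    betheSum hk lam t = ((List.finRange k).permutations'.map (cutSum (cutTerm hk lam t 0))).sum := by
  rw [← sum_perm_eq_sum_permutations', betheSum]
  refine Finset.sum_congr rfl fun σ _ => ?_
  rw [← cutSum_eq_sum_range, List.length_ofFn]
  refine Finset.sum_congr rfl fun p _ => ?_
  simp only [cutTerm, initRev, List.take_zero, List.reverse_nil, List.append_nil]
  rfl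

lemma cutTerm_append_self {m : ℕ} (h : m < k) :
    (fun I J => cutTerm hk lam t m I (J ++ [⟨m, h⟩])) = cutTerm hk lam t (m + 1) := by
  funext I J
  rw [cutTerm, cutTerm, fWord_append_singleton, linRep_chevF_stdVec, if_pos rfl, initRev_succ h]
  simp

/-- The vector v_m is killed by every f_j except f_m, which sends it to v_{m+1}; so a second word
ending at v_m can only be extended by the letter m. -/
lemma allowsOnly_cutTerm : ∀ d m, m + d = k →
    AllowsOnly (cutTerm hk lam t m) ((List.finRange k).drop m) := by
  intro d
  induction d with
  | zero =>
    intro m hm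
    rw [List.drop_eq_nil_of_le (by simp; omega)]
    trivial
  | succ d ih =>
    intro m hm
    have h : m < k := by omega
    rw [drop_finRange h]
    refine ⟨fun I J x hx => ?_, ?_⟩
    · rw [cutTerm, fWord_append_singleton, linRep_chevF_stdVec, if_neg, fWord_zero,
        TensorProduct.tmul_zero, smul_zero]
      exact fun h' => hx (Fin.ext h')
    · rw [cutTerm_append_self]
      exact ih (m + 1) (by omega)

lemma commute_vermaF (i j : Fin k) (h : (i : ℕ) + 2 ≤ j) :
    Commute (vermaF hk lam i) (vermaF hk lam j) := by
  have h1 := congrArg (vermaRep lam) (lie_chevF_chevF (Fin.castLE hk i) (Fin.castLE hk j)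
    (by simp; omega) (by simp; omega))
  rw [LieHom.map_lie, LieRing.of_associative_ring_bracket, map_zero, sub_eq_zero] at h1
  exact h1

lemma sum_cutTerm {t : Fin k → ℂ} (ht : Function.Injective t) (hz : ∀ j, t j ≠ 0) {m : ℕ}
    (h : m < k) :
    (((List.finRange k).drop m).permutations'.map fun I => cutTerm hk lam t m I []).sum =
      (∏ j ∈ Finset.range m, (diffSeq (natExt t) j)⁻¹) •
        (vermaBlock hk lam t m ⊗ₜ[ℂ] stdVec n m) := by
  -- The collapse of the sum is an identity between operators; this linear map carries it to the
  -- tensor product.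
  let L : Module.End ℂ (Verma lam) →ₗ[ℂ] Verma lam ⊗[ℂ] (Fin (n + 1) → ℂ) :=
    chainFn t 1 (initRev k m) • ((TensorProduct.mk ℂ (Verma lam) (Fin (n + 1) → ℂ)).flip
      (stdVec n m) ∘ₗ LinearMap.applyₗ (vermaVec lam))
  have hL : ∀ X, L X = chainFn t 1 (initRev k m) • (X (vermaVec lam) ⊗ₜ[ℂ] stdVec n m) :=
    fun X => rfl
  have h1 : ∀ I : List (Fin k), cutTerm hk lam t m I [] =
      L (chainFn t 0 I • (I.map (vermaF hk lam)).prod) := by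
    intro I
    rw [map_smul, hL, cutTerm, fWord_eq_prod, smul_smul, omegaFn]
    rfl
  simp only [h1]
  have hnd : ((List.finRange k).drop m).Nodup := (List.nodup_finRange k).drop
  have hca := commuteApart_drop_finRange (commute_vermaF hk lam) (k - m) m (by omega)
  rw [drop_finRange h] at hnd hca ⊢
  have h2 := sum_permutations_chainFn ht hz _ _ (vermaF hk lam) hnd hca
  have h3 := mergeChain_mergeSeq t (vermaF hk lam) m (k - 1 - m) 0 h (by omega)
  rw [mergeSeq, natExt_of_lt _ h, zero_add] at h3
  rw [← Function.comp_def L, ← List.map_map, ← map_list_sum, h2]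
  simp only [add_zero] at h3
  rw [h3, hL, chainFn_initRev t h.le, vermaBlock, if_pos h]
  rfl

lemma initialCutSum_cutTerm {t : Fin k → ℂ} (ht : Function.Injective t) (hz : ∀ j, t j ≠ 0) :
    ∀ d m, m + d = k → initialCutSum (cutTerm hk lam t m) ((List.finRange k).drop m) =
      ∑ m' ∈ Finset.Ico m (k + 1), (∏ j ∈ Finset.range m', (diffSeq (natExt t) j)⁻¹) •
        (vermaBlock hk lam t m' ⊗ₜ[ℂ] stdVec n m') := by
  intro d
  induction d with
  | zero =>
    intro m hm
    obtain rfl : m = k := by omega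
    rw [List.drop_eq_nil_of_le (by simp), initialCutSum, Nat.Ico_succ_singleton,
      Finset.sum_singleton, cutTerm, omegaFn, List.nil_append, chainFn_initRev t le_rfl,
      vermaBlock, if_neg (lt_irrefl _)]
    simp [chainFn, fWord]
  | succ d ih =>
    intro m hm
    have h : m < k := by omega
    have h1 := sum_cutTerm hk lam ht hz h
    rw [drop_finRange h] at h1 ⊢
    rw [initialCutSum, h1, cutTerm_append_self, ih (m + 1) (by omega),
      Finset.sum_eq_sum_Ico_succ_bot (by omega : m < k + 1)]

/-- Both sides agree at points with distinct nonzero coordinates, but only t_j = 0 and d_j = 0 are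
possible poles of the right side. It therefore gives the value where other coordinates coincide. -/
theorem betheSum_eq_betheReg {t : Fin k → ℂ} (ht : Function.Injective t) (hz : ∀ j, t j ≠ 0) :
    betheSum hk lam t = betheReg hk lam t := by
  have h1 := sum_permutations_cutSum (List.finRange k) (List.nodup_finRange k)
    (allowsOnly_cutTerm hk lam t k 0 (zero_add k))
  have h2 := initialCutSum_cutTerm hk lam ht hz k 0 (zero_add k)
  rw [List.drop_zero] at h2
  rw [betheSum_eq_cutSum, h1, h2, betheReg, Finset.range_eq_Ico]

/-! ### The limit of the Bethe sum -/

lemma continuousAt_natExt (p : Fin k → ℂ) (j : ℕ) :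
    ContinuousAt (fun t : Fin k → ℂ => natExt t j) p := by
  by_cases h : j < k
  · simp only [natExt, dif_pos h]
    exact (continuous_apply _).continuousAt
  · simp only [natExt, dif_neg h]
    exact continuousAt_const

lemma continuousAt_diffSeq (p : Fin k → ℂ) (j : ℕ) :
    ContinuousAt (fun t : Fin k → ℂ => diffSeq (natExt t) j) p := by
  cases j with
  | zero => exact (continuousAt_natExt p 0).sub continuousAt_const
  | succ j => exact (continuousAt_natExt p (j + 1)).sub (continuousAt_natExt p j)

/-- Continuity is tested on all linear functionals because `A` carries no topology. The induction
must quantify over `L`, since a merge step composes it with left and right multiplication. -/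
lemma continuousAt_mergeSeq {A : Type*} [Ring A] [Algebra ℂ A] {p : Fin k → ℂ}
    (h0 : ∀ j < k, natExt p j ≠ 0) (hd : ∀ j < k, diffSeq (natExt p) j ≠ 0) (F : ℕ → A) (a : ℕ) :
    ∀ d, a + d < k → ∀ L : A →ₗ[ℂ] ℂ,
      ContinuousAt (fun t : Fin k → ℂ => L (mergeSeq (natExt t) F a d)) p := by
  intro d
  induction d with
  | zero => exact fun _ _ => continuousAt_const
  | succ d ih =>
    intro h L
    have h1 := ih (by omega) (L ∘ₗ LinearMap.mulRight ℂ (F (a + d + 1)))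
    have h2 := ih (by omega) (L ∘ₗ LinearMap.mulLeft ℂ (F (a + d + 1)))
    have hx := continuousAt_natExt p (a + d)
    have hy := continuousAt_natExt p (a + d + 1)
    have hxy : natExt p (a + d) - natExt p (a + d + 1) ≠ 0 := by
      have := hd (a + d + 1) (by omega)
      rw [diffSeq] at this
      rw [← neg_sub]
      exact neg_ne_zero.2 this
    have hx0 := h0 (a + d) (by omega)
    simp only [mergeSeq, mergeStep, map_add, map_smul, smul_eq_mul]
    exact (((hx.sub hy).inv₀ hxy).mul h1).add
      (((hx.inv₀ hx0).sub ((hx.sub hy).inv₀ hxy)).mul h2)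

lemma continuousAt_betheReg {p : Fin k → ℂ} (h0 : ∀ j < k, natExt p j ≠ 0)
    (hd : ∀ j < k, diffSeq (natExt p) j ≠ 0)
    (ℓ : Module.Dual ℂ (Verma lam ⊗[ℂ] (Fin (n + 1) → ℂ))) :
    ContinuousAt (fun t => ℓ (betheReg hk lam t)) p := by
  simp only [betheReg, map_sum, map_smul, smul_eq_mul]
  refine tendsto_finsetSum _ fun m hm => ?_
  have hm : m < k + 1 := Finset.mem_range.1 hm
  refine ContinuousAt.mul ?_ ?_
  · refine tendsto_finsetProd _ fun j hj => ?_
    have hj := Finset.mem_range.1 hj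
    exact (continuousAt_diffSeq p j).inv₀ (hd j (by omega))
  · by_cases h : m < k
    · let L : Module.End ℂ (Verma lam) →ₗ[ℂ] ℂ :=
        ℓ ∘ₗ ((TensorProduct.mk ℂ (Verma lam) (Fin (n + 1) → ℂ)).flip
          (stdVec n m) ∘ₗ LinearMap.applyₗ (vermaVec lam))
      have hL := continuousAt_mergeSeq h0 hd (natExt (vermaF hk lam)) m (k - 1 - m) (by omega) L
      simp only [vermaBlock, if_pos h, ← TensorProduct.smul_tmul', map_smul, smul_eq_mul]
      exact ((continuousAt_natExt p (k - 1)).inv₀ (h0 _ (by omega))).mul hL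
    · simp only [vermaBlock, if_neg h]
      exact continuousAt_const

lemma eventually_affine_ne_zero (a : ℂ) {c : ℂ} (hc : c ≠ 0) : ∀ᶠ z in 𝓝[≠] (0 : ℂ), a + c * z ≠ 0 := by
  by_cases ha : a = 0
  · filter_upwards [self_mem_nhdsWithin] with z hz
    rw [ha, zero_add]
    exact mul_ne_zero hc hz
  · have : ContinuousAt (fun z : ℂ => a + c * z) 0 := by fun_prop
    exact (this.eventually_ne (by simpa using ha)).filter_mono nhdsWithin_le_nhds

instance neBot_regularPoints (p : Fin k → ℂ) : (𝓝[regularPoints k] p).NeBot := by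
  -- The slopes 1, ..., k are distinct and nonzero, so along this line each excluded equation fails
  -- for all small z ≠ 0.
  let s : ℂ → Fin k → ℂ := fun z j => p j + ((j : ℕ) + 1 : ℂ) * z
  have hs : Filter.Tendsto s (𝓝[≠] 0) (𝓝[regularPoints k] p) := by
    refine tendsto_nhdsWithin_iff.2 ⟨?_, ?_⟩
    · have : Continuous s := by fun_prop
      have h := this.tendsto 0
      have h0 : s 0 = p := by funext j; simp [s]
      rw [h0] at h
      exact h.mono_left nhdsWithin_le_nhds
    · have h1 : ∀ i j : Fin k, i ≠ j → ∀ᶠ z in 𝓝[≠] (0 : ℂ), s z i ≠ s z j := by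
        intro i j hij
        have hc : ((i : ℕ) - (j : ℕ) : ℂ) ≠ 0 := by
          rw [sub_ne_zero]
          exact_mod_cast fun h => hij (Fin.ext h)
        filter_upwards [eventually_affine_ne_zero (p i - p j) hc] with z hz h
        apply hz
        simp only [s] at h
        linear_combination h
      have h2 : ∀ (c : ℂ) (j : Fin k), ∀ᶠ z in 𝓝[≠] (0 : ℂ), s z j ≠ c := by
        intro c j
        have hc : ((j : ℕ) + 1 : ℂ) ≠ 0 := Nat.cast_add_one_ne_zero _
        filter_upwards [eventually_affine_ne_zero (p j - c) hc] with z hz h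
        apply hz
        simp only [s] at h
        linear_combination h
      have h1' : ∀ᶠ z in 𝓝[≠] (0 : ℂ), ∀ i j : Fin k, i ≠ j → s z i ≠ s z j := by
        simp only [Filter.eventually_all]
        exact h1
      have h2' : ∀ᶠ z in 𝓝[≠] (0 : ℂ), ∀ j, s z j ≠ 0 := Filter.eventually_all.2 (h2 0)
      have h3' : ∀ᶠ z in 𝓝[≠] (0 : ℂ), ∀ j, s z j ≠ 1 := Filter.eventually_all.2 (h2 1)
      filter_upwards [h1', h2', h3'] with z a b c
      exact ⟨fun i j hij => by_contra fun hne => a i j hne hij, fun j => ⟨b j, c j⟩⟩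
  exact hs.neBot

lemma isBetheVector_betheReg {p : Fin k → ℂ} (h0 : ∀ j < k, natExt p j ≠ 0)
    (hd : ∀ j < k, diffSeq (natExt p) j ≠ 0) : IsBetheVector hk lam p (betheReg hk lam p) := by
  intro ℓ
  have h := (continuousAt_betheReg hk lam h0 hd ℓ).tendsto.mono_left
    (nhdsWithin_le_nhds (s := regularPoints k))
  refine h.congr' ?_
  filter_upwards [self_mem_nhdsWithin] with s hs
  rw [betheSum_eq_betheReg hk lam hs.1 fun j => (hs.2 j).1]

-- Functionals separate vectors over a field, and limits are unique because regular points
-- accumulate everywhere.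
variable {hk lam} in
lemma IsBetheVector.unique {p : Fin k → ℂ} {X X' : Verma lam ⊗[ℂ] (Fin (n + 1) → ℂ)}
    (hX : IsBetheVector hk lam p X) (hX' : IsBetheVector hk lam p X') : X = X' := by
  rw [← sub_eq_zero, ← Module.forall_dual_apply_eq_zero_iff ℂ]
  intro ℓ
  rw [map_sub, sub_eq_zero]
  exact tendsto_nhds_unique (hX ℓ) (hX' ℓ)

end

/-! ### The action of the `e_i` on merged operators -/

section Merge

variable {A : Type*} [Ring A] [Algebra ℂ A]

/-- Operators that satisfy the relations between the Chevalley generators with indices below `k`. -/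
structure IsChevalleySystem (k : ℕ) (E F H : ℕ → A) : Prop where
  e_f : ∀ i < k, ∀ j < k, E i * F j = F j * E i + if i = j then H i else 0
  h_f : ∀ i < k, ∀ j < k, H i * F j = F j * H i - cartan i j • F j
  f_f : ∀ i j, i + 2 ≤ j → j < k → Commute (F i) (F j)

lemma commute_mergeStep (x y : ℂ) {X Y Z : A} (hX : Commute Z X) (hY : Commute Z Y) :
    Commute Z (mergeStep x y X Y) :=
  ((hX.mul_right hY).smul_right _).add_right ((hY.mul_right hX).smul_right _)

lemma commute_mergeSeq (t : ℕ → ℂ) {F : ℕ → A} {Z : A} {a : ℕ} : ∀ {d : ℕ}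
    (_ : ∀ j, a ≤ j → j ≤ a + d → Commute Z (F j)), Commute Z (mergeSeq t F a d) := by
  intro d
  induction d with
  | zero => exact fun h => h a le_rfl le_rfl
  | succ d ih =>
    exact fun h => commute_mergeStep _ _ (ih fun j h1 h2 => h j h1 (by omega))
      (h _ (by omega) (by omega))

variable {k : ℕ} {E F H : ℕ → A}

lemma cartan_apart {i j : ℕ} (h : i + 2 ≤ j ∨ j + 2 ≤ i) : cartan i j = 0 := by
  unfold cartan
  rw [if_neg (by omega), if_neg (by omega)]

lemma cartan_succ_left (i : ℕ) : cartan (i + 1) i = -1 := by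
  unfold cartan
  rw [if_neg (by omega), if_pos (by omega)]

lemma cartan_succ_right (i : ℕ) : cartan i (i + 1) = -1 := by
  unfold cartan
  rw [if_neg (by omega), if_pos (by omega)]

lemma IsChevalleySystem.commute_h_f (hS : IsChevalleySystem k E F H) {i j : ℕ} (hi : i < k)
    (hj : j < k) (h : i + 2 ≤ j ∨ j + 2 ≤ i) : Commute (H i) (F j) := by
  have := hS.h_f i hi j hj
  rwa [cartan_apart h, zero_smul, sub_zero] at this

lemma IsChevalleySystem.commute_e_f (hS : IsChevalleySystem k E F H) {i j : ℕ} (hi : i < k)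
    (hj : j < k) (h : i ≠ j) : Commute (E i) (F j) := by
  have := hS.e_f i hi j hj
  rwa [if_neg h, add_zero] at this

/-- Of the letters a, ..., a + d only the last fails to commute with this H. It occurs once in every
monomial and contributes 1, the negative of the Cartan entry. -/
lemma IsChevalleySystem.h_mergeSeq (hS : IsChevalleySystem k E F H) (t : ℕ → ℂ) {a d : ℕ}
    (h : a + d + 1 < k) :
    H (a + d + 1) * mergeSeq t F a d = mergeSeq t F a d * H (a + d + 1) + mergeSeq t F a d := by
  have hlast : H (a + d + 1) * F (a + d) = F (a + d) * H (a + d + 1) + F (a + d) := by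
    rw [hS.h_f _ h _ (by omega), cartan_succ_left]
    module
  cases d with
  | zero => exact hlast
  | succ d =>
    have hc : Commute (H (a + (d + 1) + 1)) (mergeSeq t F a d) :=
      commute_mergeSeq t fun j h1 h2 => hS.commute_h_f h (by omega) (by omega)
    rw [mergeSeq, mergeStep]
    set X := mergeSeq t F a d
    have h1 : H (a + (d + 1) + 1) * (X * F (a + d + 1)) =
        X * F (a + d + 1) * H (a + (d + 1) + 1) + X * F (a + d + 1) := by
      rw [← mul_assoc, hc.eq, mul_assoc, show a + d + 1 = a + (d + 1) by omega, hlast]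
      noncomm_ring
    have h2 : H (a + (d + 1) + 1) * (F (a + d + 1) * X) =
        F (a + d + 1) * X * H (a + (d + 1) + 1) + F (a + d + 1) * X := by
      rw [← mul_assoc, show a + d + 1 = a + (d + 1) by omega, hlast, add_mul, mul_assoc, hc.eq]
      noncomm_ring
    rw [mul_add, mul_smul_comm, mul_smul_comm, h1, h2, add_mul, smul_mul_assoc, smul_mul_assoc]
    module

/-- The action of the last raising operator on a merged operator. -/
lemma IsChevalleySystem.e_mergeSeq_last (hS : IsChevalleySystem k E F H) (t : ℕ → ℂ) {a d : ℕ}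
    (h : a + d + 1 < k) :
    E (a + d + 1) * mergeSeq t F a (d + 1) = mergeSeq t F a (d + 1) * E (a + d + 1) +
      mergeSeq t F a d * ((t (a + d))⁻¹ • H (a + d + 1) +
        ((t (a + d))⁻¹ - (t (a + d) - t (a + d + 1))⁻¹) • 1) := by
  have hH := hS.h_mergeSeq t h
  have hE : Commute (E (a + d + 1)) (mergeSeq t F a d) :=
    commute_mergeSeq t fun j h1 h2 => hS.commute_e_f h (by omega) (by omega)
  have hEF := hS.e_f _ h _ h
  rw [if_pos rfl] at hEF
  rw [mergeSeq, mergeStep]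
  set X := mergeSeq t F a d
  have h1 : E (a + d + 1) * (X * F (a + d + 1)) =
      X * F (a + d + 1) * E (a + d + 1) + X * H (a + d + 1) := by
    rw [← mul_assoc, hE.eq, mul_assoc, hEF]
    noncomm_ring
  have h2 : E (a + d + 1) * (F (a + d + 1) * X) =
      F (a + d + 1) * X * E (a + d + 1) + (X * H (a + d + 1) + X) := by
    rw [← mul_assoc, hEF, add_mul, mul_assoc, hE.eq, hH, mul_assoc]
  rw [mul_add, mul_smul_comm, mul_smul_comm, h1, h2, add_mul, smul_mul_assoc, smul_mul_assoc,
    mul_add, mul_smul_comm, mul_smul_comm, mul_one]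
  module

/-- Once E has passed, both orders of the last merge leave multiples of X G H and X G, as X and G
commute. The critical point equation is what makes the coefficients of X G and X G H have ratio -l.
-/
lemma IsChevalleySystem.e_mergeSeq_last_but_one (hS : IsChevalleySystem k E F H) {t : ℕ → ℂ}
    {l : ℂ} {a d : ℕ} (h : a + d + 2 < k) (hx : t (a + d) ≠ 0) (hy : t (a + d + 1) ≠ 0)
    (hxy : t (a + d + 1) - t (a + d) ≠ 0)
    (hcrit : l / t (a + d + 1) + 1 / (t (a + d + 1) - t (a + d)) -
      1 / (t (a + d + 2) - t (a + d + 1)) = 0) :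
    ∃ Z, E (a + d + 1) * mergeSeq t F a (d + 2) = mergeSeq t F a (d + 2) * E (a + d + 1) +
      Z * (H (a + d + 1) - l • 1) := by
  have hlast := hS.e_mergeSeq_last t (a := a) (d := d) (by omega)
  have hE : Commute (E (a + d + 1)) (F (a + d + 2)) :=
    hS.commute_e_f (by omega) (by omega) (by omega)
  have hX : Commute (F (a + d + 2)) (mergeSeq t F a d) :=
    commute_mergeSeq t fun j h1 h2 => (hS.f_f j _ (by omega) h).symm
  have hHF : H (a + d + 1) * F (a + d + 2) = F (a + d + 2) * H (a + d + 1) + F (a + d + 2) := by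
    rw [hS.h_f _ (by omega) _ h, cartan_succ_right]
    module
  -- This scalar is the total coefficient of X G H: x⁻¹ times the sum y⁻¹ of the two coefficients of
  -- the last merge.
  refine ⟨((t (a + d))⁻¹ * (t (a + d + 1))⁻¹) • (mergeSeq t F a d * F (a + d + 2)), ?_⟩
  have hm : mergeSeq t F a (d + 2) = mergeStep (t (a + d + 1)) (t (a + d + 2))
    (mergeSeq t F a (d + 1)) (F (a + d + 2)) := rfl
  rw [hm, mergeStep]
  set X := mergeSeq t F a d
  set S := mergeSeq t F a (d + 1)
  set x := t (a + d)
  set y := t (a + d + 1)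
  set w := t (a + d + 2)
  set Ee := E (a + d + 1)
  set Hh := H (a + d + 1)
  set G := F (a + d + 2)
  have h1 : Ee * (S * G) = S * G * Ee + x⁻¹ • (X * G * Hh) +
      (x⁻¹ + (x⁻¹ - (x - y)⁻¹)) • (X * G) := by
    rw [← mul_assoc, hlast, add_mul, mul_assoc S, hE.eq, mul_assoc X, add_mul, smul_mul_assoc,
      hHF, smul_mul_assoc, one_mul, mul_add, mul_smul_comm, mul_smul_comm, mul_add, mul_assoc X,
      mul_assoc S]
    module
  have h2 : Ee * (G * S) = G * S * Ee + x⁻¹ • (X * G * Hh) + (x⁻¹ - (x - y)⁻¹) • (X * G) := by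
    rw [← mul_assoc, hE.eq, mul_assoc, hlast, mul_add, ← mul_assoc G X, hX.eq, mul_add,
      mul_smul_comm, mul_smul_comm, mul_one, mul_assoc G S]
    module
  have hlam : l = y * ((x - y)⁻¹ - (y - w)⁻¹) := by
    have e3 : l = y * (l / y) := (mul_div_cancel₀ l hy).symm
    have e1 : (x - y)⁻¹ = -(1 / (y - x)) := by rw [← neg_sub, inv_neg, one_div]
    have e2 : (y - w)⁻¹ = -(1 / (w - y)) := by rw [← neg_sub, inv_neg, one_div]
    rw [e1, e2]
    linear_combination e3 + y * hcrit
  have hxy' : x - y ≠ 0 := by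
    rw [← neg_sub]
    exact neg_ne_zero.2 hxy
  have hc : x⁻¹ * y⁻¹ = (x - y)⁻¹ * (y⁻¹ - x⁻¹) := by
    field_simp
  rw [mul_add, mul_smul_comm, mul_smul_comm, h1, h2, add_mul, smul_mul_assoc, smul_mul_assoc,
    mul_sub, smul_mul_assoc, smul_mul_assoc, mul_smul_comm, mul_one, hlam]
  match_scalars
  · ring
  · ring
  · have hyy : y⁻¹ * y = 1 := inv_mul_cancel₀ hy
    linear_combination hc + (x⁻¹ * ((x - y)⁻¹ - (y - w)⁻¹)) * hyy
  · ring

/-- At a critical point, the raising operator of an inner letter kills the merged operator modulo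
the difference of the weight operator and its value. -/
lemma IsChevalleySystem.e_mergeSeq_inner (hS : IsChevalleySystem k E F H) {t : ℕ → ℂ}
    {l : ℂ} {a d : ℕ} (hx : t (a + d) ≠ 0) (hy : t (a + d + 1) ≠ 0)
    (hxy : t (a + d + 1) - t (a + d) ≠ 0)
    (hcrit : l / t (a + d + 1) + 1 / (t (a + d + 1) - t (a + d)) -
      1 / (t (a + d + 2) - t (a + d + 1)) = 0) (e : ℕ) : a + (d + 2 + e) < k →
    ∃ Z, E (a + d + 1) * mergeSeq t F a (d + 2 + e) = mergeSeq t F a (d + 2 + e) * E (a + d + 1) +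
      Z * (H (a + d + 1) - l • 1) := by
  induction e with
  | zero => exact fun h => hS.e_mergeSeq_last_but_one (by omega) hx hy hxy hcrit
  | succ e ih =>
    intro h
    obtain ⟨Z, hZ⟩ := ih (by omega)
    have hE : Commute (E (a + d + 1)) (F (a + (d + 2 + e) + 1)) :=
      hS.commute_e_f (by omega) (by omega) (by omega)
    have hH : Commute (H (a + d + 1)) (F (a + (d + 2 + e) + 1)) :=
      hS.commute_h_f (by omega) (by omega) (by omega)
    have hH' : Commute (H (a + d + 1) - l • 1) (F (a + (d + 2 + e) + 1)) :=
      hH.sub_left ((Commute.one_left _).smul_left _)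
    have hm : mergeSeq t F a (d + 2 + (e + 1)) =
      mergeStep (t (a + (d + 2 + e))) (t (a + (d + 2 + e) + 1)) (mergeSeq t F a (d + 2 + e))
        (F (a + (d + 2 + e) + 1)) := rfl
    rw [hm]
    set G := F (a + (d + 2 + e) + 1)
    set S := mergeSeq t F a (d + 2 + e)
    -- All later letters commute with E and H, so the remainder `Z` is merged with them just as `S`
    -- is.
    refine ⟨mergeStep (t (a + (d + 2 + e))) (t (a + (d + 2 + e) + 1)) Z G, ?_⟩
    have h1 : E (a + d + 1) * (S * G) = S * G * E (a + d + 1) + Z * G * (H (a + d + 1) - l • 1) := by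
      rw [← mul_assoc, hZ, add_mul, mul_assoc S, hE.eq, mul_assoc Z, hH'.eq]
      simp only [mul_assoc]
    have h2 : E (a + d + 1) * (G * S) = G * S * E (a + d + 1) + G * Z * (H (a + d + 1) - l • 1) := by
      rw [← mul_assoc, hE.eq, mul_assoc, hZ, mul_add]
      simp only [mul_assoc]
    rw [mergeStep, mergeStep, mul_add, mul_smul_comm, mul_smul_comm, h1, h2]
    simp only [add_mul, smul_mul_assoc]
    module

/-- The action of the first raising operator on a merged operator. -/
lemma IsChevalleySystem.e_mergeSeq_first (hS : IsChevalleySystem k E F H) (t : ℕ → ℂ) {a : ℕ}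
    (d : ℕ) : a + d + 1 < k →
    E a * mergeSeq t F a (d + 1) = mergeSeq t F a (d + 1) * E a +
      mergeSeq t F (a + 1) d * ((t a)⁻¹ • H a + (t a - t (a + 1))⁻¹ • 1) := by
  induction d with
  | zero =>
    intro h
    have hEF := hS.e_f a (by omega) a (by omega)
    rw [if_pos rfl] at hEF
    have hE : Commute (E a) (F (a + 1)) := hS.commute_e_f (by omega) h (by omega)
    have hHF : H a * F (a + 1) = F (a + 1) * H a + F (a + 1) := by
      rw [hS.h_f _ (by omega) _ h, cartan_succ_right]
      module
    change E a * mergeStep (t a) (t (a + 1)) (F a) (F (a + 1)) =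
      mergeStep (t a) (t (a + 1)) (F a) (F (a + 1)) * E a + F (a + 1) * _
    have h1 : E a * (F a * F (a + 1)) = F a * F (a + 1) * E a + (F (a + 1) * H a + F (a + 1)) := by
      rw [← mul_assoc, hEF, add_mul, hHF, mul_assoc, hE.eq, mul_assoc]
    have h2 : E a * (F (a + 1) * F a) = F (a + 1) * F a * E a + F (a + 1) * H a := by
      rw [← mul_assoc, hE.eq, mul_assoc, hEF, mul_add, mul_assoc]
    rw [mergeStep, mul_add, mul_smul_comm, mul_smul_comm, h1, h2]
    simp only [add_mul, smul_mul_assoc, mul_add, mul_smul_comm, mul_one]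
    module
  | succ d ih =>
    intro h
    have hZ := ih (by omega)
    have hE : Commute (E a) (F (a + (d + 1) + 1)) := hS.commute_e_f (by omega) h (by omega)
    have hH : Commute (H a) (F (a + (d + 1) + 1)) := hS.commute_h_f (by omega) h (by omega)
    have hm' : mergeSeq t F (a + 1) (d + 1) = mergeStep (t (a + (d + 1))) (t (a + (d + 1) + 1))
        (mergeSeq t F (a + 1) d) (F (a + (d + 1) + 1)) := by
      rw [mergeSeq, show a + 1 + d = a + (d + 1) by omega]
    have hm : mergeSeq t F a (d + 1 + 1) =
      mergeStep (t (a + (d + 1))) (t (a + (d + 1) + 1)) (mergeSeq t F a (d + 1))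
        (F (a + (d + 1) + 1)) := rfl
    rw [hm, hm']
    set P := (t a)⁻¹ • H a + (t a - t (a + 1))⁻¹ • (1 : A)
    set G := F (a + (d + 1) + 1)
    set S := mergeSeq t F a (d + 1)
    set Z := mergeSeq t F (a + 1) d
    -- From the letter a + 2 on everything commutes with E a and H a, so the factor `P` stays at the
    -- right end.
    have hP : Commute P G := (hH.smul_left _).add_left ((Commute.one_left _).smul_left _)
    have h1 : E a * (S * G) = S * G * E a + Z * G * P := by
      rw [← mul_assoc, hZ, add_mul, mul_assoc S, hE.eq, mul_assoc Z, hP.eq]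
      simp only [mul_assoc]
    have h2 : E a * (G * S) = G * S * E a + G * Z * P := by
      rw [← mul_assoc, hE.eq, mul_assoc, hZ, mul_add]
      simp only [mul_assoc]
    rw [mergeStep, mergeStep, mul_add, mul_smul_comm, mul_smul_comm, h1, h2]
    simp only [add_mul, smul_mul_assoc]
    module

end Merge

/-! ### The norm of the components of the Bethe vector -/

section Norm

variable {V : Type*} [AddCommGroup V] [Module ℂ V] {k : ℕ} {E F H : ℕ → Module.End ℂ V}

/-- The vector `f_a f_{a+1} ⋯ f_{a+d} u`. -/
def ascWord (F : ℕ → Module.End ℂ V) (a : ℕ) : ℕ → V → V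
  | 0, u => F a u
  | d + 1, u => ascWord F a d (F (a + d + 1) u)

lemma ascWord_succ (F : ℕ → Module.End ℂ V) (a d : ℕ) : ∀ u,
    ascWord F a (d + 1) u = F a (ascWord F (a + 1) d u) := by
  induction d with
  | zero => exact fun _ => rfl
  | succ d ih =>
    intro u
    rw [ascWord, ih, ascWord, show a + 1 + d + 1 = a + (d + 1) + 1 by omega]

/-- Pairing of a merged operator with a vector that is killed by all raising operators but the
first one. -/
lemma apply_mergeSeq (B : LinearMap.BilinForm ℂ V) (t : ℕ → ℂ) {y : V}
    (hB : ∀ i < k, ∀ x y, B (E i x) y = B x (F i y)) (a d : ℕ) : a + d < k →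
    (∀ r, a < r → r ≤ a + d → E r y = 0) → ∀ u, B y (mergeSeq t F a d u) =
      (∏ j ∈ Finset.range d, (t (a + j) - t (a + j + 1))⁻¹) * B y (ascWord F a d u) := by
  induction d with
  | zero => intro _ _ u; simp [mergeSeq, ascWord]
  | succ d ih =>
    intro h hy u
    -- The product with the new F on the left pairs to zero, since that F crosses the form as an E
    -- killing y. Only the other order survives, with coefficient (t_{a+d} - t_{a+d+1})⁻¹.
    rw [mergeSeq, mergeStep, LinearMap.add_apply, map_add, LinearMap.smul_apply,
      LinearMap.smul_apply, map_smul, map_smul, Module.End.mul_apply, Module.End.mul_apply,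
      ← hB _ (by omega), hy _ (by omega) (by omega),
      ih (by omega) (fun r h1 h2 => hy r h1 (by omega)), Finset.prod_range_succ, ascWord]
    simp only [map_zero, LinearMap.zero_apply, smul_eq_mul]
    ring

/-- The critical point equations, for the coordinates continued to a sequence. -/
def CriticalSeq (k : ℕ) (l t : ℕ → ℂ) : Prop :=
  ∀ r < k, l r / t r + 1 / diffSeq t r - (if r + 1 < k then 1 / diffSeq t (r + 1) else 0) = 0

/-- The sequence of the components of the Bethe vector in the Verma module. -/
def blockSeq (k : ℕ) (t : ℕ → ℂ) (F : ℕ → Module.End ℂ V) (v : V) (m : ℕ) : V :=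
  if m < k then (t (k - 1))⁻¹ • mergeSeq t F m (k - 1 - m) v else v

/-- Commuting e_r through the merged operator leaves a multiple of H_r - l_r on the right, which
kills v. -/
lemma e_blockSeq_of_lt (hS : IsChevalleySystem k E F H) {l t : ℕ → ℂ} {v : V}
    (hE : ∀ r < k, E r v = 0) (hH : ∀ r < k, H r v = l r • v) (h0 : ∀ j < k, t j ≠ 0)
    (hd : ∀ j < k, diffSeq t j ≠ 0) (hcrit : CriticalSeq k l t) {m r : ℕ} (hmr : m < r)
    (hr : r < k) : E r (blockSeq k t F v m) = 0 := by
  obtain ⟨d, rfl⟩ : ∃ d, r = m + d + 1 := ⟨r - m - 1, by omega⟩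
  rw [blockSeq, if_pos (by omega), map_smul, ← Module.End.mul_apply]
  have hc := hcrit _ hr
  have hy := h0 _ hr
  have hx := h0 (m + d) (by omega)
  have hxy : t (m + d + 1) - t (m + d) ≠ 0 := hd _ hr
  by_cases hlast : m + d + 1 + 1 < k
  · rw [if_pos hlast] at hc
    obtain ⟨e, he⟩ : ∃ e, k - 1 - m = d + 2 + e := ⟨k - 1 - m - (d + 2), by omega⟩
    obtain ⟨Z, hZ⟩ := hS.e_mergeSeq_inner hx hy hxy hc e (by omega)
    rw [he, hZ, LinearMap.add_apply, Module.End.mul_apply, hE _ hr, Module.End.mul_apply,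
      LinearMap.sub_apply, hH _ hr]
    simp
  -- The last letter has no right neighbour, so its equation has one term less; it says that the
  -- scalar left by `e_mergeSeq_last` is zero on v.
  · rw [if_neg hlast, sub_zero] at hc
    have he : k - 1 - m = d + 1 := by omega
    have hc' : (t (m + d))⁻¹ * l (m + d + 1) + ((t (m + d))⁻¹ - (t (m + d) - t (m + d + 1))⁻¹) = 0 := by
      have hxy' : t (m + d) - t (m + d + 1) ≠ 0 := by
        rw [← neg_sub]; exact neg_ne_zero.2 hxy
      rw [diffSeq] at hc
      field_simp at hc ⊢
      linear_combination (-1 : ℂ) * hc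
    rw [he, hS.e_mergeSeq_last t hr, LinearMap.add_apply, Module.End.mul_apply, hE _ hr,
      Module.End.mul_apply, LinearMap.add_apply, LinearMap.smul_apply, LinearMap.smul_apply,
      hH _ hr, Module.End.one_apply, smul_smul, ← add_smul, hc']
    simp

/-- On v the remaining factor is the scalar l_m / t_m - 1 / d_{m+1}, which the m-th critical point
equation equates with -1 / d_m. For the last letter the next block is v itself. -/
lemma e_blockSeq_self (hS : IsChevalleySystem k E F H) {l t : ℕ → ℂ} {v : V}
    (hE : ∀ r < k, E r v = 0) (hH : ∀ r < k, H r v = l r • v) (hcrit : CriticalSeq k l t) {m : ℕ}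
    (hm : m < k) : E m (blockSeq k t F v m) = -(diffSeq t m)⁻¹ • blockSeq k t F v (m + 1) := by
  have hc := hcrit _ hm
  rw [blockSeq, if_pos hm, map_smul, ← Module.End.mul_apply]
  by_cases h : m + 1 < k
  · rw [if_pos h] at hc
    have he : k - 1 - m = (k - 1 - (m + 1)) + 1 := by omega
    rw [he, hS.e_mergeSeq_first t _ (by omega), LinearMap.add_apply, Module.End.mul_apply,
      hE _ hm, Module.End.mul_apply, LinearMap.add_apply, LinearMap.smul_apply,
      LinearMap.smul_apply, hH _ hm, Module.End.one_apply, smul_smul, ← add_smul, map_smul,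
      map_zero, zero_add, blockSeq, if_pos h, smul_comm]
    congr 1
    have e1 : (t m - t (m + 1))⁻¹ = -(1 / diffSeq t (m + 1)) := by
      rw [diffSeq, ← neg_sub, inv_neg, one_div]
    rw [e1]
    linear_combination hc
  · obtain rfl : k = m + 1 := by omega
    rw [if_neg h, sub_zero] at hc
    rw [blockSeq, if_neg h]
    have hEF := hS.e_f m hm m hm
    rw [if_pos rfl] at hEF
    have he : m + 1 - 1 - m = 0 := by omega
    rw [he, mergeSeq, hEF, LinearMap.add_apply, Module.End.mul_apply, hE _ hm, hH _ hm, map_zero,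
      zero_add, smul_smul]
    congr 1
    rw [Nat.add_sub_cancel]
    linear_combination hc

/-- The leftmost f_m crosses the form as e_m and turns block m into -1 / d_m times block m + 1; this
strips the word letter by letter. -/
lemma apply_blockSeq_ascWord (hS : IsChevalleySystem k E F H) {l t : ℕ → ℂ} {v : V}
    (hE : ∀ r < k, E r v = 0) (hH : ∀ r < k, H r v = l r • v) (hcrit : CriticalSeq k l t)
    (B : LinearMap.BilinForm ℂ V) (hB : ∀ i < k, ∀ x y, B (E i x) y = B x (F i y))
    (hv : B v v = 1) (d : ℕ) : ∀ m, m + d + 1 = k → B (blockSeq k t F v m) (ascWord F m d v) =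
      ∏ j ∈ Finset.Ico m k, -(diffSeq t j)⁻¹ := by
  induction d with
  | zero =>
    intro m hm
    rw [ascWord, ← hB _ (by omega), e_blockSeq_self hS hE hH hcrit (by omega), blockSeq,
      if_neg (by omega), map_smul, LinearMap.smul_apply, hv]
    rw [show k = m + 1 by omega, Nat.Ico_succ_singleton, Finset.prod_singleton]
    simp
  | succ d ih =>
    intro m hm
    rw [ascWord_succ, ← hB _ (by omega), e_blockSeq_self hS hE hH hcrit (by omega), map_smul,
      LinearMap.smul_apply, ih (m + 1) (by omega),
      Finset.prod_eq_prod_Ico_succ_bot (show m < k by omega), smul_eq_mul]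

/-- Only one of the two copies is expanded, and a single word survives. Its coefficient is the
product of -1 / d_j over j > m, its pairing the same product over j ≥ m, so one factor d_m is left
over from the squares. -/
lemma apply_blockSeq_self (hS : IsChevalleySystem k E F H) {l t : ℕ → ℂ} {v : V}
    (hE : ∀ r < k, E r v = 0) (hH : ∀ r < k, H r v = l r • v) (h0 : ∀ j < k, t j ≠ 0)
    (hd : ∀ j < k, diffSeq t j ≠ 0) (hcrit : CriticalSeq k l t)
    (B : LinearMap.BilinForm ℂ V) (hB : ∀ i < k, ∀ x y, B (E i x) y = B x (F i y))
    (hv : B v v = 1) {m : ℕ} (hm : m < k) :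
    B (blockSeq k t F v m) (blockSeq k t F v m) =
      -(diffSeq t m / t (k - 1)) * ∏ j ∈ Finset.Ico m k, ((diffSeq t j)⁻¹) ^ 2 := by
  have hdm := hd m hm
  have h1 : B (blockSeq k t F v m) (blockSeq k t F v m) =
      (t (k - 1))⁻¹ * B (blockSeq k t F v m) (mergeSeq t F m (k - 1 - m) v) := by
    conv_lhs => rw [blockSeq, if_pos hm, map_smul]
    conv_rhs => rw [blockSeq, if_pos hm]
    rfl
  rw [h1, apply_mergeSeq B t hB m _ (by omega)
    (fun r h1 h2 => e_blockSeq_of_lt hS hE hH h0 hd hcrit h1 (by omega)),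
    apply_blockSeq_ascWord hS hE hH hcrit B hB hv _ m (by omega)]
  have h2 : ∏ j ∈ Finset.range (k - 1 - m), (t (m + j) - t (m + j + 1))⁻¹ =
      ∏ j ∈ Finset.Ico (m + 1) k, -(diffSeq t j)⁻¹ := by
    rw [Finset.prod_Ico_eq_prod_range]
    rw [show k - (m + 1) = k - 1 - m by omega]
    refine Finset.prod_congr rfl fun j _ => ?_
    rw [show m + 1 + j = m + j + 1 by omega, diffSeq, ← neg_sub, inv_neg]
  rw [h2, Finset.prod_eq_prod_Ico_succ_bot hm, Finset.prod_eq_prod_Ico_succ_bot hm (fun j => _ ^ 2)]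
  have h3 : ∏ j ∈ Finset.Ico (m + 1) k, ((diffSeq t j)⁻¹) ^ 2 =
      (∏ j ∈ Finset.Ico (m + 1) k, -(diffSeq t j)⁻¹) * ∏ j ∈ Finset.Ico (m + 1) k, -(diffSeq t j)⁻¹ := by
    rw [← Finset.prod_mul_distrib]
    exact Finset.prod_congr rfl fun j _ => by ring
  rw [h3]
  field_simp

lemma sum_range_diffSeq (t : ℕ → ℂ) (k : ℕ) :
    ∑ m ∈ Finset.range (k + 1), diffSeq t m = t k - 1 := by
  induction k with
  | zero => simp [diffSeq]
  | succ k ih => rw [Finset.sum_range_succ, ih, diffSeq]; ring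

/-- After ∏ d_j⁻² is taken out, the terms are -d_m / t_{k-1} for m < k and 1 for m = k, and Σ d_m =
t_{k-1} - 1. The case k = 0 is separate as there is no last coordinate. -/
theorem sum_apply_blockSeq (hS : IsChevalleySystem k E F H) {l t : ℕ → ℂ} {v : V}
    (hE : ∀ r < k, E r v = 0) (hH : ∀ r < k, H r v = l r • v) (h0 : ∀ j < k, t j ≠ 0)
    (hd : ∀ j < k, diffSeq t j ≠ 0) (hcrit : CriticalSeq k l t)
    (B : LinearMap.BilinForm ℂ V) (hB : ∀ i < k, ∀ x y, B (E i x) y = B x (F i y))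
    (hv : B v v = 1) :
    ∑ m ∈ Finset.range (k + 1), (∏ j ∈ Finset.range m, (diffSeq t j)⁻¹) ^ 2 *
        B (blockSeq k t F v m) (blockSeq k t F v m) =
      (∏ j ∈ Finset.range k, ((diffSeq t j)⁻¹) ^ 2) * if k = 0 then 1 else (t (k - 1))⁻¹ := by
  have h1 : ∀ m ∈ Finset.range k, (∏ j ∈ Finset.range m, (diffSeq t j)⁻¹) ^ 2 *
      B (blockSeq k t F v m) (blockSeq k t F v m) =
      -(∏ j ∈ Finset.range k, ((diffSeq t j)⁻¹) ^ 2) * (t (k - 1))⁻¹ * diffSeq t m := by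
    intro m hm
    have hm := Finset.mem_range.1 hm
    rw [apply_blockSeq_self hS hE hH h0 hd hcrit B hB hv hm, ← Finset.prod_pow,
      ← Finset.prod_range_mul_prod_Ico _ hm.le]
    ring
  rw [Finset.sum_range_succ, Finset.sum_congr rfl h1, ← Finset.mul_sum, blockSeq,
    if_neg (lt_irrefl k), hv, ← Finset.prod_pow]
  cases k with
  | zero => simp
  | succ k =>
    rw [sum_range_diffSeq, if_neg (Nat.succ_ne_zero k), Nat.add_sub_cancel]
    have := h0 k (Nat.lt_succ_self k)
    field_simp
    ring

end Norm

/-! ### Derivatives of the phase function -/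

section Phase

variable {k : ℕ}

lemma hasDerivAt_localLog {a z : ℂ} (ha : a ≠ 0) (hz : z / a ∈ Complex.slitPlane) :
    HasDerivAt (localLog a) z⁻¹ z := by
  have hz0 : z ≠ 0 := by
    rintro rfl
    rw [zero_div] at hz
    exact Complex.slitPlane_ne_zero hz rfl
  have h := ((hasDerivAt_id z).div_const a).clog hz
  have h2 := h.const_add (Complex.log a)
  have e : z⁻¹ = 1 / a / (z / a) := by field_simp
  rw [e]
  exact h2

/-- The derivative of `gap`. -/
def gapDeriv (j : Fin k) : (Fin k → ℂ) →L[ℂ] ℂ :=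
  if h : (j : ℕ) = 0 then -ContinuousLinearMap.proj j
  else ContinuousLinearMap.proj j - ContinuousLinearMap.proj ⟨(j : ℕ) - 1, by omega⟩

lemma hasFDerivAt_gap (j : Fin k) (t : Fin k → ℂ) :
    HasFDerivAt (fun t : Fin k → ℂ => gap t j) (gapDeriv j) t := by
  unfold gap gapDeriv
  by_cases h : (j : ℕ) = 0
  · simp only [dif_pos h]
    exact (hasFDerivAt_apply j t).const_sub 1
  · simp only [dif_neg h]
    exact (hasFDerivAt_apply j t).sub (hasFDerivAt_apply _ t)

/-- The matrix of the linear forms `t_j - t_{j-1}`, up to signs of rows. -/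
lemma gapDeriv_single (l i : Fin k) : gapDeriv l (Pi.single i 1) =
    (if (l : ℕ) = 0 then -1 else 1) *
      ((if l = i then 1 else 0) - if (l : ℕ) = i + 1 then 1 else 0) := by
  unfold gapDeriv
  by_cases h : (l : ℕ) = 0
  · rw [dif_pos h, if_pos h, if_neg (show ¬ (l : ℕ) = i + 1 by omega)]
    by_cases hli : l = i <;> simp [hli]
  · rw [dif_neg h, if_neg h]
    have : (⟨(l : ℕ) - 1, by omega⟩ : Fin k) = i ↔ (l : ℕ) = i + 1 := by
      rw [Fin.ext_iff]
      change (l : ℕ) - 1 = i ↔ _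
      omega
    simp [Pi.single_apply, this]

/-- The derivative of `logPhase`. -/
def logPhaseDeriv (μ : Fin k → ℂ) (κ : ℂ) (s : Fin k → ℂ) : (Fin k → ℂ) →L[ℂ] ℂ :=
  ∑ j, ((-(μ j) / κ) • (s j)⁻¹ • ContinuousLinearMap.proj (R := ℂ) (φ := fun _ : Fin k => ℂ) j +
    (-1 / κ) • (gap s j)⁻¹ • gapDeriv j)

lemma hasFDerivAt_logPhase (μ : Fin k → ℂ) (κ : ℂ) {p s : Fin k → ℂ}
    (hp : ∀ j, p j ≠ 0 ∧ gap p j ≠ 0)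
    (hs : ∀ j, s j / p j ∈ Complex.slitPlane ∧ gap s j / gap p j ∈ Complex.slitPlane) :
    HasFDerivAt (logPhase μ κ p) (logPhaseDeriv μ κ s) s := by
  unfold logPhase logPhaseDeriv
  refine HasFDerivAt.fun_sum fun j _ => ?_
  refine HasFDerivAt.add ?_ ?_
  · have h := (hasDerivAt_localLog (hp j).1 (hs j).1).comp_hasFDerivAt s
      (hasFDerivAt_apply (𝕜 := ℂ) (F' := fun _ : Fin k => ℂ) j s)
    exact h.const_mul _
  · have h := (hasDerivAt_localLog (hp j).2 (hs j).2).comp_hasFDerivAt s (hasFDerivAt_gap j s)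
    exact h.const_mul _

lemma eventually_hasFDerivAt_logPhase (μ : Fin k → ℂ) (κ : ℂ) {p : Fin k → ℂ}
    (hp : ∀ j, p j ≠ 0 ∧ gap p j ≠ 0) :
    ∀ᶠ s in 𝓝 p, HasFDerivAt (logPhase μ κ p) (logPhaseDeriv μ κ s) s := by
  have h1 : ∀ j, ∀ᶠ s in 𝓝 p, s j / p j ∈ Complex.slitPlane := by
    intro j
    have hc : ContinuousAt (fun s : Fin k → ℂ => s j / p j) p :=
      ((continuous_apply j).div_const _).continuousAt
    refine hc.eventually_mem (Complex.isOpen_slitPlane.mem_nhds ?_)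
    rw [div_self (hp j).1]
    exact Complex.one_mem_slitPlane
  have h2 : ∀ j, ∀ᶠ s in 𝓝 p, gap s j / gap p j ∈ Complex.slitPlane := by
    intro j
    have hc : ContinuousAt (fun s : Fin k → ℂ => gap s j / gap p j) p :=
      (hasFDerivAt_gap j p).continuousAt.div_const _
    refine hc.eventually_mem (Complex.isOpen_slitPlane.mem_nhds ?_)
    rw [div_self (hp j).2]
    exact Complex.one_mem_slitPlane
  filter_upwards [Filter.eventually_all.2 h1, Filter.eventually_all.2 h2] with s a b
  exact hasFDerivAt_logPhase μ κ hp fun j => ⟨a j, b j⟩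

lemma logPhaseDeriv_single (μ : Fin k → ℂ) (κ : ℂ) (s : Fin k → ℂ) (i : Fin k) :
    logPhaseDeriv μ κ s (Pi.single i 1) =
      -1 / κ * (μ i * (s i)⁻¹ + ∑ l, (gap s l)⁻¹ * gapDeriv l (Pi.single i 1)) := by
  unfold logPhaseDeriv
  simp only [_root_.sum_apply, _root_.add_apply,
    _root_.smul_apply, smul_eq_mul, ContinuousLinearMap.proj_apply,
    Finset.sum_add_distrib, Pi.single_apply, mul_ite, mul_one, mul_zero, Finset.sum_ite_eq',
    Finset.mem_univ, if_true]
  simp only [mul_add, Finset.mul_sum]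
  congr 1
  ring

lemma hessian_logPhase (μ : Fin k → ℂ) {p : Fin k → ℂ} (hp : ∀ j, p j ≠ 0 ∧ gap p j ≠ 0)
    (i j : Fin k) : hessian (logPhase μ 1 p) p i j =
      (if i = j then μ i * ((p i)⁻¹) ^ 2 else 0) +
        ∑ l, ((gap p l)⁻¹) ^ 2 * (gapDeriv l (Pi.single i 1) * gapDeriv l (Pi.single j 1)) := by
  have h1 : (fun s => fderiv ℂ (logPhase μ 1 p) s (Pi.single j 1)) =ᶠ[𝓝 p]
      fun s => -(μ j * (s j)⁻¹ + ∑ l, (gap s l)⁻¹ * gapDeriv l (Pi.single j 1)) := by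
    filter_upwards [eventually_hasFDerivAt_logPhase μ 1 hp] with s hs
    rw [hs.fderiv, logPhaseDeriv_single]
    ring
  have h2 : HasFDerivAt
      (fun s : Fin k → ℂ => -(μ j * (s j)⁻¹ + ∑ l, (gap s l)⁻¹ * gapDeriv l (Pi.single j 1)))
      (-(μ j • (-(p j ^ 2)⁻¹) • ContinuousLinearMap.proj (R := ℂ) (φ := fun _ : Fin k => ℂ) j +
        ∑ l, gapDeriv l (Pi.single j 1) • (-(gap p l ^ 2)⁻¹) • gapDeriv l)) p := by
    refine HasFDerivAt.neg (HasFDerivAt.add ?_ (HasFDerivAt.fun_sum fun l _ => ?_))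
    · exact ((hasDerivAt_inv (hp j).1).comp_hasFDerivAt p (hasFDerivAt_apply j p)).const_mul _
    · exact ((hasDerivAt_inv (hp l).2).comp_hasFDerivAt p (hasFDerivAt_gap l p)).mul_const _
  rw [hessian, Matrix.of_apply, h1.fderiv_eq, h2.fderiv]
  simp only [_root_.neg_apply, _root_.add_apply,
    _root_.sum_apply, _root_.smul_apply, smul_eq_mul,
    ContinuousLinearMap.proj_apply, neg_add, ← Finset.sum_neg_distrib]
  congr 1
  · by_cases h : i = j
    · subst h; simp
    · rw [if_neg h, Pi.single_eq_of_ne (Ne.symm h)]; simp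
  · exact Finset.sum_congr rfl fun l _ => by rw [inv_pow]; ring

/-! ### The critical point -/

lemma gap_eq_diffSeq (t : Fin k → ℂ) (j : Fin k) :
    gap t j = (if (j : ℕ) = 0 then -1 else 1) * diffSeq (natExt t) j := by
  obtain ⟨j, hj⟩ := j
  cases j with
  | zero =>
    rw [gap, dif_pos rfl, if_pos rfl]
    change _ = -1 * (natExt t 0 - 1)
    rw [natExt_of_lt t hj]
    ring
  | succ j =>
    rw [gap, dif_neg (Nat.succ_ne_zero j), if_neg (Nat.succ_ne_zero j)]
    change _ = 1 * (natExt t (j + 1) - natExt t j)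
    rw [natExt_of_lt t hj, natExt_of_lt t (by omega : j < k), one_mul]
    rfl

/-- The sign by which `gap` differs from `diffSeq` at the first index cancels between the value and
the derivative. -/
lemma sum_gap_inv (t : Fin k → ℂ) (i : Fin k) :
    ∑ l, (gap t l)⁻¹ * gapDeriv l (Pi.single i 1) = 1 / diffSeq (natExt t) i -
      if (i : ℕ) + 1 < k then 1 / diffSeq (natExt t) (i + 1) else 0 := by
  have h1 : ∀ l : Fin k, (gap t l)⁻¹ * gapDeriv l (Pi.single i 1) =
      (if l = i then 1 / diffSeq (natExt t) l else 0) -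
        if (l : ℕ) = i + 1 then 1 / diffSeq (natExt t) l else 0 := by
    intro l
    rw [gap_eq_diffSeq, gapDeriv_single, mul_inv]
    split_ifs <;> ring
  simp only [h1, Finset.sum_sub_distrib, Finset.sum_ite_eq', Finset.mem_univ, if_true]
  congr 1
  split_ifs with h
  · rw [Finset.sum_eq_single ⟨i + 1, h⟩]
    · rw [if_pos rfl]
    · intro b _ hb
      rw [if_neg]
      exact fun h' => hb (Fin.ext h')
    · simp
  · refine Finset.sum_eq_zero fun l _ => if_neg ?_
    have := l.2
    omega

/-- The exponential never vanishes and -1 / κ is a common nonzero factor, so both drop out of dΦ =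
0. -/
lemma isCriticalPoint_iff_criticalSeq (μ : Fin k → ℂ) {κ : ℂ} (hκ : κ ≠ 0) (t : Fin k → ℂ) :
    IsCriticalPoint μ κ t ↔ (∀ j < k, natExt t j ≠ 0 ∧ diffSeq (natExt t) j ≠ 0) ∧
      CriticalSeq k (natExt μ) (natExt t) := by
  have hne : (∀ j, t j ≠ 0 ∧ gap t j ≠ 0) ↔
      (∀ j < k, natExt t j ≠ 0 ∧ diffSeq (natExt t) j ≠ 0) := by
    have hg : ∀ j, gap t j ≠ 0 ↔ diffSeq (natExt t) j ≠ 0 := by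
      intro j
      rw [gap_eq_diffSeq]
      split_ifs <;> simp
    constructor
    · intro h j hj
      have := h ⟨j, hj⟩
      rw [hg] at this
      rwa [natExt_of_lt t hj]
    · intro h j
      have := h j j.2
      rw [natExt_of_lt t j.2] at this
      rwa [hg]
  rw [IsCriticalPoint, hne]
  refine and_congr_right fun hnz => ?_
  have hp := hne.2 hnz
  have hd := (eventually_hasFDerivAt_logPhase μ κ hp).self_of_nhds
  have hexp : HasFDerivAt (phase μ κ t) (Complex.exp (logPhase μ κ t t) • logPhaseDeriv μ κ t) t :=
    hd.cexp
  have hsmul : Complex.exp (logPhase μ κ t t) • logPhaseDeriv μ κ t = 0 ↔ logPhaseDeriv μ κ t = 0 :=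
    ⟨fun h => ContinuousLinearMap.ext fun x => (mul_eq_zero.1
      (DFunLike.congr_fun h x : Complex.exp _ * logPhaseDeriv μ κ t x = 0)).resolve_left
        (Complex.exp_ne_zero _),
    fun h => ContinuousLinearMap.ext fun x => mul_eq_zero_of_right (Complex.exp _)
      (DFunLike.congr_fun h x : logPhaseDeriv μ κ t x = 0)⟩
  rw [hexp.fderiv, hsmul]
  have hsingle : logPhaseDeriv μ κ t = 0 ↔ ∀ i, logPhaseDeriv μ κ t (Pi.single i 1) = 0 := by
    constructor
    · intro h i; rw [h]; rfl
    · intro h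
      ext x
      have hx : x = ∑ i, x i • (Pi.single i (1 : ℂ) : Fin k → ℂ) := by
        ext a; simp [Finset.sum_apply, Pi.single_apply]
      rw [hx, map_sum]
      simp [h]
  have hone : -1 / κ ≠ 0 := div_ne_zero (by norm_num) hκ
  rw [hsingle]
  simp only [logPhaseDeriv_single, mul_eq_zero, hone, false_or, sum_gap_inv]
  constructor
  · intro h r hr
    refine Eq.trans ?_ (h ⟨r, hr⟩)
    rw [natExt_of_lt μ hr, natExt_of_lt t hr, div_eq_mul_inv, add_sub_assoc]
  · intro h i
    refine Eq.trans ?_ (h i i.2)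
    rw [natExt_of_lt μ i.2, natExt_of_lt t i.2, div_eq_mul_inv (μ _), add_sub_assoc]

lemma shiftedTail_eq (μ : Fin k → ℂ) (i : Fin k) : shiftedTail μ i =
    μ i + if (i : ℕ) + 1 < k then natExt (shiftedTail μ) (i + 1) + 1 else 0 := by
  have hIci : Finset.Ici i = insert i (Finset.Ioi i) := by
    ext x; simp only [Finset.mem_Ici, Finset.mem_insert, Finset.mem_Ioi, le_iff_eq_or_lt, eq_comm]
  rw [shiftedTail, hIci, Finset.sum_insert (by simp)]
  split_ifs with h
  · rw [natExt_of_lt _ h, shiftedTail]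
    have : Finset.Ioi i = Finset.Ici ⟨i + 1, h⟩ := by
      ext x
      simp only [Finset.mem_Ioi, Finset.mem_Ici, Fin.lt_def, Fin.le_def]
      omega
    rw [this]
    push_cast
    ring
  · have h1 : Finset.Ioi i = ∅ := by
      ext x
      simp only [Finset.mem_Ioi, Fin.lt_def, Finset.notMem_empty, iff_false]
      have := x.2
      omega
    have h2 : (k : ℂ) = (i : ℕ) + 1 := by
      have : k = (i : ℕ) + 1 := by have := i.2; omega
      exact_mod_cast this
    rw [h1, h2]
    simp

/-- The critical point equations in recursive form. -/
lemma criticalSeq_iff (μ : Fin k → ℂ) {t : ℕ → ℂ} (h0 : ∀ j < k, t j ≠ 0)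
    (hd : ∀ j < k, diffSeq t j ≠ 0) :
    CriticalSeq k (natExt μ) t ↔ ∀ r < k, natExt (shiftedTail μ) r * diffSeq t r + t r = 0 := by
  -- With u_r = s_r + t_r / d_r this is u_r - u_{r+1}. It uses t_r / d_{r+1} = t_{r+1} / d_{r+1} - 1
  -- and s_r = μ_r + s_{r+1} + 1.
  have key : ∀ r, r < k → t r * (natExt μ r / t r + 1 / diffSeq t r -
      (if r + 1 < k then 1 / diffSeq t (r + 1) else 0)) =
      (natExt (shiftedTail μ) r + t r / diffSeq t r) -
        if r + 1 < k then natExt (shiftedTail μ) (r + 1) + t (r + 1) / diffSeq t (r + 1) else 0 := by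
    intro r hr
    have h1 := h0 r hr
    have h2 := hd r hr
    rw [natExt_of_lt (shiftedTail μ) hr, shiftedTail_eq, natExt_of_lt μ hr]
    change t r * _ = _ + (if r + 1 < k then _ else 0) + _ - _
    split_ifs with h
    · have h3 := hd (r + 1) h
      have h4 : t r = t (r + 1) - diffSeq t (r + 1) := by rw [diffSeq]; ring
      have h5 : t r * (1 / diffSeq t (r + 1)) = t (r + 1) / diffSeq t (r + 1) - 1 := by
        rw [h4]; field_simp
      rw [mul_sub, mul_add, h5, mul_div_cancel₀ _ h1]
      ring
    · rw [mul_sub, mul_add, mul_div_cancel₀ _ h1]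
      ring
  have hu : ∀ r < k, (natExt (shiftedTail μ) r + t r / diffSeq t r = 0 ↔
      natExt (shiftedTail μ) r * diffSeq t r + t r = 0) := by
    intro r hr
    have h2 := hd r hr
    rw [← mul_eq_zero_iff_right h2, add_mul, div_mul_cancel₀ _ h2]
  constructor
  · intro h
    -- The equations u_r = u_{r+1} are solved downwards from u_{k-1} = 0.
    have : ∀ d r, r + d + 1 = k → natExt (shiftedTail μ) r + t r / diffSeq t r = 0 := by
      intro d
      induction d with
      | zero =>
        intro r hr
        have h1 := key r (by omega)
        rw [h r (by omega), if_neg (by omega), mul_zero, sub_zero] at h1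
        exact h1.symm
      | succ d ih =>
        intro r hr
        have h1 := key r (by omega)
        rw [h r (by omega), if_pos (by omega), ih (r + 1) (by omega), mul_zero, sub_zero] at h1
        exact h1.symm
    exact fun r hr => (hu r hr).1 (this (k - r - 1) r (by omega))
  · intro h r hr
    have h1 := key r hr
    rw [(hu r hr).2 (h r hr)] at h1
    have h2 : (if r + 1 < k then natExt (shiftedTail μ) (r + 1) + t (r + 1) / diffSeq t (r + 1)
        else 0) = 0 := by
      split_ifs with h'
      · exact (hu _ h').2 (h _ h')
      · rfl
    rw [h2, sub_zero] at h1
    exact (mul_eq_zero.1 h1).resolve_left (h0 r hr)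

lemma critPoint_zero (μ : Fin k → ℂ) (h : 0 < k) :
    critPoint μ ⟨0, h⟩ = shiftedTail μ ⟨0, h⟩ / (shiftedTail μ ⟨0, h⟩ + 1) := by
  have : Finset.Iic (⟨0, h⟩ : Fin k) = {⟨0, h⟩} := by
    ext x; simp [Fin.le_def, Fin.ext_iff]
  rw [critPoint, this, Finset.prod_singleton]

lemma critPoint_succ (μ : Fin k → ℂ) {j : ℕ} (h : j + 1 < k) :
    critPoint μ ⟨j + 1, h⟩ = critPoint μ ⟨j, by omega⟩ *
      (shiftedTail μ ⟨j + 1, h⟩ / (shiftedTail μ ⟨j + 1, h⟩ + 1)) := by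
  have : Finset.Iic (⟨j + 1, h⟩ : Fin k) = insert ⟨j + 1, h⟩ (Finset.Iic ⟨j, by omega⟩) := by
    ext x
    simp only [Finset.mem_Iic, Fin.le_def, Finset.mem_insert, Fin.ext_iff]
    omega
  rw [critPoint, this, Finset.prod_insert (by simp [Fin.le_def]), mul_comm]
  rfl

/-- The equation is (s_r + 1) t_r = s_r t_{r-1}, with 1 in place of t_{-1}; as s_r + 1 ≠ 0, it
determines the coordinates one after another. -/
lemma eq_critPoint_iff {μ : Fin k → ℂ}
    (hgen : ∀ i, shiftedTail μ i ≠ 0 ∧ shiftedTail μ i + 1 ≠ 0) (t : Fin k → ℂ) :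
    t = critPoint μ ↔
      ∀ r < k, natExt (shiftedTail μ) r * diffSeq (natExt t) r + natExt t r = 0 := by
  constructor
  · rintro rfl r hr
    have h1 := (hgen ⟨r, hr⟩).2
    rw [natExt_of_lt _ hr, natExt_of_lt _ hr]
    cases r with
    | zero =>
      rw [diffSeq, natExt_of_lt _ hr, critPoint_zero]
      field_simp
      ring
    | succ r =>
      rw [diffSeq, natExt_of_lt _ hr, natExt_of_lt _ (by omega : r < k), critPoint_succ]
      field_simp
      ring
  · intro h
    have : ∀ r, ∀ hr : r < k, t ⟨r, hr⟩ = critPoint μ ⟨r, hr⟩ := by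
      intro r
      induction r with
      | zero =>
        intro hr
        have h1 := (hgen ⟨0, hr⟩).2
        have h2 := h 0 hr
        rw [diffSeq, natExt_of_lt _ hr, natExt_of_lt _ hr] at h2
        rw [critPoint_zero, eq_div_iff h1]
        linear_combination h2
      | succ r ih =>
        intro hr
        have h1 := (hgen ⟨r + 1, hr⟩).2
        have h2 := h (r + 1) hr
        rw [diffSeq, natExt_of_lt _ hr, natExt_of_lt _ hr, natExt_of_lt _ (by omega : r < k),
          ih] at h2
        rw [critPoint_succ, ← mul_div_assoc, eq_div_iff h1]
        linear_combination h2
    funext j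
    exact this j j.2

lemma critPoint_ne_zero {μ : Fin k → ℂ}
    (hgen : ∀ i, shiftedTail μ i ≠ 0 ∧ shiftedTail μ i + 1 ≠ 0) (j : Fin k) :
    critPoint μ j ≠ 0 :=
  Finset.prod_ne_zero_iff.2 fun i _ => div_ne_zero (hgen i).1 (hgen i).2

lemma natExt_critPoint_ne_zero {μ : Fin k → ℂ}
    (hgen : ∀ i, shiftedTail μ i ≠ 0 ∧ shiftedTail μ i + 1 ≠ 0) :
    ∀ j < k, natExt (critPoint μ) j ≠ 0 := by
  intro j hj
  rw [natExt_of_lt _ hj]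
  exact critPoint_ne_zero hgen _

/-- In s_j d_j + t_j = 0, vanishing of d_j would force t_j = 0. -/
lemma diffSeq_critPoint_ne_zero {μ : Fin k → ℂ}
    (hgen : ∀ i, shiftedTail μ i ≠ 0 ∧ shiftedTail μ i + 1 ≠ 0) :
    ∀ j < k, diffSeq (natExt (critPoint μ)) j ≠ 0 := by
  intro j hj h
  have h1 := (eq_critPoint_iff hgen _).1 rfl j hj
  rw [h, mul_zero, zero_add] at h1
  exact natExt_critPoint_ne_zero hgen j hj h1

theorem isCriticalPoint_iff {μ : Fin k → ℂ}
    (hgen : ∀ i, shiftedTail μ i ≠ 0 ∧ shiftedTail μ i + 1 ≠ 0) {κ : ℂ} (hκ : κ ≠ 0)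
    (t : Fin k → ℂ) : IsCriticalPoint μ κ t ↔ t = critPoint μ := by
  rw [isCriticalPoint_iff_criticalSeq μ hκ]
  constructor
  · rintro ⟨h1, h2⟩
    exact (eq_critPoint_iff hgen t).2
      ((criticalSeq_iff μ (fun j hj => (h1 j hj).1) fun j hj => (h1 j hj).2).1 h2)
  · rintro rfl
    refine ⟨fun j hj => ⟨natExt_critPoint_ne_zero hgen j hj, diffSeq_critPoint_ne_zero hgen j hj⟩, ?_⟩
    exact (criticalSeq_iff μ (natExt_critPoint_ne_zero hgen) (diffSeq_critPoint_ne_zero hgen)).2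
      ((eq_critPoint_iff hgen _).1 rfl)

lemma criticalSeq_critPoint {μ : Fin k → ℂ}
    (hgen : ∀ i, shiftedTail μ i ≠ 0 ∧ shiftedTail μ i + 1 ≠ 0) :
    CriticalSeq k (natExt μ) (natExt (critPoint μ)) :=
  ((isCriticalPoint_iff_criticalSeq μ one_ne_zero _).1
    ((isCriticalPoint_iff hgen one_ne_zero _).2 rfl)).2

/-! ### The determinant of the Hessian -/

/-- The bidiagonal matrix with ones on the diagonal and `-r_l` below the diagonal. -/
def bidiag (r : Fin k → ℂ) : Matrix (Fin k) (Fin k) ℂ :=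
  Matrix.of fun l i => (if l = i then 1 else 0) - if (l : ℕ) = i + 1 then r l else 0

lemma det_bidiag (r : Fin k → ℂ) : (bidiag r).det = 1 := by
  rw [Matrix.det_of_isLowerTriangular]
  · simp [bidiag]
  · intro l i hli
    have hli : l < i := hli
    have h : (l : ℕ) < i := hli
    simp only [bidiag, Matrix.of_apply]
    rw [if_neg hli.ne, if_neg (by omega), sub_zero]

/-- Entries of RᵀWR for a bidiagonal R: row l meets only the columns l and l - 1, so the result is
tridiagonal. -/
lemma sum_bidiag (w r : Fin k → ℂ) (i j : Fin k) :
    ∑ l, w l * (bidiag r l i * bidiag r l j) =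
      (if i = j then w i + ∑ l : Fin k, (if (l : ℕ) = i + 1 then w l * r l ^ 2 else 0) else 0) -
        ((if (i : ℕ) = j + 1 then w i * r i else 0) +
          (if (j : ℕ) = i + 1 then w j * r j else 0)) := by
  have h1 : ∀ l, w l * (bidiag r l i * bidiag r l j) =
      (if l = i then (if i = j then w l else 0) else 0) +
      (if i = j then (if (l : ℕ) = i + 1 then w l * r l ^ 2 else 0) else 0) -
      ((if l = i then (if (i : ℕ) = j + 1 then w l * r l else 0) else 0) +
        (if l = j then (if (j : ℕ) = i + 1 then w l * r l else 0) else 0)) := by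
    intro l
    simp only [bidiag, Matrix.of_apply, Fin.ext_iff]
    split_ifs <;> first | omega | ring
  simp only [h1, Finset.sum_sub_distrib, Finset.sum_add_distrib, Finset.sum_ite_eq',
    Finset.mem_univ, if_true]
  by_cases h : i = j
  · simp only [if_pos h]
  · simp [if_neg h]

lemma sum_ite_succ (i : Fin k) (F : ℕ → ℂ) :
    ∑ l : Fin k, (if (l : ℕ) = i + 1 then F l else 0) = if (i : ℕ) + 1 < k then F (i + 1) else 0 := by
  rw [Fin.sum_univ_eq_sum_range (fun l => if l = (i : ℕ) + 1 then F l else 0), Finset.sum_ite_eq']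
  simp

theorem det_hessian_critPoint {μ : Fin k → ℂ}
    (hgen : ∀ i, shiftedTail μ i ≠ 0 ∧ shiftedTail μ i + 1 ≠ 0) :
    (hessian (logPhase μ 1 (critPoint μ)) (critPoint μ)).det =
      (∏ j ∈ Finset.range k, ((diffSeq (natExt (critPoint μ)) j)⁻¹) ^ 2) *
        if k = 0 then 1 else (natExt (critPoint μ) (k - 1))⁻¹ := by
  set T := critPoint μ with hT
  set s := shiftedTail μ with hs
  have hT0 : ∀ j, T j ≠ 0 := critPoint_ne_zero hgen
  have hrec := (eq_critPoint_iff hgen T).1 hT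
  have hd0 := diffSeq_critPoint_ne_zero hgen
  rw [← hT] at hd0
  have hp : ∀ j, T j ≠ 0 ∧ gap T j ≠ 0 := by
    intro j
    refine ⟨hT0 j, ?_⟩
    rw [gap_eq_diffSeq]
    exact mul_ne_zero (by split_ifs <;> norm_num) (hd0 j j.2)
  have hgap : ∀ l : Fin k, (diffSeq (natExt T) l)⁻¹ = -(s l / T l) := by
    intro l
    have h1 := hrec l l.2
    rw [natExt_of_lt _ l.2, natExt_of_lt _ l.2] at h1
    have h2 := hd0 l l.2
    have h3 := hT0 l
    change s l * _ + T l = 0 at h1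
    rw [inv_eq_iff_eq_inv, ← neg_div, inv_div, eq_div_iff (neg_ne_zero.2 (hgen l).1)]
    linear_combination -h1
  -- The factorization eliminates the tridiagonal Hessian from the last index upwards. The pivots
  -- are s_l (s_l + 1) / T_l², and the ratios s_l / (s_l + 1) are those of successive coordinates of
  -- T.
  have hM : hessian (logPhase μ 1 T) T = (bidiag (fun l => s l / (s l + 1))).transpose *
      Matrix.diagonal (fun l => s l * (s l + 1) / T l ^ 2) * bidiag (fun l => s l / (s l + 1)) := by
    ext i j
    have hl : ∀ l, ((gap T l)⁻¹) ^ 2 * (gapDeriv l (Pi.single i 1) * gapDeriv l (Pi.single j 1)) =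
        (s l / T l) ^ 2 * (bidiag 1 l i * bidiag 1 l j) := by
      intro l
      rw [gap_eq_diffSeq, mul_inv, hgap, gapDeriv_single, gapDeriv_single]
      simp only [bidiag, Matrix.of_apply, Pi.one_apply]
      split_ifs <;> ring
    have hr : ((bidiag (fun l => s l / (s l + 1))).transpose *
        Matrix.diagonal (fun l => s l * (s l + 1) / T l ^ 2) *
          bidiag (fun l => s l / (s l + 1)) : Matrix (Fin k) (Fin k) ℂ) i j =
        ∑ l : Fin k, (s l * (s l + 1) / T l ^ 2) * (bidiag (fun l => s l / (s l + 1)) l i *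
          bidiag (fun l => s l / (s l + 1)) l j) := by
      rw [Matrix.mul_apply]
      refine Finset.sum_congr rfl fun l _ => ?_
      rw [Matrix.mul_diagonal, Matrix.transpose_apply]
      ring
    -- Equality of the off-diagonal entries: pivot times ratio is the original weight 1 / d_l².
    have hw : ∀ l, s l * (s l + 1) / T l ^ 2 * (s l / (s l + 1)) = (s l / T l) ^ 2 * 1 := by
      intro l
      have := (hgen l).2
      have := hT0 l
      field_simp
    rw [hessian_logPhase μ hp, hr, Finset.sum_congr rfl fun l _ => hl l,
      sum_bidiag (fun l => (s l / T l) ^ 2), sum_bidiag (fun l => s l * (s l + 1) / T l ^ 2)]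
    simp only [hw, Pi.one_apply]
    rw [← add_sub_assoc]
    congr 1
    by_cases hij : i = j
    · simp only [if_pos hij]
      have e1 : ∀ l : Fin k, (if (l : ℕ) = i + 1 then (s l / T l) ^ 2 * 1 ^ 2 else 0) =
          if (l : ℕ) = i + 1 then (natExt s l / natExt T l) ^ 2 else 0 := by
        intro l
        rw [natExt_of_lt _ l.2, natExt_of_lt _ l.2]
        simp
      have e2 : ∀ l : Fin k, (if (l : ℕ) = i + 1 then
          s l * (s l + 1) / T l ^ 2 * (s l / (s l + 1)) ^ 2 else 0) =
          if (l : ℕ) = i + 1 then natExt s l * (natExt s l + 1) / natExt T l ^ 2 *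
            (natExt s l / (natExt s l + 1)) ^ 2 else 0 := by
        intro l
        rw [natExt_of_lt _ l.2, natExt_of_lt _ l.2]
      simp only [e1, e2, sum_ite_succ i (fun l => (natExt s l / natExt T l) ^ 2),
        sum_ite_succ i (fun l => natExt s l * (natExt s l + 1) / natExt T l ^ 2 *
            (natExt s l / (natExt s l + 1)) ^ 2)]
      have hμ := shiftedTail_eq μ i
      rw [← hs] at hμ
      have hTi := hT0 i
      by_cases h : (i : ℕ) + 1 < k
      · simp only [if_pos h] at hμ ⊢
        rw [natExt_of_lt _ h] at hμ
        have h1 := (hgen ⟨i + 1, h⟩).2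
        have h1' := (hgen ⟨i + 1, h⟩).1
        have h2 := hT0 ⟨i + 1, h⟩
        have h3 : T i * s ⟨i + 1, h⟩ = T ⟨i + 1, h⟩ * (s ⟨i + 1, h⟩ + 1) := by
          rw [hT, critPoint_succ μ h]
          rw [← hs]
          field_simp
        rw [natExt_of_lt _ h, natExt_of_lt _ h]
        have h4 : T ⟨i + 1, h⟩ = T i * s ⟨i + 1, h⟩ / (s ⟨i + 1, h⟩ + 1) := by
          rw [eq_div_iff h1, h3]
        -- With μ_i and T_{i+1} expressed by T_i, s_i and s_{i+1}, equality of the diagonal entries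
        -- is a rational identity.
        have hμ' : μ i = s i - s ⟨i + 1, h⟩ - 1 := by linear_combination -hμ
        rw [h4, hμ']
        field_simp
        ring
      · simp only [if_neg h] at hμ ⊢
        rw [show μ i = s i by rw [hμ, add_zero]]
        field_simp
        ring
    · simp only [if_neg hij, add_zero]
  rw [hM, Matrix.det_mul, Matrix.det_mul, Matrix.det_transpose, det_bidiag, Matrix.det_diagonal,
    one_mul, mul_one]
  have hprod : ∏ j ∈ Finset.range k, ((diffSeq (natExt T) j)⁻¹) ^ 2 = ∏ l : Fin k, (s l / T l) ^ 2 := by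
    rw [← Fin.prod_univ_eq_prod_range (fun j => ((diffSeq (natExt T) j)⁻¹) ^ 2)]
    exact Finset.prod_congr rfl fun l _ => by rw [hgap, neg_sq]
  rw [hprod]
  have hlast : (if k = 0 then 1 else (natExt T (k - 1))⁻¹) = ∏ l : Fin k, (s l + 1) / s l := by
    split_ifs with h
    · subst h; simp
    · have hk : k - 1 < k := by omega
      have hI : Finset.Iic (⟨k - 1, hk⟩ : Fin k) = Finset.univ := by
        ext x
        simp only [Finset.mem_Iic, Fin.le_def, Finset.mem_univ, iff_true]
        have := x.2
        omega
      rw [natExt_of_lt _ hk, hT, critPoint, hI, ← Finset.prod_inv_distrib]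
      exact Finset.prod_congr rfl fun l _ => by rw [inv_div]
  rw [hlast, ← Finset.prod_mul_distrib]
  refine Finset.prod_congr rfl fun l _ => ?_
  have := (hgen l).1
  have := hT0 l
  field_simp

end Phase

/-! ### The norm of the Bethe vector -/

section Norm

variable {n k : ℕ} (hk : k ≤ n) (lam : Fin n → ℂ)

lemma vermaRep_chevE_mul_chevF (i j : Fin n) :
    vermaRep lam (chevE i) * vermaRep lam (chevF j) =
      vermaRep lam (chevF j) * vermaRep lam (chevE i) +
        if i = j then vermaRep lam (chevH i) else 0 := by
  have h := congrArg (vermaRep lam) (lie_chevE_chevF i j)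
  rw [LieHom.map_lie, LieRing.of_associative_ring_bracket, sub_eq_iff_eq_add'] at h
  rw [h]
  split_ifs
  · rfl
  · rw [map_zero]

lemma isChevalleySystem_verma : IsChevalleySystem k
    (natExt fun j => vermaRep lam (chevE (Fin.castLE hk j))) (natExt (vermaF hk lam))
    (natExt fun j => vermaRep lam (chevH (Fin.castLE hk j))) where
  e_f i hi j hj := by
    rw [natExt_of_lt _ hi, natExt_of_lt _ hi, natExt_of_lt _ hj, vermaF, vermaRep_chevE_mul_chevF]
    simp only [Fin.ext_iff, Fin.val_castLE]
  h_f i hi j hj := by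
    rw [natExt_of_lt _ hi, natExt_of_lt _ hj]
    exact LinearMap.ext fun x =>
      vermaRep_chevH_chevF lam (Fin.castLE hk ⟨i, hi⟩) (Fin.castLE hk ⟨j, hj⟩) x
  f_f i j hij hj := by
    rw [natExt_of_lt _ hj, natExt_of_lt _ (by omega : i < k)]
    exact commute_vermaF hk lam _ _ hij

lemma dotForm_stdVec {n a b : ℕ} (ha : a ≤ n) (hb : b ≤ n) :
    dotForm n (stdVec n a) (stdVec n b) = if a = b then 1 else 0 := by
  change dotProduct (stdVec n a) (stdVec n b) = _
  rw [stdVec, stdVec, dif_pos (by omega), dif_pos (by omega), single_dotProduct, one_mul,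
    Pi.single_apply]
  simp only [Fin.ext_iff]

/-- The v_m are orthonormal for the dot product, so only the diagonal terms of the double sum
remain. -/
lemma tmul_betheReg (B : LinearMap.BilinForm ℂ (Verma lam)) (t : Fin k → ℂ) :
    LinearMap.BilinForm.tmul B (dotForm n) (betheReg hk lam t) (betheReg hk lam t) =
      ∑ m ∈ Finset.range (k + 1), (∏ j ∈ Finset.range m, (diffSeq (natExt t) j)⁻¹) ^ 2 *
        B (vermaBlock hk lam t m) (vermaBlock hk lam t m) := by
  simp only [betheReg, map_sum, map_smul, LinearMap.sum_apply, LinearMap.smul_apply,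
    LinearMap.BilinForm.tensorDistrib_tmul, smul_eq_mul]
  refine Finset.sum_congr rfl fun m hm => ?_
  rw [Finset.sum_eq_single m]
  · rw [dotForm_stdVec (by have := Finset.mem_range.1 hm; omega)
      (by have := Finset.mem_range.1 hm; omega), if_pos rfl]
    ring
  · intro b hb hbm
    rw [dotForm_stdVec (by have := Finset.mem_range.1 hb; have := Finset.mem_range.1 hm; omega)
      (by have := Finset.mem_range.1 hb; have := Finset.mem_range.1 hm; omega)]
    simp [hbm]
  · exact fun h => absurd hm h

theorem tmul_betheReg_critPoint {μ : Fin k → ℂ} (hμ : μ = fun i => lam (Fin.castLE hk i))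
    (hgen : ∀ i, shiftedTail μ i ≠ 0 ∧ shiftedTail μ i + 1 ≠ 0)
    {B : LinearMap.BilinForm ℂ (Verma lam)} (hB : IsShapovalovForm (vermaRep lam) (vermaVec lam) B) :
    LinearMap.BilinForm.tmul B (dotForm n) (betheReg hk lam (critPoint μ))
      (betheReg hk lam (critPoint μ)) =
      (hessian (logPhase μ 1 (critPoint μ)) (critPoint μ)).det := by
  rw [tmul_betheReg, det_hessian_critPoint hgen]
  refine sum_apply_blockSeq (isChevalleySystem_verma hk lam) (fun r hr => ?_) (fun r hr => ?_)
    (natExt_critPoint_ne_zero hgen) (diffSeq_critPoint_ne_zero hgen) (criticalSeq_critPoint hgen) B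
    (fun i hi x y => ?_) hB.normalized
  · rw [natExt_of_lt _ hr]
    exact vermaRep_chevE lam _
  · rw [natExt_of_lt _ hr, natExt_of_lt _ hr, hμ]
    exact vermaRep_chevH lam _
  · rw [natExt_of_lt _ hi, natExt_of_lt _ hi]
    exact hB.contravariant _ x y

end Norm

end BetheNorm

end

/-! ### The theorem. -/

theorem mainTheorem1 (n k : ℕ) (hk : k ≤ n) (lam : Fin n → ℂ) (μ : Fin k → ℂ)
    (hμ : μ = fun i => lam (Fin.castLE hk i))
    (hgen : ∀ i, BetheNorm.shiftedTail μ i ≠ 0 ∧ BetheNorm.shiftedTail μ i + 1 ≠ 0) :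
    (∀ κ : ℂ, κ ≠ 0 → ∀ t : Fin k → ℂ,
      BetheNorm.IsCriticalPoint μ κ t ↔ t = BetheNorm.critPoint μ) ∧
    (∃! B₁ : LinearMap.BilinForm ℂ (BetheNorm.Verma lam),
      BetheNorm.IsShapovalovForm (BetheNorm.vermaRep lam) (BetheNorm.vermaVec lam) B₁) ∧
    (∃! B₂ : LinearMap.BilinForm ℂ (Fin (n + 1) → ℂ),
      BetheNorm.IsShapovalovForm (BetheNorm.linRep n) (BetheNorm.linVec n) B₂) ∧
    (∃! X, BetheNorm.IsBetheVector hk lam (BetheNorm.critPoint μ) X) ∧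
    (Function.Injective (BetheNorm.critPoint μ) →
      BetheNorm.IsBetheVector hk lam (BetheNorm.critPoint μ)
        (BetheNorm.betheSum hk lam (BetheNorm.critPoint μ))) ∧
    ∀ (B₁ : LinearMap.BilinForm ℂ (BetheNorm.Verma lam))
      (B₂ : LinearMap.BilinForm ℂ (Fin (n + 1) → ℂ)) X,
      BetheNorm.IsShapovalovForm (BetheNorm.vermaRep lam) (BetheNorm.vermaVec lam) B₁ →
      BetheNorm.IsShapovalovForm (BetheNorm.linRep n) (BetheNorm.linVec n) B₂ →
      BetheNorm.IsBetheVector hk lam (BetheNorm.critPoint μ) X →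
      LinearMap.BilinForm.tmul B₁ B₂ X X =
        (BetheNorm.hessian (BetheNorm.logPhase μ 1 (BetheNorm.critPoint μ))
          (BetheNorm.critPoint μ)).det := by
  have h0 := BetheNorm.natExt_critPoint_ne_zero hgen
  have hd := BetheNorm.diffSeq_critPoint_ne_zero hgen
  have hX := BetheNorm.isBetheVector_betheReg hk lam h0 hd
  refine ⟨fun κ hκ t => BetheNorm.isCriticalPoint_iff hgen hκ t,
    BetheNorm.existsUnique_isShapovalovForm_verma lam,
    BetheNorm.existsUnique_isShapovalovForm_linRep n, ⟨_, hX, fun _ h => h.unique hX⟩,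
    fun hinj => ?_, fun B₁ B₂ X hB₁ hB₂ hX' => ?_⟩
  · rw [BetheNorm.betheSum_eq_betheReg hk lam hinj (BetheNorm.critPoint_ne_zero hgen)]
    exact hX
  · rw [hX'.unique hX, hB₂.eq_dotForm]
    exact BetheNorm.tmul_betheReg_critPoint hk lam hμ hgen hB₁
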